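/- Let $\mathbb K$ be $\mathbb R$ or $\mathbb C$, let $n\ge 0$ be an integer and $d=n+1$. **Graphs.** For $N\ge1$, $\mathrm{Gra}_d(N)$ is spanned by directed multigraphs (loops and multiple edges allowed) with vertices $1,\dots,N$ and totally ordered edges, modulo: reversing an edge gives the sign $(-1)^d$, permuting the edges by $\sigma$ gives the sign $\mathrm{sgn}(\sigma)^{d+1}$. $S_N$ acts by relabelling vertices; $\gamma\circ_1\gamma'$ inserts $\gamma'$ in place of the first vertex of $\gamma$ and sums over all ways of reattaching the half-edges of $\gamma$ at that vertex to vertices of $\gamma'$ (edges of $\gamma$ come first). The full graph complex $\mathsf{fGC}_d$ consists of families $(\gamma_{N,k})_{N\ge1,k\ge0}$ where $\gamma_{N,k}$ is a combination of graphs with $N$ vertices and $k$ edges satisfying $\mathrm{sgn}(\sigma)^d\,(\gamma_{N,k}|\sigma)=\gamma_{N,k}$ for $\sigma\in S_N$; a graph with $N$ vertices and $k$ edges has degree $d(N-1)-(d-1)k$. The pre-Lie product is $\gamma\circ\gamma'=\sum_\sigma \mathrm{sgn}(\sigma)^{d}(\gamma\circ_1\gamma'|\sigma)$, over the unshuffles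 $\sigma$ of type $(N',N-1)$; $[\cdot,\cdot]$ is its graded commutator and the differential is $\delta=[\bullet\!\!\to\!\!\bullet,\cdot\,]$. $H^0(\mathsf{fGC}_d)$ is the cohomology in degree $0$. **NP-manifolds.** An NP-manifold of degree $n$ in Darboux coordinates has coordinates $x^\mu$, $p_\mu$, $\psi^\alpha_{(i)}$, $\chi^{(i)}_\alpha$ ($1\le i<n/2$) and, for $n$ even, $\xi^a$, of degrees $0,n,i,n-i,n/2$; the coordinates of degree $0$ range over an open set $U$. Its functions are polynomials in the graded-commuting coordinates of positive degree with coefficients in $C^\infty(U,\mathbb K)$. The symplectic form is $dx^\mu dp_\mu+\sum_i d\psi^\alpha_{(i)}d\chi^{(i)}_\alpha+\tfrac12\kappa_{ab}d\xi^ad\xi^b$, with $\kappa$ constant, invertible and $\kappa_{ab}=-(-1)^{n/2}\kappa_{ba}$. The Poisson bracket, of degree $-n$, is $$\{f,g\}=\sum_{a,b}(-1)^{|f||b|}\,w^{ab}\,\partial_af\,\partial_bg ,$$ where the nonzero entries of $w$ are $w^{x^\mu p_\mu}=1$, $w^{p_\mu x^\mu}=-(-1)^n$, $w^{\psi\chi}=1$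 and $w^{\chi\psi}=-(-1)^{n+i(n-i)}$ for conjugate $\psi=\psi_{(i)}^\alpha,\chi=\chi^{(i)}_\alpha$, and $w^{\xi^a\xi^b}=(\kappa^{-1})_{ab}$. A Hamiltonian function is a function $H$ of degree $n+1$ with $\{H,H\}=0$; then $Q=\{H,\cdot\}$ is a differential and $H^\bullet(C^\infty|Q)$ denotes its cohomology on functions. **Representation and flows.** $\mathrm{Rep}^{(d)}_N(\gamma)(f_1\otimes\cdots\otimes f_N)$ is obtained by applying, for the edges $(i,j)$ of $\gamma$ in order, the operators $\Delta_{ij}=\sum_{a,b}w^{ab}\,\partial_a^{(i)}\partial_b^{(j)}$ to $f_1\otimes\cdots\otimes f_N$ (with Koszul signs; $\partial^{(i)}$ acts on the $i$-th factor; the operators compose as in $\Delta_{e_1}\cdots\Delta_{e_k}$), and then multiplying the factors. This is well defined on $\mathrm{Gra}_d(N)$. A Hamiltonian flow assigns to every Hamiltonian function $H$, on every NP-manifold of degree $n$ as above, a class in $H^{d}(C^\infty|Q)$. It is universal if there is one finite family of elements $g_{N,k}$ of $\mathrm{Gra}_d$ such that, for all NP-manifolds and all $H$, the function $\sum_{N,k}\mathrm{Rep}^{(d)}_N(g_{N,k})(H^{\otimes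 N})$ is a $Q$-cocycle of degree $d$ representing this class. Universal Hamiltonian flows form a vector space $\mathsf{Hflow}$. **Proposition.** (1) For all $N\ge1$, $k\ge0$ there is a linear map $\Phi_{N,k}:H^0(\mathsf{fGC}_d)\to\mathsf{Hflow}$ such that, for each degree-$0$ cocycle $\gamma$, each NP-manifold of degree $n$ and each Hamiltonian function $H$ on it, the function $$\dot H=\mathrm{Rep}^{(d)}_N(\gamma_{N,k})(H^{\otimes N})$$ has degree $d$, satisfies $\{H,\dot H\}=0$, and represents the class $\Phi_{N,k}([\gamma])(H)\in H^{d}(C^\infty|Q)$. Moreover there is a linear map $\Psi$ to $\mathsf{Hflow}$, defined on the subspace of $H^0(\mathsf{fGC}_d)$ formed by the classes of cocycles with only finitely many nonzero components, with $\Psi([\gamma])=\sum_{N,k}\Phi_{N,k}([\gamma])$ for each such cocycle $\gamma$, the sum being over the $(N,k)$ with $\gamma_{N,k}\ne0$. In particular, a cocycle $\gamma$ all of whose graphs have $N$ vertices and $k$ edges is sent to the flow $H\mapsto[\mathrm{Rep}^{(d)}_N(\gamma)(H^{\otimes N})]$. (2) For $n=1$ (so $d=2$) these are flows on Poisson bivectors: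 $\pi\mapsto\tfrac12\pi^{\mu\nu}p_\mu p_\nu$ is a bijection from bivector fields on $U$ to functions of degree $2$, and $\tfrac12\pi^{\mu\nu}p_\mu p_\nu$ is Hamiltonian if and only if $\pi$ is Poisson. For every degree-$0$ cocycle $\gamma$ of $\mathsf{fGC}_2$, all $N,k$, and every Poisson bivector $\pi$ with $H=\tfrac12\pi^{\mu\nu}p_\mu p_\nu$, one has $\mathrm{Rep}^{(2)}_N(\gamma_{N,k})(H^{\otimes N})=\tfrac12\dot\pi^{\mu\nu}p_\mu p_\nu$ for a bivector field $\dot\pi$ with $[\pi,\dot\pi]_{\mathrm S}=0$ (Schouten bracket). These are Kontsevich's flows; the tetrahedral flow is the one given by the tetrahedron graph. -/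

import Mathlib

noncomputable section

namespace NPGraph

/-! ### Graphs and the graph operad -/

/-- Labelled multidigraphs with `N` vertices and `k` directed edges (loops and multiple edges
allowed): the edge with label `e` goes from `(γ e).1` to `(γ e).2`. -/
abbrev Multidigraph (N k : ℕ) : Type := Fin k → Fin N × Fin N

/-- Flip the direction of the edge `e`. -/
def flipEdge {N k : ℕ} (e : Fin k) (γ : Multidigraph N k) : Multidigraph N k :=
  Function.update γ e (γ e).swap

/-- The sign of a permutation as a scalar. -/
def sgn (K : Type*) [Field K] {k : ℕ} (σ : Equiv.Perm (Fin k)) : K :=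
  ((Equiv.Perm.sign σ : ℤ) : K)

/-- The class of a graph in the vector space spanned by all graphs. -/
def gr (K : Type*) [Field K] {N k : ℕ} (γ : Multidigraph N k) : Multidigraph N k →₀ K :=
  Finsupp.single γ 1

/-- The relations imposed in `Gra_d(N)`: flipping an edge gives the sign `(-1)^d`, and permuting
the labels of the edges gives the sign `sgn(σ)^(d+1)`. -/
def graRel (K : Type*) [Field K] (d N k : ℕ) : Submodule K (Multidigraph N k →₀ K) :=
  Submodule.span K
    ({z | ∃ (e : Fin k) (γ : Multidigraph N k), z = gr K (flipEdge e γ) - (-1 : K) ^ d • gr K γ} ∪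
     {z | ∃ (σ : Equiv.Perm (Fin k)) (γ : Multidigraph N k),
        z = gr K (γ ∘ σ) - sgn K σ ^ (d + 1) • gr K γ})

/-- The part of `Gra_d(N)` spanned by graphs with `k` edges: the coinvariants of the span of the
graphs under `S_k ⋉ S_2^k`, twisted by `sgn_k` for `d` even and by `sgn_2^{⊗ k}` for `d` odd. -/
def Gra (K : Type*) [Field K] (d N k : ℕ) : Type _ :=
  (Multidigraph N k →₀ K) ⧸ graRel K d N k

instance (K : Type*) [Field K] (d N k : ℕ) : AddCommGroup (Gra K d N k) :=
  inferInstanceAs (AddCommGroup ((Multidigraph N k →₀ K) ⧸ graRel K d N k))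

instance (K : Type*) [Field K] (d N k : ℕ) : Module K (Gra K d N k) :=
  inferInstanceAs (Module K ((Multidigraph N k →₀ K) ⧸ graRel K d N k))

/-- The quotient map onto `Gra_d(N)`. -/
def Gra.proj (K : Type*) [Field K] (d N k : ℕ) : (Multidigraph N k →₀ K) →ₗ[K] Gra K d N k :=
  (graRel K d N k).mkQ

/-- The class of a graph in `Gra_d(N)`. -/
def Gra.mk (K : Type*) [Field K] (d : ℕ) {N k : ℕ} (γ : Multidigraph N k) : Gra K d N k :=
  Gra.proj K d N k (gr K γ)

theorem Gra.mk_flipEdge {K : Type*} [Field K] {d : ℕ} {N k : ℕ} (e : Fin k) (γ : Multidigraph N k) :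
    Gra.mk K d (flipEdge e γ) = (-1 : K) ^ d • Gra.mk K d γ := by
  unfold Gra.mk
  rw [← map_smul, ← sub_eq_zero, ← map_sub]
  exact (Submodule.Quotient.mk_eq_zero _).2 <| Submodule.subset_span (Or.inl ⟨e, γ, rfl⟩)

theorem Gra.mk_comp_perm {K : Type*} [Field K] {d : ℕ} {N k : ℕ} (σ : Equiv.Perm (Fin k)) (γ : Multidigraph N k) :
    Gra.mk K d (γ ∘ σ) = sgn K σ ^ (d + 1) • Gra.mk K d γ := by
  unfold Gra.mk
  rw [← map_smul, ← sub_eq_zero, ← map_sub]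
  exact (Submodule.Quotient.mk_eq_zero _).2 <| Submodule.subset_span (Or.inr ⟨σ, γ, rfl⟩)

/-- A linear map on the span of graphs descends to `Gra_d(N)` as soon as it is compatible with
flips and with permutations of edges. -/
theorem graRel_le_ker {K : Type*} [Field K] {d : ℕ} {N k : ℕ} {W : Type*} [AddCommGroup W] [Module K W]
    (f : (Multidigraph N k →₀ K) →ₗ[K] W)
    (h₁ : ∀ e γ, f (gr K (flipEdge e γ)) = (-1 : K) ^ d • f (gr K γ))
    (h₂ : ∀ (σ : Equiv.Perm (Fin k)) γ, f (gr K (γ ∘ σ)) = sgn K σ ^ (d + 1) • f (gr K γ)) :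
    graRel K d N k ≤ LinearMap.ker f := by
  refine Submodule.span_le.2 ?_
  rintro z (⟨e, γ, rfl⟩ | ⟨σ, γ, rfl⟩)
  · simp [h₁]
  · simp [h₂]

/-- Replace every vertex `v` by `π v`. -/
def mapVert {N N' k : ℕ} (π : Fin N → Fin N') (γ : Multidigraph N k) : Multidigraph N' k :=
  fun e => Prod.map π π (γ e)

theorem mapVert_flipEdge {N N' k : ℕ} (π : Fin N → Fin N') (e : Fin k) (γ : Multidigraph N k) :
    mapVert π (flipEdge e γ) = flipEdge e (mapVert π γ) := by
  funext i
  by_cases h : i = e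
  · subst h; simp [mapVert, flipEdge, Prod.map, Prod.swap]
  · simp [mapVert, flipEdge, h]

/-- The right action of `S_N` on `Gra_d(N)`: the vertex with label `v` gets the label `σ⁻¹ v`. -/
def relabel (K : Type*) [Field K] (d : ℕ) {N k : ℕ} (σ : Equiv.Perm (Fin N)) :
    Gra K d N k →ₗ[K] Gra K d N k :=
  (graRel K d N k).liftQ
    (Finsupp.linearCombination K fun γ : Multidigraph N k => Gra.mk K d (mapVert (⇑σ⁻¹) γ))
    (graRel_le_ker _
      (fun e γ => by simp [gr, mapVert_flipEdge, Gra.mk_flipEdge])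
      (fun τ γ => by
        have : mapVert (⇑σ⁻¹) (γ ∘ τ) = mapVert (⇑σ⁻¹) γ ∘ τ := rfl
        simp only [gr, Finsupp.linearCombination_single, one_smul, this, Gra.mk_comp_perm]))

/-- The map of vertex sets that collapses the first `N'` vertices to the first vertex and shifts
the others down accordingly. -/
def collapse {M N' L : ℕ} (h : N' + M = L) (v : Fin L) : Fin (M + 1) :=
  if hv : (v : ℕ) < N' then 0 else ⟨v - N' + 1, by have := v.2; omega⟩

/-- Put the edges of `G` first, then those of `G'`. -/
def appendEdges {L j k l : ℕ} (h : j + k = l) (G : Multidigraph L j) (G' : Multidigraph L k) :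
    Multidigraph L l :=
  Fin.append G G' ∘ Fin.cast h.symm

theorem appendEdges_flip_left {L j k l : ℕ} (h : j + k = l) (G : Multidigraph L j)
    (G' : Multidigraph L k) (e : Fin j) :
    appendEdges h (flipEdge e G) G' =
      flipEdge (Fin.cast h (Fin.castAdd k e)) (appendEdges h G G') := by
  subst h
  funext i
  refine Fin.addCases (fun a => ?_) (fun b => ?_) i
  · by_cases ha : a = e
    · subst ha; simp [appendEdges, flipEdge]
    · simp [appendEdges, flipEdge, ha]
  · have : Fin.natAdd j b ≠ Fin.castAdd k e := by
      intro hh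
      have := congrArg Fin.val hh
      simp at this; omega
    simp [appendEdges, flipEdge, this]

theorem appendEdges_flip_right {L j k l : ℕ} (h : j + k = l) (G : Multidigraph L j)
    (G' : Multidigraph L k) (e : Fin k) :
    appendEdges h G (flipEdge e G') =
      flipEdge (Fin.cast h (Fin.natAdd j e)) (appendEdges h G G') := by
  subst h
  funext i
  refine Fin.addCases (fun a => ?_) (fun b => ?_) i
  · have : Fin.castAdd k a ≠ Fin.natAdd j e := by
      intro hh
      have := congrArg Fin.val hh
      simp at this; omega
    simp [appendEdges, flipEdge, this]
  · by_cases hb : b = e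
    · subst hb; simp [appendEdges, flipEdge]
    · simp [appendEdges, flipEdge, hb]

theorem mk_appendEdges_perm {K : Type*} [Field K] {d : ℕ} {L j k l : ℕ} (h : j + k = l) (G : Multidigraph L j)
    (G' : Multidigraph L k) (σ : Equiv.Perm (Fin j)) (τ : Equiv.Perm (Fin k)) :
    Gra.mk K d (appendEdges h (G ∘ σ) (G' ∘ τ)) =
      (sgn K σ * sgn K τ) ^ (d + 1) • Gra.mk K d (appendEdges h G G') := by
  subst h
  have key : appendEdges rfl (G ∘ σ) (G' ∘ τ) =
      appendEdges rfl G G' ∘ (finSumFinEquiv.permCongr (Equiv.Perm.sumCongr σ τ)) := by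
    funext i
    refine Fin.addCases (fun a => ?_) (fun b => ?_) i
    · simp [appendEdges, Equiv.permCongr_apply]
    · simp [appendEdges, Equiv.permCongr_apply]
  rw [key, Gra.mk_comp_perm]
  congr 2
  simp [sgn]

/-- The partial composition `γ ∘₁ γ'` of graphs: insert `γ'` in place of the first vertex of `γ` and
sum over all ways of reconnecting the half-edges of `γ` at that vertex to vertices of `γ'`.  A way of
reconnecting is the same as a graph `G` with the edges of `γ` on the new vertex set that becomes `γ`
when the vertices of `γ'` are collapsed to one.  The vertices of `γ'` come first, then the remaining
vertices of `γ`; the edges of `γ` come before the edges of `γ'`. -/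
def insertGraph (K : Type*) [Field K] (d : ℕ) {M N' L j k l : ℕ} (h : N' + M = L) (hl : j + k = l)
    (γ : Multidigraph (M + 1) j) (γ' : Multidigraph N' k) : Gra K d L l :=
  ∑ G ∈ Finset.univ.filter (fun G : Multidigraph L j => mapVert (collapse h) G = γ),
    Gra.mk K d (appendEdges hl G (mapVert (Fin.castLE (by omega)) γ'))

theorem flipEdge_flipEdge {N k : ℕ} (e : Fin k) (γ : Multidigraph N k) :
    flipEdge e (flipEdge e γ) = γ := by
  simp [flipEdge]

theorem insertGraph_flip_left {K : Type*} [Field K] {d : ℕ} {M N' L j k l : ℕ} (h : N' + M = L) (hl : j + k = l)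
    (γ : Multidigraph (M + 1) j) (γ' : Multidigraph N' k) (e : Fin j) :
    insertGraph K d h hl (flipEdge e γ) γ' = (-1 : K) ^ d • insertGraph K d h hl γ γ' := by
  unfold insertGraph
  rw [Finset.smul_sum]
  refine Finset.sum_bij' (fun G _ => flipEdge e G) (fun G _ => flipEdge e G) ?_ ?_ ?_ ?_ ?_
  · intro G hG
    simp only [Finset.mem_filter, Finset.mem_univ, true_and] at hG ⊢
    rw [mapVert_flipEdge, hG, flipEdge_flipEdge]
  · intro G hG
    simp only [Finset.mem_filter, Finset.mem_univ, true_and] at hG ⊢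
    rw [mapVert_flipEdge, hG]
  · intro G _; exact flipEdge_flipEdge e G
  · intro G _; exact flipEdge_flipEdge e G
  · intro G _
    rw [appendEdges_flip_left, Gra.mk_flipEdge, smul_smul, ← mul_pow]
    simp

theorem insertGraph_flip_right {K : Type*} [Field K] {d : ℕ} {M N' L j k l : ℕ} (h : N' + M = L) (hl : j + k = l)
    (γ : Multidigraph (M + 1) j) (γ' : Multidigraph N' k) (e : Fin k) :
    insertGraph K d h hl γ (flipEdge e γ') = (-1 : K) ^ d • insertGraph K d h hl γ γ' := by
  unfold insertGraph
  rw [Finset.smul_sum]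
  refine Finset.sum_congr rfl fun G _ => ?_
  rw [mapVert_flipEdge, appendEdges_flip_right, Gra.mk_flipEdge]

theorem insertGraph_perm_left {K : Type*} [Field K] {d : ℕ} {M N' L j k l : ℕ} (h : N' + M = L) (hl : j + k = l)
    (γ : Multidigraph (M + 1) j) (γ' : Multidigraph N' k) (σ : Equiv.Perm (Fin j)) :
    insertGraph K d h hl (γ ∘ σ) γ' = sgn K σ ^ (d + 1) • insertGraph K d h hl γ γ' := by
  unfold insertGraph
  rw [Finset.smul_sum]
  refine Finset.sum_bij' (fun G _ => G ∘ ⇑σ⁻¹) (fun G _ => G ∘ ⇑σ) ?_ ?_ ?_ ?_ ?_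
  · intro G hG
    simp only [Finset.mem_filter, Finset.mem_univ, true_and] at hG ⊢
    have : mapVert (collapse h) (G ∘ ⇑σ⁻¹) = mapVert (collapse h) G ∘ ⇑σ⁻¹ := rfl
    rw [this, hG]
    funext i; simp
  · intro G hG
    simp only [Finset.mem_filter, Finset.mem_univ, true_and] at hG ⊢
    rw [← hG]; rfl
  · intro G _; funext i; simp
  · intro G _; funext i; simp
  · intro G _
    have := mk_appendEdges_perm (K := K) (d := d) hl (G ∘ ⇑σ⁻¹)
      (mapVert (Fin.castLE (by omega : N' ≤ L)) γ') σ 1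
    have e1 : (G ∘ ⇑σ⁻¹) ∘ ⇑σ = G := by funext i; simp
    rw [e1] at this
    simpa [sgn] using this

theorem insertGraph_perm_right {K : Type*} [Field K] {d : ℕ} {M N' L j k l : ℕ} (h : N' + M = L) (hl : j + k = l)
    (γ : Multidigraph (M + 1) j) (γ' : Multidigraph N' k) (σ : Equiv.Perm (Fin k)) :
    insertGraph K d h hl γ (γ' ∘ σ) = sgn K σ ^ (d + 1) • insertGraph K d h hl γ γ' := by
  unfold insertGraph
  rw [Finset.smul_sum]
  refine Finset.sum_congr rfl fun G _ => ?_
  have := mk_appendEdges_perm (K := K) (d := d) hl G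
      (mapVert (Fin.castLE (by omega : N' ≤ L)) γ') 1 σ
  have e1 : mapVert (Fin.castLE (by omega : N' ≤ L)) (γ' ∘ ⇑σ) =
      mapVert (Fin.castLE (by omega : N' ≤ L)) γ' ∘ ⇑σ := rfl
  rw [e1]
  simpa [sgn] using this

/-- The partial composition `∘₁ : Gra_d(M+1) ⊗ Gra_d(N') → Gra_d(M+N')`. -/
def insertFirst (K : Type*) [Field K] (d : ℕ) {M N' L j k l : ℕ} (h : N' + M = L) (hl : j + k = l) :
    Gra K d (M + 1) j →ₗ[K] Gra K d N' k →ₗ[K] Gra K d L l :=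
  LinearMap.liftQ₂ _ _
    (Finsupp.linearCombination K fun γ : Multidigraph (M + 1) j =>
      Finsupp.linearCombination K fun γ' : Multidigraph N' k => insertGraph K d h hl γ γ')
    (graRel_le_ker _
      (fun e γ => by
        refine Finsupp.lhom_ext' fun γ' => LinearMap.ext_ring ?_
        simp [gr, insertGraph_flip_left])
      (fun σ γ => by
        refine Finsupp.lhom_ext' fun γ' => LinearMap.ext_ring ?_
        simp [gr, insertGraph_perm_left]))
    (graRel_le_ker _
      (fun e γ' => by
        refine Finsupp.lhom_ext' fun γ => LinearMap.ext_ring ?_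
        simp [gr, insertGraph_flip_right])
      (fun σ γ' => by
        refine Finsupp.lhom_ext' fun γ => LinearMap.ext_ring ?_
        simp [gr, insertGraph_perm_right]))

/-! ### The full graph complex -/

/-- Unshuffles of type `(p, N - p)`: `σ⁻¹` is increasing on the first `p` labels and on the
remaining ones. -/
def IsUnshuffle (p : ℕ) {N : ℕ} (σ : Equiv.Perm (Fin N)) : Prop :=
  ∀ a b : Fin N, a < b → ((b : ℕ) < p ∨ p ≤ (a : ℕ)) → σ⁻¹ a < σ⁻¹ b

open Classical in
/-- The pre-Lie product `γ ∘ γ'` of an element with `M+1` vertices and one with `M'+1` vertices: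
the sum of `(-1)^{d|σ|} Σ(γ ∘₁ γ' | σ)` over the unshuffles `σ` of type `(M'+1, M)`. -/
def preLie (K : Type*) [Field K] (d : ℕ) {M M' P j k l : ℕ} (hP : M + M' = P) (hl : j + k = l) :
    Gra K d (M + 1) j →ₗ[K] Gra K d (M' + 1) k →ₗ[K] Gra K d (P + 1) l :=
  ∑ σ ∈ Finset.univ.filter (fun σ : Equiv.Perm (Fin (P + 1)) => IsUnshuffle (M' + 1) σ),
    sgn K σ ^ d •
      (insertFirst K d (show M' + 1 + M = P + 1 by omega) hl).compr₂ (relabel K d σ)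

/-- The degree in `fGC_d` of a graph with `M+1` vertices and `k` edges. -/
def graphDegree (d M k : ℕ) : ℤ := (d : ℤ) * M + k * (1 - (d : ℤ))

/-- The graded commutator of the pre-Lie product. -/
def graphBracket (K : Type*) [Field K] (d : ℕ) {M M' P j k l : ℕ} (hP : M + M' = P)
    (hl : j + k = l) :
    Gra K d (M + 1) j →ₗ[K] Gra K d (M' + 1) k →ₗ[K] Gra K d (P + 1) l :=
  preLie K d hP hl -
    (((graphDegree d M j * graphDegree d M' k).negOnePow : ℤ) : K) •
      (preLie K d (show M' + M = P by omega) (show k + j = l by omega)).flip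

/-- The graph with two vertices and a single edge from the first to the second. -/
def edgeGraph (K : Type*) [Field K] (d : ℕ) : Gra K d (1 + 1) 1 :=
  Gra.mk K d (fun _ => (0, 1))

/-- Families of elements of `Gra_d(N)`, `N ≥ 1`: the entry with index `M`, `k` is the component with
`M + 1` vertices and `k` edges. -/
abbrev GraphSeries (K : Type*) [Field K] (d : ℕ) : Type _ := ∀ M k : ℕ, Gra K d (M + 1) k

/-- The differential `δ = [edge, ·]`; it adds one vertex and one edge. -/
def graphDiff (K : Type*) [Field K] (d : ℕ) : GraphSeries K d →ₗ[K] GraphSeries K d where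
  toFun γ M k :=
    match M, k with
    | M + 1, k + 1 =>
        graphBracket K d (Nat.add_comm 1 M) (Nat.add_comm 1 k) (edgeGraph K d) (γ M k)
    | _, _ => 0
  map_add' γ γ' := by
    funext M k
    rcases M with _ | M <;> rcases k with _ | k <;> simp
  map_smul' c γ := by
    funext M k
    rcases M with _ | M <;> rcases k with _ | k <;> simp

/-- The homogeneous part of degree `m` of `fGC_d`: families of invariants for the action of `S_N`
(twisted by `sgn_N` for `d` odd) whose components are concentrated in degree `m`. -/
def fGC (K : Type*) [Field K] (d : ℕ) (m : ℤ) : Submodule K (GraphSeries K d) where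
  carrier := {γ | ∀ M k, (graphDegree d M k ≠ m → γ M k = 0) ∧
    ∀ σ : Equiv.Perm (Fin (M + 1)), sgn K σ ^ d • relabel K d σ (γ M k) = γ M k}
  add_mem' {γ γ'} h h' M k := by
    refine ⟨fun hm => by simp [(h M k).1 hm, (h' M k).1 hm], fun σ => ?_⟩
    rw [Pi.add_apply, Pi.add_apply, map_add, smul_add, (h M k).2 σ, (h' M k).2 σ]
  zero_mem' M k := by simp
  smul_mem' c γ h M k := by
    refine ⟨fun hm => by simp [(h M k).1 hm], fun σ => ?_⟩
    rw [Pi.smul_apply, Pi.smul_apply, map_smul, smul_comm, (h M k).2 σ]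

/-- Cocycles of degree `m` of the full graph complex. -/
def graphCocycles (K : Type*) [Field K] (d : ℕ) (m : ℤ) : Submodule K (GraphSeries K d) :=
  fGC K d m ⊓ LinearMap.ker (graphDiff K d)

/-- Coboundaries of degree `m` of the full graph complex. -/
def graphCoboundaries (K : Type*) [Field K] (d : ℕ) (m : ℤ) : Submodule K (GraphSeries K d) :=
  (fGC K d (m - 1)).map (graphDiff K d)

/-- The cohomology `H^m(fGC_d)`. -/
abbrev GraphCohomology (K : Type*) [Field K] (d : ℕ) (m : ℤ) : Type _ :=
  graphCocycles K d m ⧸ (graphCoboundaries K d m).submoduleOf (graphCocycles K d m)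

/-- The cohomology class of a cocycle. -/
def graphClass (K : Type*) [Field K] (d : ℕ) (m : ℤ) :
    graphCocycles K d m →ₗ[K] GraphCohomology K d m :=
  Submodule.mkQ _

/-- A family of graphs only finitely many of whose components are nonzero. -/
def IsFinite {K : Type*} [Field K] {d : ℕ} (γ : GraphSeries K d) : Prop :=
  {q : ℕ × ℕ | γ q.1 q.2 ≠ 0}.Finite

/-- The classes in `H^m(fGC_d)` of the cocycles that are finite sums of graphs, that is, of finite
sums of cocycles with a fixed number of vertices. -/
def finiteClasses (K : Type*) [Field K] (d : ℕ) (m : ℤ) : Submodule K (GraphCohomology K d m) where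
  carrier := {c | ∃ γ : graphCocycles K d m, IsFinite γ.1 ∧ graphClass K d m γ = c}
  add_mem' := by
    rintro _ _ ⟨γ, h, rfl⟩ ⟨γ', h', rfl⟩
    refine ⟨γ + γ', (h.union h').subset fun q hq => ?_, map_add _ _ _⟩
    by_contra hc
    simp only [Set.mem_union, Set.mem_ofPred_eq, not_or, not_not] at hc
    exact hq (by simp [hc.1, hc.2])
  zero_mem' := ⟨0, by simp [IsFinite], map_zero _⟩
  smul_mem' := by
    rintro c _ ⟨γ, h, rfl⟩
    refine ⟨c • γ, h.subset fun q hq => ?_, map_smul _ _ _⟩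
    intro hc
    exact hq (by simp [hc])

end NPGraph

namespace NPGraph

/-! ### Graded symplectic charts -/

/-- Darboux coordinates of degree `n`: `x^μ` and `p_μ` for `μ < m`; `ψ^α` and `χ_α` for
`α < r i`, one family for each `i` with `1 ≤ i` and `2 i < n` (the index `i : Fin ((n-1)/2)` stands
for the degree `i + 1`); `ξ^a` for `a < s`. -/
inductive Coord (n m : ℕ) (r : Fin ((n - 1) / 2) → ℕ) (s : ℕ) : Type
  | x (μ : Fin m)
  | p (μ : Fin m)
  | psi (i : Fin ((n - 1) / 2)) (α : Fin (r i))
  | chi (i : Fin ((n - 1) / 2)) (α : Fin (r i))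
  | xi (a : Fin s)
  deriving DecidableEq, Fintype

/-- The degrees of the coordinates: `0`, `n`, `i`, `n - i` and `n / 2`. -/
def Coord.deg {n m : ℕ} {r : Fin ((n - 1) / 2) → ℕ} {s : ℕ} : Coord n m r s → ℕ
  | .x _ => 0
  | .p _ => n
  | .psi i _ => (i : ℕ) + 1
  | .chi i _ => n - ((i : ℕ) + 1)
  | .xi _ => n / 2

/-- An `NP`-manifold of degree `n` in Darboux coordinates: numbers of coordinates of each kind, an
open set `U` in the space of coordinates of degree zero, and the constant matrix `κ_{ab}` of the form
`½ κ_{ab} dξ^a dξ^b`, where coordinates `ξ^a` only occur for `n` even. The symplectic form is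
`dx^μ dp_μ + Σ_i dψ^α dχ_α + ½ κ_{ab} dξ^a dξ^b`. -/
structure NPChart (𝕜 : Type*) [RCLike 𝕜] (n : ℕ) where
  m : ℕ
  r : Fin ((n - 1) / 2) → ℕ
  s : ℕ
  s_eq_zero : Odd n → s = 0
  κ : Matrix (Fin s) (Fin s) 𝕜
  isUnit_κ : IsUnit κ
  κ_symm : ∀ a b, κ a b = -(-1) ^ (n / 2) * κ b a
  U : Set ({c : Coord n m r s // c.deg = 0} → ℝ)
  isOpen_U : IsOpen U

namespace NPChart

variable {𝕜 : Type*} [RCLike 𝕜] {n : ℕ} (V : NPChart 𝕜 n)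

/-- The coordinates of the chart. -/
abbrev Ix : Type := Coord n V.m V.r V.s

/-- Coordinates of degree zero. -/
abbrev BodyIx : Type := {c : V.Ix // c.deg = 0}

/-- Coordinates of even positive degree. -/
abbrev EvenIx : Type := {c : V.Ix // c.deg ≠ 0 ∧ Even c.deg}

/-- Coordinates of odd degree. -/
abbrev OddIx : Type := {c : V.Ix // Odd c.deg}

/-- Extension by zero of a function on `U`. -/
def ext (f : V.U → 𝕜) : (V.BodyIx → ℝ) → 𝕜 := Function.extend Subtype.val f 0

theorem ext_apply (f : V.U → 𝕜) (x : V.U) : V.ext f x = f x :=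
  Subtype.val_injective.extend_apply _ _ _

/-- The algebra of smooth functions on `U`. -/
def Smooth : Subalgebra 𝕜 (V.U → 𝕜) where
  carrier := {f | ContDiffOn ℝ (⊤ : ℕ∞) (V.ext f) V.U}
  mul_mem' {f g} hf hg := by
    refine (ContDiffOn.mul hf hg).congr fun x hx => ?_
    have h := fun f => V.ext_apply f ⟨x, hx⟩
    simp only at h
    simp [h]
  add_mem' {f g} hf hg := by
    refine (ContDiffOn.add hf hg).congr fun x hx => ?_
    have h := fun f => V.ext_apply f ⟨x, hx⟩
    simp only at h
    simp [h]
  algebraMap_mem' c := by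
    refine (contDiffOn_const (c := c)).congr fun x hx => ?_
    have h := fun f => V.ext_apply f ⟨x, hx⟩
    simp only at h
    simp [h]

theorem contDiffOn_ext (f : V.Smooth) : ContDiffOn ℝ (⊤ : ℕ∞) (V.ext f.1) V.U := f.2

theorem differentiableAt_ext (f : V.Smooth) (x : V.U) : DifferentiableAt ℝ (V.ext f.1) x :=
  ((V.contDiffOn_ext f).differentiableOn (by simp)).differentiableAt (V.isOpen_U.mem_nhds x.2)

theorem ext_eventuallyEq (f : V.U → 𝕜) (F : (V.BodyIx → ℝ) → 𝕜) (h : ∀ y : V.U, f y = F y)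
    (x : V.U) : V.ext f =ᶠ[nhds (x : V.BodyIx → ℝ)] F := by
  filter_upwards [V.isOpen_U.mem_nhds x.2] with y hy
  rw [← h ⟨y, hy⟩]
  exact V.ext_apply f ⟨y, hy⟩

/-- The partial derivative of a smooth function on `U` along a coordinate of degree zero. -/
def pd (c : V.BodyIx) : V.Smooth →ₗ[𝕜] V.Smooth where
  toFun f := ⟨fun x => fderiv ℝ (V.ext f.1) x (Pi.single c 1), by
    have h1 : ContDiffOn ℝ (⊤ : ℕ∞) (fun x => fderiv ℝ (V.ext f.1) x (Pi.single c 1)) V.U :=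
      ((V.contDiffOn_ext f).fderiv_of_isOpen V.isOpen_U (by simp)).clm_apply contDiffOn_const
    exact h1.congr fun x hx => V.ext_apply _ ⟨x, hx⟩⟩
  map_add' f g := by
    ext x
    have h : V.ext (f + g).1 =ᶠ[nhds (x : V.BodyIx → ℝ)] V.ext f.1 + V.ext g.1 :=
      V.ext_eventuallyEq _ _ (fun y => by simp [V.ext_apply]) x
    simp only [h.fderiv_eq]
    rw [fderiv_add (V.differentiableAt_ext f x) (V.differentiableAt_ext g x)]
    rfl
  map_smul' c f := by
    ext x
    have h : V.ext (c • f).1 =ᶠ[nhds (x : V.BodyIx → ℝ)] c • V.ext f.1 :=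
      V.ext_eventuallyEq _ _ (fun y => by simp [V.ext_apply]) x
    simp only [h.fderiv_eq]
    rw [fderiv_const_smul (V.differentiableAt_ext f x)]
    rfl

theorem pd_comm (c c' : V.BodyIx) (f : V.Smooth) : V.pd c (V.pd c' f) = V.pd c' (V.pd c f) := by
  ext x
  have hx := V.isOpen_U.mem_nhds x.2
  have hf : ContDiffAt ℝ (⊤ : ℕ∞) (V.ext f.1) x := (V.contDiffOn_ext f).contDiffAt hx
  have hd : DifferentiableAt ℝ (fderiv ℝ (V.ext f.1)) x :=
    ((hf.fderiv_right (m := 1) (by norm_cast)).differentiableAt (by simp))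
  have key : ∀ a b : V.BodyIx, (V.pd a (V.pd b f)).1 x =
      fderiv ℝ (fderiv ℝ (V.ext f.1)) x (Pi.single a 1) (Pi.single b 1) := by
    intro a b
    have h : V.ext (V.pd b f).1 =ᶠ[nhds (x : V.BodyIx → ℝ)]
        fun y => fderiv ℝ (V.ext f.1) y (Pi.single b 1) :=
      V.ext_eventuallyEq (V.pd b f).1 (fun y => fderiv ℝ (V.ext f.1) y (Pi.single b 1))
        (fun y => rfl) x
    change fderiv ℝ (V.ext (V.pd b f).1) x (Pi.single a 1) = _
    rw [h.fderiv_eq, fderiv_clm_apply hd (differentiableAt_const _)]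
    simp
  rw [key, key]
  have hs : IsSymmSndFDerivAt ℝ (V.ext f.1) x :=
    hf.isSymmSndFDerivAt (by simpa using (by exact_mod_cast le_top : ((2 : ℕ∞) : WithTop ℕ∞) ≤ ((⊤ : ℕ∞) : WithTop ℕ∞)))
  exact hs _ _

open TensorProduct

/-- Polynomials in the coordinates of even positive degree with coefficients smooth functions of the
coordinates of degree zero. -/
def EvenFun : Type _ := V.Smooth ⊗[𝕜] MvPolynomial V.EvenIx 𝕜

instance : CommRing V.EvenFun := inferInstanceAs (CommRing (V.Smooth ⊗[𝕜] MvPolynomial V.EvenIx 𝕜))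

instance : Algebra 𝕜 V.EvenFun :=
  inferInstanceAs (Algebra 𝕜 (V.Smooth ⊗[𝕜] MvPolynomial V.EvenIx 𝕜))

/-- The exterior algebra generated by the coordinates of odd degree. -/
abbrev OddFun : Type _ := ExteriorAlgebra 𝕜 (V.OddIx →₀ 𝕜)

/-- The algebra of functions on the chart: polynomials in the coordinates of even positive degree and
in the anticommuting coordinates of odd degree, with coefficients smooth functions of the coordinates
of degree zero. -/
def Fun : Type _ := V.EvenFun ⊗[𝕜] V.OddFun

instance : Ring V.Fun := inferInstanceAs (Ring (V.EvenFun ⊗[𝕜] V.OddFun))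

instance : Algebra 𝕜 V.Fun := inferInstanceAs (Algebra 𝕜 (V.EvenFun ⊗[𝕜] V.OddFun))

/-- The function `a ω` for `a` in the even part and `ω` in the odd part. -/
def tmul (a : V.EvenFun) (ω : V.OddFun) : V.Fun := a ⊗ₜ[𝕜] ω

/-- The linear map `a ω ↦ φ(a) ω` for `φ` acting on the even part. -/
def onEven (φ : V.EvenFun →ₗ[𝕜] V.EvenFun) : V.Fun →ₗ[𝕜] V.Fun :=
  (TensorProduct.map φ LinearMap.id : V.EvenFun ⊗[𝕜] V.OddFun →ₗ[𝕜] V.EvenFun ⊗[𝕜] V.OddFun)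

/-- The linear map `a ω ↦ a φ(ω)` for `φ` acting on the odd part. -/
def onOdd (φ : V.OddFun →ₗ[𝕜] V.OddFun) : V.Fun →ₗ[𝕜] V.Fun :=
  (TensorProduct.map LinearMap.id φ : V.EvenFun ⊗[𝕜] V.OddFun →ₗ[𝕜] V.EvenFun ⊗[𝕜] V.OddFun)

/-- The odd coordinate `θ_c` as an element of the exterior algebra. -/
def theta (c : V.OddIx) : V.OddFun := ExteriorAlgebra.ι 𝕜 (Finsupp.single c 1)

/-- The function `f(x) y^e` of the even coordinates. -/
def evenMono (f : V.Smooth) (e : V.EvenIx →₀ ℕ) : V.EvenFun :=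
  f ⊗ₜ[𝕜] MvPolynomial.monomial e (1 : 𝕜)

/-- The monomial function `f(x) y^e θ_{c₁} ⋯ θ_{c_l}`. -/
def mono (f : V.Smooth) (e : V.EvenIx →₀ ℕ) (l : List V.OddIx) : V.Fun :=
  V.tmul (V.evenMono f e) (l.map V.theta).prod

/-- Homogeneous functions of degree `k`. -/
def homog (k : ℕ) : Submodule 𝕜 V.Fun :=
  Submodule.span 𝕜 {F | ∃ f e l, F = V.mono f e l ∧
    (e.sum fun c i => i * c.1.deg) + (l.map fun c => c.1.deg).sum = k}

/-- The derivative of an even function along a coordinate of degree zero. -/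
def evenPd (c : V.BodyIx) : V.EvenFun →ₗ[𝕜] V.EvenFun :=
  (TensorProduct.map (V.pd c) LinearMap.id :
    V.Smooth ⊗[𝕜] MvPolynomial V.EvenIx 𝕜 →ₗ[𝕜] V.Smooth ⊗[𝕜] MvPolynomial V.EvenIx 𝕜)

/-- The derivative of an even function along a coordinate of even positive degree. -/
def evenPderiv (c : V.EvenIx) : V.EvenFun →ₗ[𝕜] V.EvenFun :=
  (TensorProduct.map LinearMap.id (MvPolynomial.pderiv c).toLinearMap :
    V.Smooth ⊗[𝕜] MvPolynomial V.EvenIx 𝕜 →ₗ[𝕜] V.Smooth ⊗[𝕜] MvPolynomial V.EvenIx 𝕜)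

/-- The left derivative `∂/∂θ_c` of the exterior algebra: the antiderivation that is given on
coordinates by `θ_b ↦ δ_{cb}`. -/
def oddPd (c : V.OddIx) : V.OddFun →ₗ[𝕜] V.OddFun :=
  CliffordAlgebra.contractLeft (Q := (0 : QuadraticForm 𝕜 (V.OddIx →₀ 𝕜))) (Finsupp.lapply c)

/-- The (left) partial derivative along the coordinate `c`. -/
def deriv (c : V.Ix) : V.Fun →ₗ[𝕜] V.Fun :=
  if h₀ : c.deg = 0 then V.onEven (V.evenPd ⟨c, h₀⟩)
  else if h₁ : Even c.deg then V.onEven (V.evenPderiv ⟨c, h₀, h₁⟩)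
  else V.onOdd (V.oddPd ⟨c, Nat.not_even_iff_odd.1 h₁⟩)

/-- The sign operator `f ↦ (-1)^{|f|} f`. -/
def parity : V.Fun →ₗ[𝕜] V.Fun :=
  V.onOdd (CliffordAlgebra.involute (Q := (0 : QuadraticForm 𝕜 (V.OddIx →₀ 𝕜)))).toLinearMap

/-- The components of the Poisson bivector: the coefficient of `∂/∂a ⊗ ∂/∂b`. -/
def w : V.Ix → V.Ix → 𝕜
  | .x μ, .p ν => if μ = ν then 1 else 0
  | .p μ, .x ν => if μ = ν then (if Odd n then 1 else -1) else 0
  | .psi i α, .chi j β => if (⟨i, α⟩ : Σ i, Fin (V.r i)) = ⟨j, β⟩ then 1 else 0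
  | .chi i α, .psi j β => if (⟨i, α⟩ : Σ i, Fin (V.r i)) = ⟨j, β⟩ then
      (if Odd n then 1 else -(-1) ^ ((i : ℕ) + 1)) else 0
  | .xi a, .xi b => V.κ⁻¹ a b
  | _, _ => 0

/-- The Poisson bracket `{f, g}_ω = Σ (-1)^{|f| |b|} w^{ab} ∂_a f ∂_b g` of degree `-n`. -/
def bracket (f g : V.Fun) : V.Fun :=
  ∑ a, ∑ b, V.w a b • (V.deriv a ((V.parity ^ b.deg) f) * V.deriv b g)

/-- Hamiltonian functions: homogeneous functions of degree `n + 1` with `{H, H}_ω = 0`. -/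
def Ham : Set V.Fun := {H | H ∈ V.homog (n + 1) ∧ V.bracket H H = 0}

/-- The vector field `{H, ·}_ω`. -/
def ham (H : V.Fun) : V.Fun →ₗ[𝕜] V.Fun :=
  ∑ a, ∑ b, V.w a b •
    (LinearMap.mulLeft 𝕜 (V.deriv a ((V.parity ^ b.deg) H)) ∘ₗ V.deriv b)

theorem ham_apply (H f : V.Fun) : V.ham H f = V.bracket H f := by
  simp [ham, bracket, LinearMap.sum_apply]

/-- Cocycles of degree `k` for `Q = {H, ·}_ω`. -/
def cocycles (H : V.Fun) (k : ℕ) : Submodule 𝕜 V.Fun := V.homog k ⊓ LinearMap.ker (V.ham H)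

/-- Coboundaries of degree `k + 1` for `Q = {H, ·}_ω`. -/
def coboundaries (H : V.Fun) (k : ℕ) : Submodule 𝕜 V.Fun := (V.homog k).map (V.ham H)

/-- The cohomology of degree `k + 1` of the functions on the chart with respect to
`Q = {H, ·}_ω`. -/
abbrev Cohomology (H : V.Fun) (k : ℕ) : Type _ :=
  V.cocycles H (k + 1) ⧸ (V.coboundaries H k).submoduleOf (V.cocycles H (k + 1))

/-! ### The representation of the graph operad -/

/-- The `N`-fold tensor power of the algebra of functions. -/
abbrev TFun (N : ℕ) : Type _ := ⨂[𝕜] _ : Fin N, V.Fun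

/-- The derivative along `c` acting on the factor `i` of a tensor product, with the Koszul sign
`(-1)^{|c| |f_j|}` for each factor `f_j` that stands before. -/
def derivAt {N : ℕ} (c : V.Ix) (i : Fin N) : Module.End 𝕜 (V.TFun N) :=
  PiTensorProduct.map fun j =>
    if j < i then V.parity ^ c.deg else if j = i then V.deriv c else LinearMap.id

/-- The operator `Δ_{ij} = Σ w^{ab} ∂_a^{(i)} ∂_b^{(j)}` attached to an edge. -/
def Delta {N : ℕ} (i j : Fin N) : Module.End 𝕜 (V.TFun N) :=
  ∑ a, ∑ b, V.w a b • (V.derivAt a i * V.derivAt b j)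

/-- The action of a graph: apply the operators `Δ_{ij}` of its edges, in the order of the edges, then
multiply the factors. -/
def repGraph {N k : ℕ} (γ : Multidigraph N k) : V.TFun N →ₗ[𝕜] V.Fun :=
  PiTensorProduct.lift (MultilinearMap.mkPiAlgebraFin 𝕜 N V.Fun) ∘ₗ
    (List.ofFn fun e => V.Delta (γ e).1 (γ e).2).prod


section Relations

theorem onEven_mul (φ φ' : V.EvenFun →ₗ[𝕜] V.EvenFun) :
    V.onEven φ * V.onEven φ' = V.onEven (φ ∘ₗ φ') :=
  (TensorProduct.map_comp φ LinearMap.id φ' LinearMap.id).symm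

theorem onOdd_mul (φ φ' : V.OddFun →ₗ[𝕜] V.OddFun) :
    V.onOdd φ * V.onOdd φ' = V.onOdd (φ ∘ₗ φ') :=
  (TensorProduct.map_comp LinearMap.id φ LinearMap.id φ').symm

theorem onEven_onOdd (φ : V.EvenFun →ₗ[𝕜] V.EvenFun) (φ' : V.OddFun →ₗ[𝕜] V.OddFun) :
    V.onEven φ * V.onOdd φ' = V.onOdd φ' * V.onEven φ :=
  ((TensorProduct.map_comp φ LinearMap.id LinearMap.id φ').symm).trans
    (TensorProduct.map_comp LinearMap.id φ' φ LinearMap.id)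

theorem onOdd_neg (φ : V.OddFun →ₗ[𝕜] V.OddFun) : V.onOdd (-φ) = -V.onOdd φ :=
  LinearMap.lTensor_neg (M := V.EvenFun) (f := φ)

theorem evenPd_comm (c c' : V.BodyIx) : V.evenPd c ∘ₗ V.evenPd c' = V.evenPd c' ∘ₗ V.evenPd c := by
  have h : V.pd c ∘ₗ V.pd c' = V.pd c' ∘ₗ V.pd c := LinearMap.ext fun f => V.pd_comm c c' f
  refine ((TensorProduct.map_comp (V.pd c) LinearMap.id (V.pd c') LinearMap.id).symm).trans ?_
  rw [h]
  exact TensorProduct.map_comp _ _ _ _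

theorem evenPd_evenPderiv (c : V.BodyIx) (c' : V.EvenIx) :
    V.evenPd c ∘ₗ V.evenPderiv c' = V.evenPderiv c' ∘ₗ V.evenPd c :=
  ((TensorProduct.map_comp (V.pd c) LinearMap.id LinearMap.id
      (MvPolynomial.pderiv c').toLinearMap).symm).trans
    (TensorProduct.map_comp LinearMap.id (MvPolynomial.pderiv c').toLinearMap
      (V.pd c) LinearMap.id)

theorem evenPderiv_comm (c c' : V.EvenIx) :
    V.evenPderiv c ∘ₗ V.evenPderiv c' = V.evenPderiv c' ∘ₗ V.evenPderiv c := by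
  have h : (MvPolynomial.pderiv (R := 𝕜) c).toLinearMap ∘ₗ
      (MvPolynomial.pderiv (R := 𝕜) c').toLinearMap =
      (MvPolynomial.pderiv (R := 𝕜) c').toLinearMap ∘ₗ
        (MvPolynomial.pderiv (R := 𝕜) c).toLinearMap := by
    have h0 : ⁅MvPolynomial.pderiv (R := 𝕜) c, MvPolynomial.pderiv (R := 𝕜) c'⁆ = 0 := by
      refine MvPolynomial.derivation_ext fun i => ?_
      classical
      simp [Derivation.commutator_apply, MvPolynomial.pderiv_X, Pi.single_apply, apply_ite]
    refine LinearMap.ext fun f => ?_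
    have h1 := congrArg (fun D : Derivation 𝕜 (MvPolynomial V.EvenIx 𝕜) _ => D f) h0
    simpa [Derivation.commutator_apply, sub_eq_zero] using h1
  refine ((TensorProduct.map_comp (LinearMap.id : V.Smooth →ₗ[𝕜] V.Smooth)
    (MvPolynomial.pderiv (R := 𝕜) c).toLinearMap LinearMap.id
    (MvPolynomial.pderiv (R := 𝕜) c').toLinearMap).symm).trans ?_
  rw [h]
  exact TensorProduct.map_comp _ _ _ _

theorem oddPd_comm (c c' : V.OddIx) : V.oddPd c ∘ₗ V.oddPd c' = -(V.oddPd c' ∘ₗ V.oddPd c) :=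
  LinearMap.ext fun x => CliffordAlgebra.contractLeft_comm _ _ x

theorem deriv_mul (c c' : V.Ix) :
    V.deriv c * V.deriv c' = (-1 : 𝕜) ^ (c.deg * c'.deg) • (V.deriv c' * V.deriv c) := by
  unfold deriv
  by_cases h₀ : c.deg = 0 <;> by_cases h₀' : c'.deg = 0
  · simp [h₀, h₀', onEven_mul, evenPd_comm V ⟨c, h₀⟩ ⟨c', h₀'⟩]
  · by_cases h₁' : Even c'.deg
    · simp [h₀, h₀', h₁', onEven_mul, evenPd_evenPderiv]
    · simp [h₀, h₀', h₁', onEven_onOdd]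
  · by_cases h₁ : Even c.deg
    · simp [h₀, h₀', h₁, onEven_mul, evenPd_evenPderiv]
    · simp [h₀, h₀', h₁, onEven_onOdd]
  · by_cases h₁ : Even c.deg <;> by_cases h₁' : Even c'.deg
    · simp [h₀, h₀', h₁, h₁', onEven_mul, (h₁.mul_right _).neg_one_pow,
        evenPderiv_comm V ⟨c, h₀, h₁⟩ ⟨c', h₀', h₁'⟩]
    · simp [h₀, h₀', h₁, h₁', onEven_onOdd, (h₁.mul_right _).neg_one_pow]
    · simp [h₀, h₀', h₁, h₁', onEven_onOdd, (h₁'.mul_left _).neg_one_pow]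
    · have h2 : Odd (c.deg * c'.deg) :=
        (Nat.not_even_iff_odd.1 h₁).mul (Nat.not_even_iff_odd.1 h₁')
      simp only [h₀, h₀', h₁, h₁', dite_false, onOdd_mul, h2.neg_one_pow]
      rw [oddPd_comm, onOdd_neg]
      exact (neg_one_smul 𝕜 _).symm

theorem deriv_parity (c : V.Ix) :
    V.deriv c * V.parity = (-1 : 𝕜) ^ c.deg • (V.parity * V.deriv c) := by
  unfold deriv parity
  by_cases h₀ : c.deg = 0
  · simp [h₀, onEven_onOdd]
  by_cases h₁ : Even c.deg
  · simp [h₀, h₁, onEven_onOdd, h₁.neg_one_pow]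
  · have h2 := Nat.not_even_iff_odd.1 h₁
    simp only [h₀, h₁, dite_false, onOdd_mul, h2.neg_one_pow]
    have : V.oddPd ⟨c, h2⟩ ∘ₗ (CliffordAlgebra.involute
        (Q := (0 : QuadraticForm 𝕜 (V.OddIx →₀ 𝕜)))).toLinearMap =
        -((CliffordAlgebra.involute
          (Q := (0 : QuadraticForm 𝕜 (V.OddIx →₀ 𝕜)))).toLinearMap ∘ₗ V.oddPd ⟨c, h2⟩) := by
      refine LinearMap.ext fun x => ?_
      induction x using CliffordAlgebra.left_induction with
      | algebraMap r => simp [oddPd, CliffordAlgebra.contractLeft_algebraMap]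
      | add x y hx hy => simp only [map_add, hx, hy]
      | ι_mul x v hx =>
        simp only [LinearMap.comp_apply, AlgHom.toLinearMap_apply, LinearMap.neg_apply, oddPd,
          map_mul, CliffordAlgebra.involute_ι, CliffordAlgebra.contractLeft_ι_mul, neg_mul,
          map_neg, map_sub, map_smul] at hx ⊢
        rw [hx]
        simp
    rw [this, onOdd_neg]
    exact (neg_one_smul 𝕜 _).symm

theorem deriv_parity_pow (c : V.Ix) (k : ℕ) :
    V.deriv c * V.parity ^ k = (-1 : 𝕜) ^ (c.deg * k) • (V.parity ^ k * V.deriv c) := by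
  induction k with
  | zero => simp
  | succ k ih =>
    rw [pow_succ, ← mul_assoc, ih, smul_mul_assoc, mul_assoc, deriv_parity, mul_smul_comm, smul_smul,
      ← mul_assoc, Nat.mul_succ, pow_add]

/-- A tensor product of operators that agree up to a scalar in one factor. -/
theorem map_smul_single {N : ℕ} (g f : Fin N → (V.Fun →ₗ[𝕜] V.Fun)) (i : Fin N) (z : 𝕜)
    (h : ∀ j, g j = if j = i then z • f j else f j) :
    (PiTensorProduct.map g : Module.End 𝕜 (V.TFun N)) = z • PiTensorProduct.map f := by
  have hg : g = Function.update f i (z • f i) := by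
    funext j
    by_cases hj : j = i
    · subst hj; simp [h]
    · simp [h, hj]
  rw [hg, PiTensorProduct.map_update_smul, Function.update_eq_self]

theorem derivAt_mul {N : ℕ} (a b : V.Ix) (i j : Fin N) :
    V.derivAt a i * V.derivAt b j =
      (-1 : 𝕜) ^ (a.deg * b.deg) • (V.derivAt b j * V.derivAt a i) := by
  unfold derivAt
  rw [← PiTensorProduct.map_mul, ← PiTensorProduct.map_mul]
  rcases lt_trichotomy i j with hij | hij | hij
  · refine V.map_smul_single _ _ i _ fun l => ?_
    rcases lt_trichotomy l i with h | h | h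
    · simp [h, h.trans hij, h.ne, ← pow_add, add_comm]
    · subst h; simp [hij, deriv_parity_pow]
    · simp [h.not_gt, h.ne', Module.End.mul_eq_comp]
  · subst hij
    refine V.map_smul_single _ _ i _ fun l => ?_
    rcases lt_trichotomy l i with h | h | h
    · simp [h, h.ne, ← pow_add, add_comm]
    · subst h; simp only [lt_irrefl, if_true, if_false]; exact V.deriv_mul a b
    · simp [h.not_gt, h.ne', Module.End.mul_eq_comp]
  · refine V.map_smul_single _ _ j _ fun l => ?_
    rcases lt_trichotomy l j with h | h | h
    · simp [h, h.trans hij, h.ne, ← pow_add, add_comm]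
    · subst h
      simp only [hij, lt_irrefl, if_true, if_false]
      rw [deriv_parity_pow, smul_smul, mul_comm b.deg, ← mul_pow]
      simp
    · simp [h.not_gt, h.ne', Module.End.mul_eq_comp]

theorem w_deg (a b : V.Ix) (h : V.w a b ≠ 0) : a.deg + b.deg = n := by
  rcases a with μ | μ | ⟨i, α⟩ | ⟨i, α⟩ | a <;> rcases b with ν | ν | ⟨j, β⟩ | ⟨j, β⟩ | b <;>
    simp only [w, ne_eq, not_true_eq_false, ite_eq_right_iff, not_forall] at h <;>
    simp only [Coord.deg]
  · simp
  · simp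
  · obtain ⟨h, -⟩ := h
    have : i = j := congrArg Sigma.fst h
    subst this
    have := i.2
    omega
  · obtain ⟨h, -⟩ := h
    have : i = j := congrArg Sigma.fst h
    subst this
    have := i.2
    omega
  · have hn : ¬ Odd n := fun hn => by
      have := V.s_eq_zero hn
      have := a.2
      omega
    obtain ⟨k, hk⟩ := Nat.not_odd_iff_even.1 hn
    omega

theorem κ_inv_symm (a b : Fin V.s) : V.κ⁻¹ b a = -(-1) ^ (n / 2) * V.κ⁻¹ a b := by
  set z : 𝕜 := -(-1) ^ (n / 2) with hz
  have hzz : z * z = 1 := by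
    rw [hz, neg_mul_neg, ← mul_pow]; simp
  have hdet : IsUnit V.κ.det := (Matrix.isUnit_iff_isUnit_det _).1 V.isUnit_κ
  have h1 : V.κ.transpose = z • V.κ := by
    ext i j
    rw [Matrix.transpose_apply, V.κ_symm j i, Matrix.smul_apply, smul_eq_mul]
  have h2 : V.κ⁻¹.transpose = z • V.κ⁻¹ := by
    rw [Matrix.transpose_nonsing_inv, h1]
    refine Matrix.inv_eq_left_inv ?_
    rw [Matrix.smul_mul, Matrix.mul_smul, smul_smul, hzz, one_smul,
      Matrix.nonsing_inv_mul _ hdet]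
  have h3 := congrFun (congrFun h2 a) b
  simpa using h3

theorem w_symm (a b : V.Ix) : V.w b a * (-1) ^ (a.deg * b.deg) = (-1) ^ (n + 1) * V.w a b := by
  have e1 : ∀ {k : ℕ}, Even k → (-1 : 𝕜) ^ k = 1 := fun h => h.neg_one_pow
  have e2 : ∀ {k : ℕ}, Odd k → (-1 : 𝕜) ^ k = -1 := fun h => h.neg_one_pow
  rcases a with μ | μ | ⟨i, α⟩ | ⟨i, α⟩ | a <;> rcases b with ν | ν | ⟨j, β⟩ | ⟨j, β⟩ | b <;>
    simp only [w, Coord.deg, mul_zero, zero_mul]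
  · by_cases h : μ = ν
    · subst h
      rcases Nat.even_or_odd n with hn | hn
      · simp [Nat.not_odd_iff_even.2 hn, e2 hn.add_one]
      · simp [hn, e1 hn.add_one]
    · simp [h, Ne.symm h]
  · by_cases h : μ = ν
    · subst h
      rcases Nat.even_or_odd n with hn | hn
      · simp [Nat.not_odd_iff_even.2 hn, e2 hn.add_one]
      · simp [hn, e1 hn.add_one]
    · simp [h, Ne.symm h]
  · by_cases h : (⟨i, α⟩ : Σ i, Fin (V.r i)) = ⟨j, β⟩
    · obtain ⟨rfl, h'⟩ := Sigma.mk.inj_iff.1 h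
      obtain rfl := eq_of_heq h'
      have hi := i.2
      have hle : (i : ℕ) + 1 ≤ n := by omega
      rcases Nat.even_or_odd n with hn | hn
      · have hp : (-1 : 𝕜) ^ (((i : ℕ) + 1) * (n - ((i : ℕ) + 1))) = (-1) ^ ((i : ℕ) + 1) := by
          rcases Nat.even_or_odd ((i : ℕ) + 1) with h2 | h2
          · rw [e1 h2, e1 (h2.mul_right _)]
          · rw [e2 h2, e2 (h2.mul (Nat.Even.sub_odd hle hn h2))]
        rw [hp]
        simp only [if_true, Nat.not_odd_iff_even.2 hn, if_false, e2 hn.add_one, neg_mul, mul_one]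
        rw [← mul_pow]; simp
      · have hp : (-1 : 𝕜) ^ (((i : ℕ) + 1) * (n - ((i : ℕ) + 1))) = 1 := by
          rcases Nat.even_or_odd ((i : ℕ) + 1) with h2 | h2
          · rw [e1 (h2.mul_right _)]
          · rw [e1 ((Nat.Odd.sub_odd hn h2).mul_left _)]
        rw [hp]
        simp [hn, e1 hn.add_one]
    · rw [if_neg h, if_neg (Ne.symm h)]; simp
  · by_cases h : (⟨i, α⟩ : Σ i, Fin (V.r i)) = ⟨j, β⟩
    · obtain ⟨rfl, h'⟩ := Sigma.mk.inj_iff.1 h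
      obtain rfl := eq_of_heq h'
      have hi := i.2
      have hle : (i : ℕ) + 1 ≤ n := by omega
      rcases Nat.even_or_odd n with hn | hn
      · have hp : (-1 : 𝕜) ^ ((n - ((i : ℕ) + 1)) * ((i : ℕ) + 1)) = (-1) ^ ((i : ℕ) + 1) := by
          rcases Nat.even_or_odd ((i : ℕ) + 1) with h2 | h2
          · rw [e1 h2, e1 (h2.mul_left _)]
          · rw [e2 h2, e2 (Odd.mul (Nat.Even.sub_odd hle hn h2) h2)]
        rw [hp]
        simp [Nat.not_odd_iff_even.2 hn, e2 hn.add_one]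
      · have hp : (-1 : 𝕜) ^ ((n - ((i : ℕ) + 1)) * ((i : ℕ) + 1)) = 1 := by
          rcases Nat.even_or_odd ((i : ℕ) + 1) with h2 | h2
          · rw [e1 (h2.mul_left _)]
          · rw [e1 ((Nat.Odd.sub_odd hn h2).mul_right _)]
        rw [hp]
        simp [hn, e1 hn.add_one]
    · rw [if_neg h, if_neg (Ne.symm h)]; simp
  · have hn : Even n := Nat.not_odd_iff_even.1 fun hn => by
      have := V.s_eq_zero hn
      have := a.2
      omega
    rw [κ_inv_symm V a b, e2 hn.add_one]
    have hp : (-1 : 𝕜) ^ (n / 2 * (n / 2)) = (-1) ^ (n / 2) := by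
      rcases Nat.even_or_odd (n / 2) with h2 | h2
      · rw [e1 h2, e1 (h2.mul_right _)]
      · rw [e2 h2, e2 (h2.mul h2)]
    rw [hp, neg_mul, neg_mul, mul_right_comm, ← mul_pow]
    simp

theorem Delta_swap {N : ℕ} (i j : Fin N) :
    V.Delta j i = (-1 : 𝕜) ^ (n + 1) • V.Delta i j := by
  unfold Delta
  rw [Finset.smul_sum, Finset.sum_comm]
  refine Finset.sum_congr rfl fun a _ => ?_
  rw [Finset.smul_sum]
  refine Finset.sum_congr rfl fun b _ => ?_
  rw [V.derivAt_mul b a j i, smul_smul, smul_smul, mul_comm b.deg, w_symm]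

theorem Delta_comm {N : ℕ} (i j k l : Fin N) :
    V.Delta i j * V.Delta k l = (-1 : 𝕜) ^ n • (V.Delta k l * V.Delta i j) := by
  have key : ∀ a b c e : V.Ix,
      (V.w a b • (V.derivAt a i * V.derivAt b j)) * (V.w c e • (V.derivAt c k * V.derivAt e l)) =
      (-1 : 𝕜) ^ n • ((V.w c e • (V.derivAt c k * V.derivAt e l)) *
        (V.w a b • (V.derivAt a i * V.derivAt b j))) := by
    intro a b c e
    by_cases h1 : V.w a b = 0
    · simp [h1]
    by_cases h2 : V.w c e = 0
    · simp [h2]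
    have d1 := V.w_deg a b h1
    have d2 := V.w_deg c e h2
    have hs : (-1 : 𝕜) ^ n = (-1) ^ (b.deg * c.deg) * (-1) ^ (b.deg * e.deg) *
        ((-1) ^ (a.deg * c.deg) * (-1) ^ (a.deg * e.deg)) := by
      have e3 : b.deg * c.deg + b.deg * e.deg + (a.deg * c.deg + a.deg * e.deg) = n * n := by
        calc _ = (a.deg + b.deg) * (c.deg + e.deg) := by ring
          _ = n * n := by rw [d1, d2]
      rw [← pow_add, ← pow_add, ← pow_add, e3]
      rcases Nat.even_or_odd n with hn | hn
      · rw [hn.neg_one_pow, (hn.mul_right _).neg_one_pow]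
      · rw [hn.neg_one_pow, (hn.mul hn).neg_one_pow]
    have hm : (V.derivAt a i * V.derivAt b j) * (V.derivAt c k * V.derivAt e l) =
        (-1 : 𝕜) ^ n • ((V.derivAt c k * V.derivAt e l) * (V.derivAt a i * V.derivAt b j)) := by
      calc (V.derivAt a i * V.derivAt b j) * (V.derivAt c k * V.derivAt e l)
          = V.derivAt a i * (V.derivAt b j * V.derivAt c k) * V.derivAt e l := by
            simp only [mul_assoc]
        _ = (-1 : 𝕜) ^ (b.deg * c.deg) •
            ((V.derivAt a i * V.derivAt c k) * (V.derivAt b j * V.derivAt e l)) := by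
            rw [V.derivAt_mul b c]
            simp only [mul_assoc, mul_smul_comm, smul_mul_assoc]
        _ = ((-1 : 𝕜) ^ (b.deg * c.deg) * (-1) ^ (b.deg * e.deg) * (-1) ^ (a.deg * c.deg)) •
            (V.derivAt c k * (V.derivAt a i * V.derivAt e l) * V.derivAt b j) := by
            rw [V.derivAt_mul b e, V.derivAt_mul a c]
            simp only [mul_assoc, mul_smul_comm, smul_mul_assoc, smul_smul]
        _ = _ := by
            rw [V.derivAt_mul a e, hs]
            simp only [mul_assoc, mul_smul_comm, smul_mul_assoc, smul_smul]
    rw [smul_mul_smul_comm, hm, smul_mul_smul_comm, smul_smul, smul_smul, mul_comm (V.w c e)]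
    congr 1
    ring
  have hD : ∀ i j : Fin N, V.Delta i j =
      ∑ c : V.Ix × V.Ix, V.w c.1 c.2 • (V.derivAt c.1 i * V.derivAt c.2 j) := fun i j => by
    rw [Delta, Fintype.sum_prod_type]
  rw [hD, hD, Finset.sum_mul_sum, Finset.sum_mul_sum, Finset.sum_comm, Finset.smul_sum]
  refine Finset.sum_congr rfl fun c _ => ?_
  rw [Finset.smul_sum]
  exact Finset.sum_congr rfl fun a _ => key _ _ _ _

theorem prod_ofFn_swap {E : Type*} [Ring E] [Algebra 𝕜 E] (z : 𝕜) {k : ℕ} (i : Fin k)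
    (f : Fin (k + 1) → E) (hf : ∀ a b, f a * f b = z • (f b * f a)) :
    (List.ofFn (f ∘ Equiv.swap i.castSucc i.succ)).prod = z • (List.ofFn f).prod := by
  induction k with
  | zero => exact i.elim0
  | succ k ih =>
    refine Fin.cases ?_ (fun i => ?_) i
    · have e : ∀ l : Fin k, Equiv.swap (0 : Fin (k + 2)) 1 l.succ.succ = l.succ.succ := fun l =>
        Equiv.swap_apply_of_ne_of_ne (Fin.succ_ne_zero _) (by
          rw [← Fin.succ_zero_eq_one, Ne, Fin.succ_inj]; exact Fin.succ_ne_zero _)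
      simp only [List.ofFn_succ, List.prod_cons, Function.comp_apply, Fin.castSucc_zero,
        Fin.succ_zero_eq_one, Equiv.swap_apply_left, Equiv.swap_apply_right, e]
      rw [← mul_assoc, hf 1 0, smul_mul_assoc, mul_assoc]
    · have e : ∀ l : Fin (k + 1), Equiv.swap i.succ.castSucc i.succ.succ l.succ =
          (Equiv.swap i.castSucc i.succ l).succ := fun l => by
        rw [← Fin.succ_castSucc]
        exact (Fin.succ_injective _).swap_apply _ _ _
      have e0 : Equiv.swap i.succ.castSucc i.succ.succ 0 = 0 :=
        Equiv.swap_apply_of_ne_of_ne (by rw [← Fin.succ_castSucc]; exact (Fin.succ_ne_zero _).symm)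
          (Fin.succ_ne_zero _).symm
      have := ih i (fun l => f l.succ) (fun a b => hf _ _)
      rw [List.ofFn_succ, List.ofFn_succ (f := f), List.prod_cons, List.prod_cons, ← mul_smul_comm,
        ← this]
      simp only [Function.comp_def, e, e0]

/-- A product of operators that commute up to a common sign, in a permuted order. -/
theorem prod_ofFn_perm {E : Type*} [Ring E] [Algebra 𝕜 E] (q : ℕ) {k : ℕ}
    (σ : Equiv.Perm (Fin k)) (f : Fin k → E)
    (hf : ∀ a b, f a * f b = (-1 : 𝕜) ^ q • (f b * f a)) :
    (List.ofFn (f ∘ σ)).prod = sgn 𝕜 σ ^ q • (List.ofFn f).prod := by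
  rcases k with _ | k
  · simp [sgn, Subsingleton.elim σ 1]
  have hσ : σ ∈ Submonoid.closure
      (Set.range fun i : Fin k => Equiv.swap i.castSucc i.succ) := by
    rw [Equiv.Perm.mclosure_swap_castSucc_succ]; trivial
  induction hσ using Submonoid.closure_induction generalizing f with
  | mem τ h =>
    obtain ⟨i, rfl⟩ := h
    simp only
    rw [prod_ofFn_swap _ i f hf]
    have : sgn 𝕜 (Equiv.swap i.castSucc i.succ) = -1 := by
      simp [sgn, Equiv.Perm.sign_swap (Fin.castSucc_lt_succ (i := i)).ne]
    rw [this]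
  | one => simp [sgn]
  | mul τ τ' _ _ h h' =>
    have e : f ∘ ⇑(τ * τ') = (f ∘ τ) ∘ τ' := rfl
    rw [e, h' (f ∘ τ) (fun a b => hf _ _), h f hf, smul_smul, ← mul_pow]
    simp [sgn, mul_comm]

theorem repGraph_comp_perm {N k : ℕ} (σ : Equiv.Perm (Fin k)) (γ : Multidigraph N k) :
    V.repGraph (γ ∘ σ) = sgn 𝕜 σ ^ (n + 1 + 1) • V.repGraph γ := by
  have h := prod_ofFn_perm (𝕜 := 𝕜) n σ (fun e => V.Delta (γ e).1 (γ e).2)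
    (fun a b => V.Delta_comm _ _ _ _)
  have hs : sgn 𝕜 σ ^ (n + 1 + 1) = sgn 𝕜 σ ^ n := by
    rcases Int.units_eq_one_or (Equiv.Perm.sign σ) with h | h <;> simp [sgn, h, pow_succ]
  unfold repGraph
  rw [hs, ← LinearMap.comp_smul, ← h]
  rfl

theorem prod_ofFn_update {E : Type*} [Ring E] [Algebra 𝕜 E] (z : 𝕜) {k : ℕ} (e : Fin k)
    (f g : Fin k → E) (h : ∀ i, g i = if i = e then z • f i else f i) :
    (List.ofFn g).prod = z • (List.ofFn f).prod := by
  induction k with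
  | zero => exact e.elim0
  | succ k ih =>
    rw [List.ofFn_succ, List.ofFn_succ (f := f), List.prod_cons, List.prod_cons]
    revert h
    refine Fin.cases (fun h => ?_) (fun e h => ?_) e
    · have h0 : g 0 = z • f 0 := by simpa using h 0
      have h1 : ∀ i : Fin k, g i.succ = f i.succ := fun i => by
        rw [h, if_neg (Fin.succ_ne_zero i)]
      simp only [h0, h1, smul_mul_assoc]
    · have h0 : g 0 = f 0 := by rw [h, if_neg (Fin.succ_ne_zero e).symm]
      rw [h0, ih e (fun i => f i.succ) (fun i => g i.succ) (fun i => by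
        rw [h]; simp only [Fin.succ_inj]), mul_smul_comm]

theorem repGraph_flipEdge {N k : ℕ} (e : Fin k) (γ : Multidigraph N k) :
    V.repGraph (flipEdge e γ) = (-1 : 𝕜) ^ (n + 1) • V.repGraph γ := by
  unfold repGraph
  rw [← LinearMap.comp_smul]
  congr 1
  refine prod_ofFn_update _ e _ _ fun i => ?_
  by_cases hi : i = e
  · subst hi
    simp only [flipEdge, Function.update_self, Prod.fst_swap, Prod.snd_swap, if_true]
    exact V.Delta_swap _ _
  · simp [flipEdge, hi]

end Relations

/-- The representation `Rep_N` of the graph operad `Gra_d`, `d = n + 1`, on the functions of the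
chart. -/
def Rep {N k : ℕ} : Gra 𝕜 (n + 1) N k →ₗ[𝕜] (V.TFun N →ₗ[𝕜] V.Fun) :=
  (graRel 𝕜 (n + 1) N k).liftQ
    (Finsupp.linearCombination 𝕜 fun γ : Multidigraph N k => V.repGraph γ)
    (graRel_le_ker _
      (fun e γ => by
        simp only [gr, Finsupp.linearCombination_single, one_smul]
        exact V.repGraph_flipEdge e γ)
      (fun σ γ => by
        simp only [gr, Finsupp.linearCombination_single, one_smul]
        exact V.repGraph_comp_perm σ γ))

/-- The element `Rep_N(γ)(f ⊗ ⋯ ⊗ f)`. -/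
def flowAt {N k : ℕ} (γ : Gra 𝕜 (n + 1) N k) (f : V.Fun) : V.Fun :=
  V.Rep γ (PiTensorProduct.tprod 𝕜 fun _ : Fin N => f)

/-- The element `Σ Rep_N(g_N)(f ⊗ ⋯ ⊗ f)` for a finite sum of graphs `g`; the entry with index
`(M, k)` of `g` is its component with `M + 1` vertices and `k` edges. -/
def evalFormula (f : V.Fun) :
    (DirectSum (ℕ × ℕ) fun q => Gra 𝕜 (n + 1) (q.1 + 1) q.2) →ₗ[𝕜] V.Fun :=
  DirectSum.toModule 𝕜 (ℕ × ℕ) V.Fun fun q =>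
    LinearMap.applyₗ (PiTensorProduct.tprod 𝕜 fun _ : Fin (q.1 + 1) => f) ∘ₗ V.Rep

/-- The class of a cocycle in the cohomology of `Q = {H, ·}_ω`. -/
def cohClass (H : V.Fun) (k : ℕ) : V.cocycles H (k + 1) →ₗ[𝕜] V.Cohomology H k :=
  Submodule.mkQ _

end NPChart

/-! ### Hamiltonian flows -/

/-- Hamiltonian flows on all charts of degree `n`: maps sending a Hamiltonian function `H` to a class
of degree `n + 1` in the cohomology of `Q = {H, ·}_ω`. -/
abbrev Flow (𝕜 : Type*) [RCLike 𝕜] (n : ℕ) : Type _ :=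
  ∀ (V : NPChart 𝕜 n) (H : V.Ham), V.Cohomology H.1 n

/-- Universal Hamiltonian flows: those given, on all charts at once, by one and the same formula
`H ↦ Σ Rep_N(g_N)(H ⊗ ⋯ ⊗ H)` for a finite sum `g` of elements of the graph operad `Gra_{n+1}`. -/
def HFlow (𝕜 : Type*) [RCLike 𝕜] (n : ℕ) : Submodule 𝕜 (Flow 𝕜 n) where
  carrier := {F | ∃ g : DirectSum (ℕ × ℕ) fun q => Gra 𝕜 (n + 1) (q.1 + 1) q.2,
    ∀ (V : NPChart 𝕜 n) (H : V.Ham), ∃ hc : V.evalFormula H.1 g ∈ V.cocycles H.1 (n + 1),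
      F V H = V.cohClass H.1 n ⟨V.evalFormula H.1 g, hc⟩}
  add_mem' := by
    rintro F F' ⟨g, hg⟩ ⟨g', hg'⟩
    refine ⟨g + g', fun V H => ?_⟩
    obtain ⟨hc, e⟩ := hg V H
    obtain ⟨hc', e'⟩ := hg' V H
    have h : V.evalFormula H.1 (g + g') = V.evalFormula H.1 g + V.evalFormula H.1 g' := map_add _ _ _
    refine ⟨h ▸ add_mem hc hc', ?_⟩
    rw [Pi.add_apply, Pi.add_apply, e, e', ← map_add]
    congr 1
    exact Subtype.ext h.symm
  zero_mem' := by
    refine ⟨0, fun V H => ?_⟩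
    have h : V.evalFormula H.1 0 = 0 := map_zero _
    refine ⟨h ▸ zero_mem _, ?_⟩
    rw [Pi.zero_apply, Pi.zero_apply, ← map_zero (V.cohClass H.1 n)]
    congr 1
  smul_mem' := by
    rintro z F ⟨g, hg⟩
    refine ⟨z • g, fun V H => ?_⟩
    obtain ⟨hc, e⟩ := hg V H
    have h : V.evalFormula H.1 (z • g) = z • V.evalFormula H.1 g := map_smul _ _ _
    refine ⟨h ▸ Submodule.smul_mem _ z hc, ?_⟩
    rw [Pi.smul_apply, Pi.smul_apply, e, ← map_smul]
    congr 1
    exact Subtype.ext h.symm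

/-! ### Bivector fields and functions of degree two on charts of degree one -/

section Bivector

variable {𝕜 : Type*} [RCLike 𝕜] (V : NPChart 𝕜 1)

/-- Bivector fields on `U`: antisymmetric matrices of smooth functions. -/
def IsBivector (π : Fin V.m → Fin V.m → V.Smooth) : Prop := ∀ μ ν, π ν μ = -π μ ν

/-- The function `½ π^{μν} p_μ p_ν`. -/
def bivectorFun (π : Fin V.m → Fin V.m → V.Smooth) : V.Fun :=
  (1 / 2 : 𝕜) • ∑ μ, ∑ ν, V.mono (π μ ν) 0 [⟨.p μ, odd_one⟩, ⟨.p ν, odd_one⟩]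

/-- The partial derivative `∂/∂x^ρ`. -/
def dx (ρ : Fin V.m) : V.Smooth →ₗ[𝕜] V.Smooth := V.pd ⟨.x ρ, rfl⟩

/-- The term `Σ_ρ (π^{ρλ} ∂_ρ π'^{μν} + π'^{ρλ} ∂_ρ π^{μν})`. -/
def schoutenTerm (π π' : Fin V.m → Fin V.m → V.Smooth) (l μ ν : Fin V.m) : V.Smooth :=
  ∑ ρ, (π ρ l * dx V ρ (π' μ ν) + π' ρ l * dx V ρ (π μ ν))

/-- The components of the Schouten bracket of two bivector fields (up to normalisation). -/
def schouten (π π' : Fin V.m → Fin V.m → V.Smooth) (l μ ν : Fin V.m) : V.Smooth :=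
  schoutenTerm V π π' l μ ν + schoutenTerm V π π' μ ν l + schoutenTerm V π π' ν l μ

/-- Poisson bivector fields: bivector fields with vanishing Schouten square, that is, the Jacobi
identity. -/
def IsPoisson (π : Fin V.m → Fin V.m → V.Smooth) : Prop :=
  IsBivector V π ∧ ∀ l μ ν, schouten V π π l μ ν = 0

end Bivector

end NPGraph

end

noncomputable section

namespace NPGraph

namespace NPChart

variable {𝕜 : Type*} [RCLike 𝕜] {n : ℕ} (V : NPChart 𝕜 n)

open TensorProduct

/-! ### The algebra of functions -/

/-! Evaluating graphs on copies of a single Hamiltonian $H$ turns the differential of the graph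
complex into the bracket with $H$. Three properties of the representation carry this.

Insertion (`flowAt_insertFirst`): by the graded Leibniz rule (`deriv_mul_apply`, `derivAt_mulFirst`)
a derivative of a product is the signed sum of the derivatives of its factors. Letting the edges of
$\gamma$ act on a slot that holds the product computed by $\gamma'$ therefore sums over all
reattachments of half-edges, and $\gamma\circ_1\gamma'$ evaluates to $\gamma$ applied to
$(\gamma'(H,\dots,H),H,\dots,H)$.

Equivariance (`flowAt_relabel`): the signed exchange `braid` of neighbouring factors intertwines the
edge operators and is absorbed by the graded commutative multiplication. All inputs equal $H$, of
degree $d=n+1$, so relabelling by $\sigma$ costs $\mathrm{sgn}(\sigma)^d$. This cancels the twist in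
the pre-Lie product, and all unshuffles contribute the same term (`flowAt_preLie`).

The edge graph acts as the Poisson bracket (`repGraph_edge`).

Hence in $[\bullet\to\bullet,\gamma]$ the terms that insert the edge into $\gamma$ contain
$\{H,H\}=0$, and the others add up to a positive integer multiple of $\{\gamma(H,\dots,H),H\}$
(`exists_flowAt_graphBracket`). In characteristic zero graph cocycles thus give $Q$-cocycles, and
graph coboundaries give $Q$-coboundaries. Since $\delta$ maps the component $(N,k)$ to $(N+1,k+1)$
only, this holds for each component separately; finiteness matters only for summing the components.
Each edge lowers the degree by $n$, so a graph of degree $m$ gives a function of degree $m+d$.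

For $n=1$ functions of degree two are quadratic in the odd $p_\mu$, and the bracket of two of them
is cubic. A cubic function whose coefficients are antisymmetric in the last two indices vanishes
exactly when their cyclic sums do (`cubFun_eq_zero_iff`); for the bracket these sums are the
Schouten bracket. This is applied to $\{H,H\}$ and to $\{H,\dot H\}$. -/

theorem tmul_mul_tmul (a b : V.EvenFun) (ω η : V.OddFun) :
    V.tmul a ω * V.tmul b η = V.tmul (a * b) (ω * η) :=
  Algebra.TensorProduct.tmul_mul_tmul _ _ _ _

theorem onEven_tmul (φ : V.EvenFun →ₗ[𝕜] V.EvenFun) (a : V.EvenFun) (ω : V.OddFun) :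
    V.onEven φ (V.tmul a ω) = V.tmul (φ a) ω := rfl

theorem onOdd_tmul (φ : V.OddFun →ₗ[𝕜] V.OddFun) (a : V.EvenFun) (ω : V.OddFun) :
    V.onOdd φ (V.tmul a ω) = V.tmul a (φ ω) := rfl

theorem tmul_add (a : V.EvenFun) (ω η : V.OddFun) :
    V.tmul a (ω + η) = V.tmul a ω + V.tmul a η := TensorProduct.tmul_add _ _ _

theorem tmul_sub (a : V.EvenFun) (ω η : V.OddFun) :
    V.tmul a (ω - η) = V.tmul a ω - V.tmul a η := TensorProduct.tmul_sub _ _ _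

theorem tmul_smul (a : V.EvenFun) (z : 𝕜) (ω : V.OddFun) :
    V.tmul a (z • ω) = z • V.tmul a ω := TensorProduct.tmul_smul _ _ _

theorem add_tmul (a b : V.EvenFun) (ω : V.OddFun) :
    V.tmul (a + b) ω = V.tmul a ω + V.tmul b ω := TensorProduct.add_tmul _ _ _

theorem smul_tmul (a : V.EvenFun) (z : 𝕜) (ω : V.OddFun) :
    V.tmul (z • a) ω = z • V.tmul a ω := TensorProduct.smul_tmul' _ _ _

theorem zero_tmul (ω : V.OddFun) : V.tmul 0 ω = 0 := TensorProduct.zero_tmul _ _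

theorem tmul_zero (a : V.EvenFun) : V.tmul a 0 = 0 := TensorProduct.tmul_zero _ _

theorem one_eq_tmul : (1 : V.Fun) = V.tmul 1 1 := rfl

theorem fun_induction {P : V.Fun → Prop} (x : V.Fun) (tmul : ∀ a ω, P (V.tmul a ω))
    (add : ∀ x y, P x → P y → P (x + y)) : P x :=
  TensorProduct.induction_on (motive := P) x
    (by
      have h := tmul 0 0
      rw [V.tmul_zero] at h
      exact h) tmul add

/-- The function `f g` for `f` a function of the coordinates of degree zero and `g` a polynomial. -/
def etmul (f : V.Smooth) (g : MvPolynomial V.EvenIx 𝕜) : V.EvenFun := f ⊗ₜ[𝕜] g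

theorem evenFun_induction {P : V.EvenFun → Prop} (x : V.EvenFun)
    (tmul : ∀ (f : V.Smooth) (g : MvPolynomial V.EvenIx 𝕜), P (V.etmul f g))
    (add : ∀ x y, P x → P y → P (x + y)) : P x :=
  TensorProduct.induction_on (motive := P) x
    (by
      have h := tmul 0 0
      have h0 : V.etmul 0 0 = 0 := TensorProduct.tmul_zero _ _
      rw [h0] at h
      exact h) tmul add

theorem pd_mul (c : V.BodyIx) (f g : V.Smooth) :
    V.pd c (f * g) = V.pd c f * g + f * V.pd c g := by
  ext x
  have h : V.ext (f * g).1 =ᶠ[nhds (x : V.BodyIx → ℝ)] V.ext f.1 * V.ext g.1 :=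
    V.ext_eventuallyEq _ _ (fun y => by simp [V.ext_apply]) x
  change fderiv ℝ (V.ext (f * g).1) x (Pi.single c 1) =
    fderiv ℝ (V.ext f.1) x (Pi.single c 1) * g.1 x + f.1 x * fderiv ℝ (V.ext g.1) x (Pi.single c 1)
  rw [h.fderiv_eq, fderiv_mul (V.differentiableAt_ext f x) (V.differentiableAt_ext g x)]
  simp [V.ext_apply]
  ring

theorem evenMul_tmul (f f' : V.Smooth) (g g' : MvPolynomial V.EvenIx 𝕜) :
    V.etmul f g * V.etmul f' g' = V.etmul (f * f') (g * g') :=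
  Algebra.TensorProduct.tmul_mul_tmul _ _ _ _

theorem evenPd_mul (c : V.BodyIx) (a b : V.EvenFun) :
    V.evenPd c (a * b) = V.evenPd c a * b + a * V.evenPd c b := by
  induction a using V.evenFun_induction with
  | add x y hx hy => simp only [add_mul, map_add, hx, hy]; abel
  | tmul f g =>
    induction b using V.evenFun_induction with
    | add x y hx hy => simp only [mul_add, map_add, hx, hy]; abel
    | tmul f' g' =>
      have h : ∀ u v, V.evenPd c (V.etmul u v) = V.etmul (V.pd c u) v := fun _ _ => rfl
      rw [evenMul_tmul, h, h, h, evenMul_tmul, evenMul_tmul, pd_mul]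
      exact TensorProduct.add_tmul _ _ _

theorem evenPderiv_mul (c : V.EvenIx) (a b : V.EvenFun) :
    V.evenPderiv c (a * b) = V.evenPderiv c a * b + a * V.evenPderiv c b := by
  induction a using V.evenFun_induction with
  | add x y hx hy => simp only [add_mul, map_add, hx, hy]; abel
  | tmul f g =>
    induction b using V.evenFun_induction with
    | add x y hx hy => simp only [mul_add, map_add, hx, hy]; abel
    | tmul f' g' =>
      have h : ∀ u v, V.evenPderiv c (V.etmul u v) = V.etmul u (MvPolynomial.pderiv c v) :=
        fun _ _ => rfl
      rw [evenMul_tmul, h, h, h, evenMul_tmul, evenMul_tmul, Derivation.leibniz, add_comm]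
      simp only [smul_eq_mul]
      rw [mul_comm g' (MvPolynomial.pderiv c g)]
      exact TensorProduct.tmul_add _ _ _

/-- The sign operator of the exterior algebra. -/
abbrev oddParity : V.OddFun →ₐ[𝕜] V.OddFun :=
  CliffordAlgebra.involute (Q := (0 : QuadraticForm 𝕜 (V.OddIx →₀ 𝕜)))

theorem oddParity_oddParity (ω : V.OddFun) : V.oddParity (V.oddParity ω) = ω :=
  CliffordAlgebra.involute_involute ω

/-- Contraction is an antiderivation by its rule on a single generator; peeling the generators off
$\omega$ one at a time extends this to all products. -/
theorem oddPd_mul (c : V.OddIx) (ω η : V.OddFun) :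
    V.oddPd c (ω * η) = V.oddPd c ω * η + V.oddParity ω * V.oddPd c η := by
  induction ω using CliffordAlgebra.left_induction with
  | algebraMap r =>
    simp [oddPd, CliffordAlgebra.contractLeft_algebraMap_mul, CliffordAlgebra.contractLeft_algebraMap]
  | add x y hx hy => simp only [add_mul, map_add, hx, hy]; abel
  | ι_mul x v hx =>
    simp only [oddPd, oddParity] at hx ⊢
    rw [mul_assoc, CliffordAlgebra.contractLeft_ι_mul, hx, CliffordAlgebra.contractLeft_ι_mul, map_mul,
      CliffordAlgebra.involute_ι, mul_add, sub_mul, smul_mul_assoc]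
    simp only [mul_assoc, neg_mul]
    abel

/-- Graded commutativity for elements without a definite parity: $\eta+\bar\eta$ is twice the even
part of $\eta$, which commutes with $\omega$, and $\eta-\bar\eta$ is twice the odd part, which moves
past $\omega$ at the cost of the involution. -/
theorem odd_two_mul (ω η : V.OddFun) :
    ω * η + ω * η = (η + V.oddParity η) * ω + (η - V.oddParity η) * V.oddParity ω := by
  induction ω using CliffordAlgebra.left_induction generalizing η with
  | algebraMap r =>
    rw [AlgHom.commutes, ← Algebra.commutes r, ← Algebra.commutes r, ← mul_add, ← mul_add]
    congr 1
    abel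
  | add x y hx hy =>
    have : (x + y) * η + (x + y) * η = (x * η + x * η) + (y * η + y * η) := by noncomm_ring
    rw [this, hx, hy, map_add]
    noncomm_ring
  | ι_mul x v hx =>
    -- The quadratic form is zero, so generators anticommute, and moving one past $\zeta$ applies
    -- the involution to $\zeta$.
    have hι : ∀ ζ : V.OddFun, CliffordAlgebra.ι (0 : QuadraticForm 𝕜 (V.OddIx →₀ 𝕜)) v * ζ =
        V.oddParity ζ * CliffordAlgebra.ι (0 : QuadraticForm 𝕜 (V.OddIx →₀ 𝕜)) v := by
      intro ζ
      induction ζ using CliffordAlgebra.left_induction with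
      | algebraMap r => simp only [AlgHom.commutes, ← Algebra.commutes r]
      | add x y hx hy => simp only [mul_add, map_add, add_mul, hx, hy]
      | ι_mul x u hx =>
        have h : CliffordAlgebra.ι (0 : QuadraticForm 𝕜 (V.OddIx →₀ 𝕜)) v *
            CliffordAlgebra.ι (0 : QuadraticForm 𝕜 (V.OddIx →₀ 𝕜)) u =
            -(CliffordAlgebra.ι (0 : QuadraticForm 𝕜 (V.OddIx →₀ 𝕜)) u *
              CliffordAlgebra.ι (0 : QuadraticForm 𝕜 (V.OddIx →₀ 𝕜)) v) := by
          rw [eq_neg_iff_add_eq_zero, CliffordAlgebra.ι_mul_ι_add_swap]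
          simp [QuadraticMap.polar]
        rw [map_mul, CliffordAlgebra.involute_ι, ← mul_assoc, h, neg_mul, mul_assoc, hx]
        simp [mul_assoc]
    rw [map_mul, CliffordAlgebra.involute_ι, mul_assoc, ← mul_add, hx, mul_add, ← mul_assoc, hι,
      ← mul_assoc, hι (η - _), map_add, map_sub, oddParity_oddParity]
    noncomm_ring

theorem parity_tmul (a : V.EvenFun) (ω : V.OddFun) :
    V.parity (V.tmul a ω) = V.tmul a (V.oddParity ω) := rfl

theorem parity_mul_self : V.parity * V.parity = 1 := by
  refine LinearMap.ext fun x => ?_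
  induction x using V.fun_induction with
  | add x y hx hy => rw [map_add, map_add, hx, hy]
  | tmul a ω =>
    rw [Module.End.mul_apply, parity_tmul, parity_tmul, oddParity_oddParity]
    rfl

theorem parity_pow_of_even {k : ℕ} (h : Even k) : V.parity ^ k = 1 := by
  obtain ⟨r, rfl⟩ := h
  rw [← two_mul, pow_mul, pow_two, parity_mul_self, one_pow]

theorem parity_pow_of_odd {k : ℕ} (h : Odd k) : V.parity ^ k = V.parity := by
  obtain ⟨r, rfl⟩ := h
  rw [pow_succ, pow_mul, pow_two, parity_mul_self, one_pow, one_mul]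

theorem parity_mul (f g : V.Fun) : V.parity (f * g) = V.parity f * V.parity g := by
  induction f using V.fun_induction with
  | add x y hx hy => simp only [map_add, add_mul, hx, hy]
  | tmul a ω =>
    induction g using V.fun_induction with
    | add x y hx hy => simp only [map_add, mul_add, hx, hy]
    | tmul b η => rw [tmul_mul_tmul, parity_tmul, parity_tmul, parity_tmul, tmul_mul_tmul, map_mul]

theorem parity_one : V.parity 1 = 1 := by
  rw [one_eq_tmul, parity_tmul, map_one]

theorem parity_pow_mul (k : ℕ) (f g : V.Fun) :
    (V.parity ^ k) (f * g) = (V.parity ^ k) f * (V.parity ^ k) g := by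
  rcases Nat.even_or_odd k with h | h
  · simp [V.parity_pow_of_even h]
  · rw [V.parity_pow_of_odd h, parity_mul]

theorem parity_pow_one (k : ℕ) : (V.parity ^ k) 1 = 1 := by
  rcases Nat.even_or_odd k with h | h
  · simp [V.parity_pow_of_even h]
  · rw [V.parity_pow_of_odd h, parity_one]

/-- Graded commutativity of the algebra of functions. -/
theorem mul_eq_parity (f g : V.Fun) :
    f * g = (1 / 2 : 𝕜) • (g * f + V.parity g * f + g * V.parity f - V.parity g * V.parity f) := by
  have key : f * g + f * g = (g + V.parity g) * f + (g - V.parity g) * V.parity f := by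
    induction f using V.fun_induction with
    | add x y hx hy =>
      have : (x + y) * g + (x + y) * g = (x * g + x * g) + (y * g + y * g) := by noncomm_ring
      rw [this, hx, hy, map_add]
      noncomm_ring
    | tmul a ω =>
      induction g using V.fun_induction with
      | add x y hx hy =>
        have : V.tmul a ω * (x + y) + V.tmul a ω * (x + y) =
          (V.tmul a ω * x + V.tmul a ω * x) + (V.tmul a ω * y + V.tmul a ω * y) := by noncomm_ring
        rw [this, hx, hy, map_add]
        noncomm_ring
      | tmul b η =>
        rw [parity_tmul, parity_tmul, ← tmul_add, ← tmul_sub]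
        simp only [tmul_mul_tmul]
        rw [← tmul_add, odd_two_mul, tmul_add, mul_comm a b]
  have h2 : f * g = (1 / 2 : 𝕜) • (f * g + f * g) := by
    rw [← two_smul 𝕜 (f * g), smul_smul]; norm_num
  rw [h2, key]
  congr 1
  noncomm_ring

/-- The sign $(-1)^{|c||f|}$ is carried by the operator `V.parity ^ c.deg`, so $f$ may be
inhomogeneous. Even coordinates act by derivations of the even tensor factor, odd ones by
antiderivations of the odd factor, the only place where parity is visible. -/
theorem deriv_mul_apply (c : V.Ix) (f g : V.Fun) :
    V.deriv c (f * g) = V.deriv c f * g + (V.parity ^ c.deg) f * V.deriv c g := by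
  unfold deriv
  by_cases h₀ : c.deg = 0
  · simp only [h₀, dite_true, pow_zero, Module.End.one_apply]
    induction f using V.fun_induction with
    | add x y hx hy => simp only [map_add, add_mul, hx, hy]; abel
    | tmul a ω =>
      induction g using V.fun_induction with
      | add x y hx hy => simp only [map_add, mul_add, hx, hy]; abel
      | tmul b η =>
        rw [tmul_mul_tmul]; simp only [onEven_tmul]
        rw [tmul_mul_tmul, tmul_mul_tmul, ← add_tmul, evenPd_mul]
  by_cases h₁ : Even c.deg
  · simp only [h₀, h₁, dite_true, dite_false, V.parity_pow_of_even h₁, Module.End.one_apply]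
    induction f using V.fun_induction with
    | add x y hx hy => simp only [map_add, add_mul, hx, hy]; abel
    | tmul a ω =>
      induction g using V.fun_induction with
      | add x y hx hy => simp only [map_add, mul_add, hx, hy]; abel
      | tmul b η =>
        rw [tmul_mul_tmul]; simp only [onEven_tmul]
        rw [tmul_mul_tmul, tmul_mul_tmul, ← add_tmul, evenPderiv_mul]
  · simp only [h₀, h₁, dite_false, V.parity_pow_of_odd (Nat.not_even_iff_odd.1 h₁)]
    induction f using V.fun_induction with
    | add x y hx hy => simp only [map_add, add_mul, hx, hy]; abel
    | tmul a ω =>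
      induction g using V.fun_induction with
      | add x y hx hy => simp only [map_add, mul_add, hx, hy]; abel
      | tmul b η =>
        rw [tmul_mul_tmul]; simp only [onOdd_tmul, parity_tmul]
        rw [tmul_mul_tmul, tmul_mul_tmul, ← tmul_add, oddPd_mul]

theorem deriv_one (c : V.Ix) : V.deriv c 1 = 0 := by
  have := V.deriv_mul_apply c 1 1
  simpa [parity_pow_one] using this

/-! ### Degrees -/

/-- Homogeneous functions, with degrees in `ℤ`. -/
def homogInt (z : ℤ) : Submodule 𝕜 V.Fun :=
  Submodule.span 𝕜 {F | ∃ f e l, F = V.mono f e l ∧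
    (((e.sum fun c i => i * c.1.deg) + (l.map fun c => c.1.deg).sum : ℕ) : ℤ) = z}

theorem homogInt_natCast (k : ℕ) : V.homogInt k = V.homog k := by
  simp only [homogInt, homog, Nat.cast_inj]

theorem mono_mul_mono (f f' : V.Smooth) (e e' : V.EvenIx →₀ ℕ) (l l' : List V.OddIx) :
    V.mono f e l * V.mono f' e' l' = V.mono (f * f') (e + e') (l ++ l') := by
  have h : V.evenMono f e * V.evenMono f' e' = V.evenMono (f * f') (e + e') := by
    refine (V.evenMul_tmul _ _ _ _).trans ?_
    rw [MvPolynomial.monomial_mul, one_mul]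
    rfl
  unfold mono
  rw [tmul_mul_tmul, h, List.map_append, List.prod_append]

theorem one_eq_mono : (1 : V.Fun) = V.mono 1 0 [] := rfl

theorem one_mem_homogInt : (1 : V.Fun) ∈ V.homogInt 0 :=
  Submodule.subset_span ⟨1, 0, [], V.one_eq_mono, by simp⟩

theorem mul_mem_homogInt {y z : ℤ} {f g : V.Fun} (hf : f ∈ V.homogInt y) (hg : g ∈ V.homogInt z) :
    f * g ∈ V.homogInt (y + z) := by
  refine Submodule.span_induction₂ (p := fun f g _ _ => f * g ∈ V.homogInt (y + z))
    ?_ ?_ ?_ ?_ ?_ ?_ ?_ hf hg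
  · rintro _ _ ⟨f, e, l, rfl, h⟩ ⟨f', e', l', rfl, h'⟩
    refine Submodule.subset_span ⟨_, _, _, V.mono_mul_mono _ _ _ _ _ _, ?_⟩
    rw [← h, ← h', Finsupp.sum_add_index' (by simp) (by intros; ring)]
    simp
    ring
  · intros; simp
  · intros; simp
  · intro x y z _ _ _ hx hy; rw [add_mul]; exact add_mem hx hy
  · intro x y z _ _ _ hx hy; rw [mul_add]; exact add_mem hx hy
  · intro r x y _ _ h; rw [smul_mul_assoc]; exact Submodule.smul_mem _ _ h
  · intro r x y _ _ h; rw [mul_smul_comm]; exact Submodule.smul_mem _ _ h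

theorem oddParity_theta_prod (l : List V.OddIx) :
    V.oddParity (l.map V.theta).prod =
      (-1 : 𝕜) ^ (l.map fun c => c.1.deg).sum • (l.map V.theta).prod := by
  induction l with
  | nil => simp
  | cons c l ih =>
    have h : V.oddParity (V.theta c) = (-1 : 𝕜) ^ c.1.deg • V.theta c := by
      rw [c.2.neg_one_pow]
      exact (CliffordAlgebra.involute_ι _).trans (neg_one_smul 𝕜 _).symm
    rw [List.map_cons, List.prod_cons, map_mul, ih, h, smul_mul_smul_comm, List.map_cons,
      List.sum_cons, pow_add]

/-- The sign operator counts the odd generators. Coordinates of even degree do not change the degree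
modulo 2, so this count has the parity of $k$. -/
theorem parity_of_mem_homog {k : ℕ} {f : V.Fun} (hf : f ∈ V.homog k) :
    V.parity f = (-1 : 𝕜) ^ k • f := by
  induction hf using Submodule.span_induction with
  | mem x h =>
    obtain ⟨f, e, l, rfl, h⟩ := h
    have he : Even (e.sum fun c i => i * c.1.deg) :=
      Finset.even_sum _ fun c _ => c.2.2.mul_left _
    rw [mono, parity_tmul, oddParity_theta_prod, tmul_smul, ← h, pow_add, he.neg_one_pow, one_mul]
  | zero => simp
  | add x y _ _ hx hy => rw [map_add, hx, hy, smul_add]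
  | smul r x _ hx => rw [map_smul, hx, smul_comm]

theorem parity_mem_homogInt {z : ℤ} {f : V.Fun} (hf : f ∈ V.homogInt z) :
    V.parity f ∈ V.homogInt z := by
  induction hf using Submodule.span_induction with
  | mem x h =>
    obtain ⟨f, e, l, rfl, h⟩ := h
    rw [mono, parity_tmul, oddParity_theta_prod, tmul_smul]
    exact Submodule.smul_mem _ _ (Submodule.subset_span ⟨f, e, l, rfl, h⟩)
  | zero => simp
  | add x y _ _ hx hy => rw [map_add]; exact add_mem hx hy
  | smul r x _ hx => rw [map_smul]; exact Submodule.smul_mem _ _ hx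

theorem parity_pow_mem_homogInt (k : ℕ) {z : ℤ} {f : V.Fun} (hf : f ∈ V.homogInt z) :
    (V.parity ^ k) f ∈ V.homogInt z := by
  rcases Nat.even_or_odd k with h | h
  · simpa [V.parity_pow_of_even h] using hf
  · rw [V.parity_pow_of_odd h]; exact V.parity_mem_homogInt hf

/-- The derivative of a word is a signed sum of words with one letter $c$ removed. The degrees are
compared by an addition, which avoids truncated subtraction. -/
theorem oddPd_theta_prod (c : V.OddIx) (l : List V.OddIx) :
    V.oddPd c (l.map V.theta).prod ∈ Submodule.span 𝕜 {ω | ∃ l' : List V.OddIx,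
      ω = (l'.map V.theta).prod ∧
        (l'.map fun c => c.1.deg).sum + c.1.deg = (l.map fun c => c.1.deg).sum} := by
  induction l with
  | nil =>
    have : V.oddPd c 1 = 0 := CliffordAlgebra.contractLeft_one _ _
    simp [this]
  | cons b l ih =>
    have h : V.oddPd c ((b :: l).map V.theta).prod =
        (Finsupp.single b (1 : 𝕜) c) • (l.map V.theta).prod -
          V.theta b * V.oddPd c (l.map V.theta).prod := by
      rw [List.map_cons, List.prod_cons]
      exact CliffordAlgebra.contractLeft_ι_mul _ _ _
    rw [h]
    refine sub_mem ?_ ?_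
    · by_cases hb : b = c
      · subst hb
        exact Submodule.smul_mem _ _ (Submodule.subset_span ⟨l, rfl, by simp [add_comm]⟩)
      · simp [hb]
    · generalize V.oddPd c (l.map V.theta).prod = ω at ih
      induction ih using Submodule.span_induction with
      | mem x h =>
        obtain ⟨l', rfl, h⟩ := h
        refine Submodule.subset_span ⟨b :: l', by simp, ?_⟩
        rw [List.map_cons, List.sum_cons, List.map_cons, List.sum_cons, ← h, add_assoc]
      | zero => simp
      | add x y _ _ hx hy => rw [mul_add]; exact add_mem hx hy
      | smul r x _ hx => rw [mul_smul_comm]; exact Submodule.smul_mem _ _ hx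

/-- Integer degrees are essential here: a derivative can land in a negative degree, where the span
is zero. -/
theorem deriv_mem_homogInt (c : V.Ix) {z : ℤ} {f : V.Fun} (hf : f ∈ V.homogInt z) :
    V.deriv c f ∈ V.homogInt (z - c.deg) := by
  induction hf using Submodule.span_induction with
  | zero => simp
  | add x y _ _ hx hy => rw [map_add]; exact add_mem hx hy
  | smul r x _ hx => rw [map_smul]; exact Submodule.smul_mem _ _ hx
  | mem x h =>
    obtain ⟨f, e, l, rfl, h⟩ := h
    unfold deriv mono
    by_cases h₀ : c.deg = 0
    · simp only [h₀, dite_true, onEven_tmul]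
      exact Submodule.subset_span ⟨V.pd ⟨c, h₀⟩ f, e, l, rfl, by simpa using h⟩
    by_cases h₁ : Even c.deg
    · simp only [h₀, h₁, dite_true, dite_false, onEven_tmul]
      set c' : V.EvenIx := ⟨c, h₀, h₁⟩ with hc'
      have h3 : V.evenPderiv c' (V.evenMono f e) =
          (e c' : 𝕜) • V.evenMono f (e - Finsupp.single c' 1) := by
        have : V.evenPderiv c' (V.evenMono f e) =
          V.etmul f (MvPolynomial.pderiv c' (MvPolynomial.monomial e (1 : 𝕜))) := rfl
        rw [this, MvPolynomial.pderiv_monomial, one_mul]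
        have h4 : (MvPolynomial.monomial (e - Finsupp.single c' 1) (e c' : 𝕜)) =
          (e c' : 𝕜) • MvPolynomial.monomial (e - Finsupp.single c' 1) (1 : 𝕜) := by
          rw [MvPolynomial.smul_monomial, smul_eq_mul, mul_one]
        rw [h4]
        exact TensorProduct.tmul_smul _ _ _
      rw [h3, smul_tmul]
      -- A vanishing exponent makes the coefficient zero; otherwise the truncated subtraction in the
      -- exponent is a genuine one.
      by_cases he : e c' = 0
      · simp [he]
      · refine Submodule.smul_mem _ _ (Submodule.subset_span ⟨f, _, l, rfl, ?_⟩)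
        have h5 : e = (e - Finsupp.single c' 1) + Finsupp.single c' 1 := by
          rw [tsub_add_cancel_of_le]
          rw [Finsupp.single_le_iff]
          omega
        have h6 : (e.sum fun c i => i * c.1.deg) =
            ((e - Finsupp.single c' 1).sum fun c i => i * c.1.deg) + c.deg := by
          conv_lhs => rw [h5]
          rw [Finsupp.sum_add_index' (by simp) (by intros; ring)]
          simp [hc']
        rw [← h, h6]
        push_cast
        ring
    · simp only [h₀, h₁, dite_false, onOdd_tmul]
      have h3 := V.oddPd_theta_prod ⟨c, Nat.not_even_iff_odd.1 h₁⟩ l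
      generalize V.oddPd ⟨c, Nat.not_even_iff_odd.1 h₁⟩ (l.map V.theta).prod = ω at h3
      induction h3 using Submodule.span_induction with
      | mem x h' =>
        obtain ⟨l', rfl, h'⟩ := h'
        refine Submodule.subset_span ⟨f, e, l', rfl, ?_⟩
        rw [← h, ← h']
        push_cast
        ring
      | zero => simp [tmul_zero]
      | add x y _ _ hx hy => rw [tmul_add]; exact add_mem hx hy
      | smul r x _ hx => rw [tmul_smul]; exact Submodule.smul_mem _ _ hx

end NPChart

/-! ### Ordered products in noncommutative monoids and the algebra of the Koszul sign -/

/-- Isolates two neighbouring factors: the surrounding $A$ and $B$ are the same for all $g$ that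
differ from $f$ only at these two places, so an identity between products of two elements can be
used inside a long product. -/
theorem exists_prod_ofFn_eq {E : Type*} [Monoid E] {k : ℕ} (i : Fin k) (f : Fin (k + 1) → E) :
    ∃ A B : E, ∀ g : Fin (k + 1) → E, (∀ l, l ≠ i.castSucc → l ≠ i.succ → g l = f l) →
      (List.ofFn g).prod = A * (g i.castSucc * g i.succ) * B := by
  induction k with
  | zero => exact i.elim0
  | succ k ih =>
    refine Fin.cases ?_ (fun i => ?_) i
    · refine ⟨1, (List.ofFn fun l : Fin k => f l.succ.succ).prod, fun g hg => ?_⟩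
      have h : ∀ l : Fin k, g l.succ.succ = f l.succ.succ := fun l =>
        hg _ (Fin.succ_ne_zero _) (by
          rw [Ne, Fin.succ_inj]; exact Fin.succ_ne_zero _)
      rw [List.ofFn_succ, List.ofFn_succ, List.prod_cons, List.prod_cons, one_mul, ← mul_assoc]
      simp only [h]
      rfl
    · obtain ⟨A, B, h⟩ := ih i (fun l => f l.succ)
      refine ⟨f 0 * A, B, fun g hg => ?_⟩
      have h0 : g 0 = f 0 := hg 0 (by rw [← Fin.succ_castSucc]; exact (Fin.succ_ne_zero _).symm)
        (Fin.succ_ne_zero _).symm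
      rw [List.ofFn_succ, List.prod_cons, h0, h (fun l => g l.succ) (fun l h1 h2 => hg _
        (by rwa [← Fin.succ_castSucc, Ne, Fin.succ_inj]) (by rwa [Ne, Fin.succ_inj]))]
      simp only [mul_assoc]
      rfl

/-- On eigenvectors of the commuting sign operators $P$ and $R$ with eigenvalues $(-1)^p$ and
$(-1)^q$, half of $1+P+R-PR$ is $(-1)^{pq}$. An operator $D$ of degree $m$ on the second factor
shifts $q$ by $m$ modulo 2, which changes this sign by $(-1)^{pm}$, that is, by $P^m$. -/
theorem koszul_aux {𝕜 E : Type*} [CommRing 𝕜] [Ring E] [Algebra 𝕜 E] (P R D : E) (m : ℕ)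
    (h3 : P * P = 1) (h4 : P * R = R * P) (h1 : P * D = D * P)
    (h2 : R * D = (-1 : 𝕜) ^ m • (D * R)) :
    (1 + P + R - P * R) * (P ^ m * D) = D * (1 + P + R - P * R) := by
  rcases Nat.even_or_odd m with h | h
  · have e : P ^ m = 1 := by
      obtain ⟨r, hr⟩ := h
      rw [hr, ← two_mul, pow_mul, pow_two, h3, one_pow]
    rw [h.neg_one_pow, one_smul] at h2
    have h5 : P * R * D = D * (P * R) := by rw [mul_assoc, h2, ← mul_assoc, h1, mul_assoc]
    simp only [e, one_mul, add_mul, sub_mul, mul_add, mul_sub, mul_one, h1, h2, h5]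
  · have e : P ^ m = P := by
      obtain ⟨r, hr⟩ := h
      rw [hr, pow_succ, pow_mul, pow_two, h3, one_pow, one_mul]
    rw [h.neg_one_pow, neg_smul, one_smul] at h2
    have h5 : P * R * D = -(D * (P * R)) := by
      rw [mul_assoc, h2, mul_neg, ← mul_assoc, h1, mul_assoc]
    have h6 : R * (P * D) = -(D * (P * R)) := by rw [← mul_assoc, ← h4, h5]
    have h7 : P * R * (P * D) = -(D * R) := by
      rw [mul_assoc, h6, mul_neg, ← mul_assoc P D, h1, mul_assoc D P, ← mul_assoc P P, h3, one_mul]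
    have h8 : P * (P * D) = D := by rw [← mul_assoc, h3, one_mul]
    rw [e, sub_mul, add_mul, add_mul, one_mul, h8, h6, h7, h1]
    noncomm_ring

theorem semiconjBy_prod_ofFn {E : Type*} [Monoid E] {k : ℕ} (T : E) (f g : Fin k → E)
    (h : ∀ i, SemiconjBy T (f i) (g i)) : SemiconjBy T (List.ofFn f).prod (List.ofFn g).prod := by
  induction k with
  | zero => simp
  | succ k ih =>
    rw [List.ofFn_succ, List.ofFn_succ, List.prod_cons, List.prod_cons]
    exact (h 0).mul_right (ih _ _ fun i => h _)

namespace NPChart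

variable {𝕜 : Type*} [RCLike 𝕜] {n : ℕ} (V : NPChart 𝕜 n)

open PiTensorProduct

/-! ### Multiplication of the factors of a tensor -/

/-- The multiplication `f₁ ⊗ ⋯ ⊗ f_N ↦ f₁ ⋯ f_N`. -/
def mulAll (N : ℕ) : V.TFun N →ₗ[𝕜] V.Fun :=
  PiTensorProduct.lift (MultilinearMap.mkPiAlgebraFin 𝕜 N V.Fun)

theorem mulAll_tprod {N : ℕ} (f : Fin N → V.Fun) :
    V.mulAll N (tprod 𝕜 f) = (List.ofFn f).prod := by
  rw [mulAll, lift.tprod, MultilinearMap.mkPiAlgebraFin_apply]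

theorem repGraph_eq {N k : ℕ} (γ : Multidigraph N k) :
    V.repGraph γ = V.mulAll N ∘ₗ (List.ofFn fun e => V.Delta (γ e).1 (γ e).2).prod := rfl

theorem derivAt_tprod {N : ℕ} (c : V.Ix) (i : Fin N) (f : Fin N → V.Fun) :
    V.derivAt c i (tprod 𝕜 f) = tprod 𝕜 fun j =>
      (if j < i then V.parity ^ c.deg else if j = i then V.deriv c else LinearMap.id) (f j) := by
  rw [derivAt, map_tprod]

theorem parity_pow_prod_ofFn {N : ℕ} (k : ℕ) (f : Fin N → V.Fun) :
    (V.parity ^ k) (List.ofFn f).prod = (List.ofFn fun i => (V.parity ^ k) (f i)).prod := by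
  induction N with
  | zero => simp [parity_pow_one]
  | succ N ih =>
    rw [List.ofFn_succ, List.prod_cons, parity_pow_mul, ih, List.ofFn_succ, List.prod_cons]

/-- The Leibniz rule for products of several factors. -/
theorem deriv_prod_ofFn {N : ℕ} (c : V.Ix) (f : Fin N → V.Fun) :
    V.deriv c (List.ofFn f).prod = ∑ i, (List.ofFn fun j =>
      (if j < i then V.parity ^ c.deg else if j = i then V.deriv c else LinearMap.id) (f j)).prod := by
  induction N with
  | zero => simp [deriv_one]
  | succ N ih =>
    rw [List.ofFn_succ, List.prod_cons, deriv_mul_apply, ih, Fin.sum_univ_succ, Finset.mul_sum]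
    congr 1
    · rw [List.ofFn_succ, List.prod_cons]
      simp
    · refine Finset.sum_congr rfl fun i _ => ?_
      rw [List.ofFn_succ, List.prod_cons]
      simp

/-! ### Exchange of neighbouring factors -/

/-- The sign operator of one factor of a tensor product. -/
def parityAt {N : ℕ} (i : Fin N) : Module.End 𝕜 (V.TFun N) :=
  PiTensorProduct.map fun j => if j = i then V.parity else LinearMap.id

/-- Permutation of the factors of a tensor product, without signs. -/
def permute {N : ℕ} (σ : Equiv.Perm (Fin N)) : Module.End 𝕜 (V.TFun N) :=
  PiTensorProduct.lift ((PiTensorProduct.tprod 𝕜).domDomCongr σ)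

theorem permute_tprod {N : ℕ} (σ : Equiv.Perm (Fin N)) (f : Fin N → V.Fun) :
    V.permute σ (tprod 𝕜 f) = tprod 𝕜 fun i => f (σ i) := by
  rw [permute, lift.tprod, MultilinearMap.domDomCongr_apply]

theorem permute_mul_map {N : ℕ} (σ : Equiv.Perm (Fin N)) (g : Fin N → V.Fun →ₗ[𝕜] V.Fun) :
    V.permute σ * (PiTensorProduct.map g : Module.End 𝕜 (V.TFun N)) =
      (PiTensorProduct.map fun i => g (σ i) : Module.End 𝕜 (V.TFun N)) * V.permute σ := by
  refine PiTensorProduct.ext (MultilinearMap.ext fun f => ?_)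
  simp [permute_tprod]

theorem parityAt_mul_self {N : ℕ} (i : Fin N) : V.parityAt i * V.parityAt i = 1 := by
  rw [parityAt, ← PiTensorProduct.map_mul, ← PiTensorProduct.map_one]
  congr 1
  funext j
  by_cases h : j = i
  · simp [h, parity_mul_self]
  · simp [h]; rfl

theorem parityAt_comm {N : ℕ} (i j : Fin N) :
    V.parityAt i * V.parityAt j = V.parityAt j * V.parityAt i := by
  rw [parityAt, parityAt, ← PiTensorProduct.map_mul, ← PiTensorProduct.map_mul]
  congr 1
  funext l
  split_ifs <;> rfl

theorem parityAt_mul_derivAt {N : ℕ} (c : V.Ix) (i : Fin N) :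
    V.parityAt i * V.derivAt c i = (-1 : 𝕜) ^ c.deg • (V.derivAt c i * V.parityAt i) := by
  have h : V.derivAt c i * V.parityAt i = (-1 : 𝕜) ^ c.deg • (V.parityAt i * V.derivAt c i) := by
    rw [parityAt, derivAt, ← PiTensorProduct.map_mul, ← PiTensorProduct.map_mul]
    refine V.map_smul_single _ _ i _ fun j => ?_
    by_cases h : j = i
    · subst h; simp [deriv_parity]
    · simp only [h, if_false]; rfl
  rw [h, smul_smul, ← mul_pow]
  simp

theorem parityAt_mul_derivAt_of_ne {N : ℕ} (c : V.Ix) {i j : Fin N} (hij : i ≠ j) :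
    V.parityAt i * V.derivAt c j = V.derivAt c j * V.parityAt i := by
  rw [parityAt, derivAt, ← PiTensorProduct.map_mul, ← PiTensorProduct.map_mul]
  congr 1
  funext l
  by_cases h : l = i
  · subst h
    rcases lt_or_gt_of_ne hij with h | h
    · simp only [h, if_true]; exact ((Commute.refl V.parity).pow_right _).eq
    · simp only [h.not_gt, h.ne', if_true, if_false]; rfl
  · simp only [h, if_false]; rfl

/-- The sign `(-1)^{|f_i| |f_j|}` as an operator on tensors. -/
def koszulAt {N : ℕ} (i j : Fin N) : Module.End 𝕜 (V.TFun N) :=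
  (1 / 2 : 𝕜) • (1 + V.parityAt i + V.parityAt j - V.parityAt i * V.parityAt j)

theorem koszulAt_comm {N : ℕ} (i j : Fin N) : V.koszulAt i j = V.koszulAt j i := by
  unfold koszulAt
  rw [V.parityAt_comm i j, add_right_comm]

theorem koszulAt_mul_derivAt {N : ℕ} (c : V.Ix) {i j : Fin N} (hij : i ≠ j) :
    V.koszulAt i j * (V.parityAt i ^ c.deg * V.derivAt c j) = V.derivAt c j * V.koszulAt i j := by
  have h1 := V.parityAt_mul_derivAt_of_ne c hij
  have h2 := V.parityAt_mul_derivAt c j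
  have h3 := V.parityAt_mul_self i
  have h4 := V.parityAt_comm i j
  unfold koszulAt
  rw [smul_mul_assoc, mul_smul_comm]
  congr 1
  exact koszul_aux _ _ _ _ h3 h4 h1 h2

theorem koszulAt_mul_derivAt_of_ne {N : ℕ} (c : V.Ix) {i j l : Fin N} (hi : i ≠ l) (hj : j ≠ l) :
    V.koszulAt i j * V.derivAt c l = V.derivAt c l * V.koszulAt i j := by
  have h1 := V.parityAt_mul_derivAt_of_ne c hi
  have h2 := V.parityAt_mul_derivAt_of_ne c hj
  unfold koszulAt
  rw [smul_mul_assoc, mul_smul_comm]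
  congr 1
  simp only [add_mul, sub_mul, mul_add, mul_sub, one_mul, mul_one, h1, h2, mul_assoc]
  rw [← mul_assoc, h1, mul_assoc]

/-- The exchange of the factors `i` and `i + 1`, with the Koszul sign. -/
def braid {N : ℕ} (i : Fin N) : Module.End 𝕜 (V.TFun (N + 1)) :=
  V.koszulAt i.castSucc i.succ * V.permute (Equiv.swap i.castSucc i.succ)

theorem parityAt_pow {N : ℕ} (i : Fin N) (k : ℕ) :
    V.parityAt i ^ k = PiTensorProduct.map fun j => if j = i then V.parity ^ k else LinearMap.id := by
  rw [parityAt, ← PiTensorProduct.map_pow]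
  congr 1
  funext j
  by_cases h : j = i
  · simp [h]
  · rw [Pi.pow_apply]; simp only [h, if_false]; exact one_pow (M := Module.End 𝕜 V.Fun) k

theorem swap_lt_iff {N : ℕ} (i : Fin N) {l : Fin (N + 1)} (h : l ≠ i.succ)
    (j : Fin (N + 1)) : Equiv.swap i.castSucc i.succ j < l ↔ j < l := by
  rw [Equiv.swap_apply_def]
  simp only [Ne, Fin.ext_iff, Fin.val_succ] at h
  split_ifs with h1 h2
  · subst h1; simp only [Fin.lt_def, Fin.val_castSucc, Fin.val_succ]; omega
  · subst h2; simp only [Fin.lt_def, Fin.val_castSucc, Fin.val_succ]; omega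
  · rfl

/-- The derivative at slot `l` puts signs on all earlier slots. Exchanging two neighbours disturbs
this string only if `l` is one of them, and then by a single sign operator on the other one. The
factor `parityAt` records this defect of the unsigned exchange. -/
theorem permute_mul_derivAt {N : ℕ} (i : Fin N) (c : V.Ix) (l : Fin (N + 1)) :
    V.permute (Equiv.swap i.castSucc i.succ) * V.derivAt c l =
      (if l = i.castSucc then V.parityAt i.castSucc ^ c.deg * V.derivAt c i.succ
        else if l = i.succ then V.parityAt i.succ ^ c.deg * V.derivAt c i.castSucc
        else V.derivAt c l) * V.permute (Equiv.swap i.castSucc i.succ) := by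
  conv_lhs => rw [derivAt, permute_mul_map]
  congr 1
  have hlt : i.castSucc < i.succ := Fin.castSucc_lt_succ
  split_ifs with h h'
  · subst h
    rw [parityAt_pow, derivAt, ← PiTensorProduct.map_mul]
    congr 1
    funext j
    by_cases h1 : j = i.castSucc
    · subst h1
      -- The sign that the derivative at the later slot puts on this one is squared away by the
      -- correction factor.
      simp only [Equiv.swap_apply_left, hlt.not_gt, hlt.ne', if_true, if_false, hlt,
        ← pow_add, V.parity_pow_of_even (Even.add_self _)]
      rfl
    by_cases h2 : j = i.succ
    · subst h2
      simp only [Equiv.swap_apply_right, lt_irrefl, if_true, if_false, hlt.ne']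
      rfl
    · rw [Equiv.swap_apply_of_ne_of_ne h1 h2]
      have : j < i.castSucc ↔ j < i.succ := by
        simp only [Fin.ext_iff, Fin.val_castSucc, Fin.val_succ, Fin.lt_def] at h1 h2 ⊢
        omega
      simp only [h1, h2, this, if_false]
      rfl
  · subst h'
    rw [parityAt_pow, derivAt, ← PiTensorProduct.map_mul]
    congr 1
    funext j
    by_cases h1 : j = i.castSucc
    · subst h1
      simp only [Equiv.swap_apply_left, lt_irrefl, if_true, if_false, hlt.ne]
      rfl
    by_cases h2 : j = i.succ
    · subst h2
      simp only [Equiv.swap_apply_right, hlt, hlt.not_gt, hlt.ne', if_true, if_false]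
      rfl
    · rw [Equiv.swap_apply_of_ne_of_ne h1 h2]
      have : j < i.castSucc ↔ j < i.succ := by
        simp only [Fin.ext_iff, Fin.val_castSucc, Fin.val_succ, Fin.lt_def] at h1 h2 ⊢
        omega
      simp only [h1, h2, this, if_false]
      rfl
  · rw [derivAt]
    congr 1
    funext j
    have : Equiv.swap i.castSucc i.succ j = l ↔ j = l := by
      rw [← Equiv.eq_symm_apply, Equiv.symm_swap, Equiv.swap_apply_of_ne_of_ne h h']
    simp only [swap_lt_iff i h', this]

/-- The defect of the unsigned exchange in `permute_mul_derivAt` is what the Koszul operator absorbs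
by `koszulAt_mul_derivAt`, so the signed exchange merely moves the slot of the derivative. -/
theorem semiconjBy_braid_derivAt {N : ℕ} (i : Fin N) (c : V.Ix) (l : Fin (N + 1)) :
    SemiconjBy (V.braid i) (V.derivAt c l)
      (V.derivAt c (Equiv.swap i.castSucc i.succ l)) := by
  have hlt : i.castSucc < i.succ := Fin.castSucc_lt_succ
  unfold SemiconjBy braid
  rw [mul_assoc, permute_mul_derivAt, ← mul_assoc, ← mul_assoc]
  congr 1
  split_ifs with h h'
  · rw [h, Equiv.swap_apply_left, koszulAt_mul_derivAt _ _ hlt.ne]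
  · rw [h', Equiv.swap_apply_right, koszulAt_comm, koszulAt_mul_derivAt _ _ hlt.ne']
  · rw [Equiv.swap_apply_of_ne_of_ne h h',
      koszulAt_mul_derivAt_of_ne _ _ (Ne.symm h) (Ne.symm h')]

theorem semiconjBy_braid_Delta {N : ℕ} (i : Fin N) (j l : Fin (N + 1)) :
    SemiconjBy (V.braid i) (V.Delta j l) (V.Delta (Equiv.swap i.castSucc i.succ j)
      (Equiv.swap i.castSucc i.succ l)) := by
  unfold SemiconjBy Delta
  simp only [Finset.mul_sum, Finset.sum_mul, mul_smul_comm, smul_mul_assoc]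
  refine Finset.sum_congr rfl fun a _ => Finset.sum_congr rfl fun b _ => ?_
  rw [((V.semiconjBy_braid_derivAt i a j).mul_right (V.semiconjBy_braid_derivAt i b l)).eq]

theorem parityAt_tprod {N : ℕ} (i : Fin N) (f : Fin N → V.Fun) :
    V.parityAt i (tprod 𝕜 f) = tprod 𝕜 (Function.update f i (V.parity (f i))) := by
  rw [parityAt, map_tprod]
  congr 1
  funext j
  by_cases h : j = i
  · subst h; simp
  · simp [h]

/-- This is graded commutativity `mul_eq_parity` for the two neighbouring factors; its four terms
are the four terms of the Koszul operator. -/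
theorem mulAll_comp_braid {N : ℕ} (i : Fin N) : V.mulAll (N + 1) ∘ₗ V.braid i = V.mulAll (N + 1) := by
  refine PiTensorProduct.ext (MultilinearMap.ext fun f => ?_)
  have hlt : i.castSucc < i.succ := Fin.castSucc_lt_succ
  obtain ⟨A, B, hAB⟩ := exists_prod_ofFn_eq i f
  have h0 := hAB f fun l _ _ => rfl
  simp only [LinearMap.compMultilinearMap_apply, LinearMap.comp_apply, braid, koszulAt,
    Module.End.mul_apply, permute_tprod, LinearMap.smul_apply, LinearMap.sub_apply,
    LinearMap.add_apply, Module.End.one_apply, parityAt_tprod, map_smul, map_sub, map_add,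
    mulAll_tprod, h0]
  rw [hAB, hAB, hAB, hAB, V.mul_eq_parity (f i.castSucc)]
  · simp only [Function.update_self, Function.update_of_ne hlt.ne, Function.update_of_ne hlt.ne',
      Equiv.swap_apply_left, Equiv.swap_apply_right]
    simp only [mul_smul_comm, smul_mul_assoc]
    congr 1
    noncomm_ring
  all_goals
    intro l h h'
    simp [h, h', Equiv.swap_apply_of_ne_of_ne h h']

/-- The exchange passes through the operators of all edges, relabelling their ends, and then
disappears in the multiplication. -/
theorem repGraph_mapVert_swap {N k : ℕ} (i : Fin N) (γ : Multidigraph (N + 1) k)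
    (t : V.TFun (N + 1)) :
    V.repGraph (mapVert (Equiv.swap i.castSucc i.succ) γ) (V.braid i t) = V.repGraph γ t := by
  have h := semiconjBy_prod_ofFn (V.braid i) (fun e => V.Delta (γ e).1 (γ e).2)
    (fun e => V.Delta (Equiv.swap i.castSucc i.succ (γ e).1) (Equiv.swap i.castSucc i.succ (γ e).2))
    (fun e => V.semiconjBy_braid_Delta i _ _)
  have h' := LinearMap.congr_fun h.eq t
  rw [repGraph_eq, repGraph_eq, LinearMap.comp_apply, LinearMap.comp_apply]
  refine (congrArg _ h'.symm).trans ?_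
  exact LinearMap.congr_fun (V.mulAll_comp_braid i) _

theorem braid_tprod {N : ℕ} (i : Fin N) (f : Fin (N + 1) → V.Fun) (p q : ℕ)
    (hp : V.parity (f i.castSucc) = (-1 : 𝕜) ^ p • f i.castSucc)
    (hq : V.parity (f i.succ) = (-1 : 𝕜) ^ q • f i.succ) :
    V.braid i (tprod 𝕜 f) =
      (-1 : 𝕜) ^ (p * q) • tprod 𝕜 fun l => f (Equiv.swap i.castSucc i.succ l) := by
  have hlt : i.castSucc < i.succ := Fin.castSucc_lt_succ
  have h1 : ∀ (g : Fin (N + 1) → V.Fun) (j : Fin (N + 1)) (r : ℕ),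
      V.parity (g j) = (-1 : 𝕜) ^ r • g j →
        V.parityAt j (tprod 𝕜 g) = (-1 : 𝕜) ^ r • tprod 𝕜 g := by
    intro g j r h
    rw [parityAt_tprod, h, MultilinearMap.map_update_smul, Function.update_eq_self]
  rw [braid, Module.End.mul_apply, permute_tprod]
  -- After the exchange the earlier slot holds the factor of parity $q$ and the later one that of
  -- parity $p$.
  have h2 := h1 (fun l => f (Equiv.swap i.castSucc i.succ l)) i.castSucc q (by simpa using hq)
  have h3 := h1 (fun l => f (Equiv.swap i.castSucc i.succ l)) i.succ p (by simpa using hp)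
  simp only [koszulAt, LinearMap.smul_apply, LinearMap.sub_apply, LinearMap.add_apply,
    Module.End.one_apply, Module.End.mul_apply, h2, h3, map_smul, smul_smul]
  generalize tprod 𝕜 (fun l => f (Equiv.swap i.castSucc i.succ l)) = t
  have : (1 / 2 : 𝕜) * (1 + (-1) ^ q + (-1) ^ p - (-1) ^ p * (-1) ^ q) = (-1) ^ (p * q) := by
    rcases Nat.even_or_odd p with hp | hp <;> rcases Nat.even_or_odd q with hq | hq
    · rw [(hp.mul_right q).neg_one_pow, hp.neg_one_pow, hq.neg_one_pow]; norm_num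
    · rw [(hp.mul_right q).neg_one_pow, hp.neg_one_pow, hq.neg_one_pow]; norm_num
    · rw [(hq.mul_left p).neg_one_pow, hp.neg_one_pow, hq.neg_one_pow]; norm_num
    · rw [(hp.mul hq).neg_one_pow, hp.neg_one_pow, hq.neg_one_pow]; norm_num
  rw [← this]
  module

/-! ### Degrees of flows -/

/-- Homogeneous tensors. -/
def thomog (N : ℕ) (z : ℤ) : Submodule 𝕜 (V.TFun N) :=
  Submodule.span 𝕜 {t | ∃ (f : Fin N → V.Fun) (y : Fin N → ℤ), (∀ i, f i ∈ V.homogInt (y i)) ∧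
    ∑ i, y i = z ∧ t = tprod 𝕜 f}

theorem derivAt_mem_thomog {N : ℕ} (c : V.Ix) (i : Fin N) {z : ℤ} {t : V.TFun N}
    (ht : t ∈ V.thomog N z) : V.derivAt c i t ∈ V.thomog N (z - c.deg) := by
  induction ht using Submodule.span_induction with
  | mem x h =>
    obtain ⟨f, y, hf, hy, rfl⟩ := h
    rw [derivAt_tprod]
    refine Submodule.subset_span ⟨_, y - Pi.single i (c.deg : ℤ), fun j => ?_, ?_, rfl⟩
    · by_cases h : j = i
      · subst h; simpa using V.deriv_mem_homogInt c (hf j)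
      · rcases lt_or_gt_of_ne h with h' | h'
        · simpa [h, h'] using V.parity_pow_mem_homogInt _ (hf j)
        · simpa [h, h'.not_gt] using hf j
    · simp [Finset.sum_sub_distrib, hy]
  | zero => simp
  | add x y _ _ hx hy => rw [map_add]; exact add_mem hx hy
  | smul r x _ hx => rw [map_smul]; exact Submodule.smul_mem _ _ hx

/-- The bivector pairs only coordinates whose degrees add up to $n$ (`w_deg`), so every edge lowers
the total degree by exactly $n$. -/
theorem Delta_mem_thomog {N : ℕ} (i j : Fin N) {z : ℤ} {t : V.TFun N}
    (ht : t ∈ V.thomog N z) : V.Delta i j t ∈ V.thomog N (z - n) := by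
  simp only [Delta, LinearMap.sum_apply, LinearMap.smul_apply, Module.End.mul_apply]
  refine Submodule.sum_mem _ fun a _ => Submodule.sum_mem _ fun b _ => ?_
  by_cases h : V.w a b = 0
  · simp [h]
  · refine Submodule.smul_mem _ _ ?_
    have := V.derivAt_mem_thomog a i (V.derivAt_mem_thomog b j ht)
    have e : z - (b.deg : ℤ) - a.deg = z - n := by have := V.w_deg a b h; omega
    rwa [e] at this

theorem prod_Delta_mem_thomog {N k : ℕ} (γ : Multidigraph N k) {z : ℤ} {t : V.TFun N}
    (ht : t ∈ V.thomog N z) :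
    (List.ofFn fun e => V.Delta (γ e).1 (γ e).2).prod t ∈ V.thomog N (z - k * n) := by
  induction k with
  | zero => simpa using ht
  | succ k ih =>
    rw [List.ofFn_succ, List.prod_cons, Module.End.mul_apply]
    have := V.Delta_mem_thomog (γ 0).1 (γ 0).2 (ih (fun e => γ e.succ))
    convert this using 2
    push_cast
    ring

theorem prod_ofFn_mem_homogInt {N : ℕ} (f : Fin N → V.Fun) (y : Fin N → ℤ)
    (h : ∀ i, f i ∈ V.homogInt (y i)) : (List.ofFn f).prod ∈ V.homogInt (∑ i, y i) := by
  induction N with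
  | zero => simpa using V.one_mem_homogInt
  | succ N ih =>
    rw [List.ofFn_succ, List.prod_cons, Fin.sum_univ_succ]
    exact V.mul_mem_homogInt (h 0) (ih _ _ fun i => h _)

theorem mulAll_mem_homogInt {N : ℕ} {z : ℤ} {t : V.TFun N} (ht : t ∈ V.thomog N z) :
    V.mulAll N t ∈ V.homogInt z := by
  induction ht using Submodule.span_induction with
  | mem x h =>
    obtain ⟨f, y, hf, rfl, rfl⟩ := h
    rw [mulAll_tprod]
    exact V.prod_ofFn_mem_homogInt f y hf
  | zero => simp
  | add x y _ _ hx hy => rw [map_add]; exact add_mem hx hy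
  | smul r x _ hx => rw [map_smul]; exact Submodule.smul_mem _ _ hx

theorem Rep_mk {N k : ℕ} (γ : Multidigraph N k) : V.Rep (Gra.mk 𝕜 (n + 1) γ) = V.repGraph γ := by
  have h : V.Rep (Gra.mk 𝕜 (n + 1) γ) =
      Finsupp.linearCombination 𝕜 (fun γ : Multidigraph N k => V.repGraph γ) (gr 𝕜 γ) := rfl
  rw [h, gr, Finsupp.linearCombination_single, one_smul]

end NPChart

theorem Gra.induction {K : Type*} [Field K] {d N k : ℕ} {P : Gra K d N k → Prop} (g : Gra K d N k)
    (zero : P 0) (add : ∀ x y, P x → P y → P (x + y)) (smul_mk : ∀ (c : K) γ, P (c • Gra.mk K d γ)) :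
    P g := by
  obtain ⟨z, rfl⟩ := Submodule.mkQ_surjective (graRel K d N k) g
  induction z using Finsupp.induction_linear with
  | zero => rw [map_zero]; exact zero
  | add x y hx hy => rw [map_add]; exact add _ _ hx hy
  | single γ c =>
    have h : Finsupp.single γ c = c • gr K γ := by simp [gr]
    rw [h, map_smul]
    exact smul_mk c γ

namespace NPChart

variable {𝕜 : Type*} [RCLike 𝕜] {n : ℕ} (V : NPChart 𝕜 n)

theorem flowAt_mem_homogInt {N k : ℕ} (γ : Gra 𝕜 (n + 1) N k) {f : V.Fun} {z : ℤ}
    (hf : f ∈ V.homogInt z) : V.flowAt γ f ∈ V.homogInt (N * z - k * n) := by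
  unfold flowAt
  induction γ using Gra.induction with
  | zero => simp
  | add x y hx hy => rw [map_add]; exact add_mem hx hy
  | smul_mk c γ =>
    rw [map_smul]
    refine Submodule.smul_mem _ _ ?_
    rw [Rep_mk, repGraph_eq]
    refine V.mulAll_mem_homogInt (V.prod_Delta_mem_thomog γ ?_)
    exact Submodule.subset_span ⟨_, fun _ => z, fun _ => hf, by simp, rfl⟩

end NPChart

/-! ### Intertwiners, expansion of products of sums, and concatenated tuples -/

theorem comp_prod_ofFn {R E F : Type*} [CommRing R] [AddCommGroup E] [Module R E] [AddCommGroup F]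
    [Module R F] {k : ℕ} (C : E →ₗ[R] F) (X : Fin k → Module.End R F) (Y : Fin k → Module.End R E)
    (h : ∀ i, X i ∘ₗ C = C ∘ₗ Y i) : (List.ofFn X).prod ∘ₗ C = C ∘ₗ (List.ofFn Y).prod := by
  induction k with
  | zero => simp [Module.End.one_eq_id]
  | succ k ih =>
    rw [List.ofFn_succ, List.ofFn_succ, List.prod_cons, List.prod_cons, Module.End.mul_eq_comp,
      Module.End.mul_eq_comp, LinearMap.comp_assoc, ih _ _ fun i => h _, ← LinearMap.comp_assoc, h,
      LinearMap.comp_assoc]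

/-- For edge operators a choice function `G` is a simultaneous choice of reattachments of all edges,
so the expanded product is a sum over graphs. -/
theorem prod_ofFn_sum {𝕜 E α : Type*} [CommRing 𝕜] [Ring E] [Algebra 𝕜 E] [DecidableEq α] {k : ℕ}
    (A : Fin k → Finset α) (D : Fin k → α → E) :
    (List.ofFn fun e => ∑ q ∈ A e, D e q).prod =
      ∑ G ∈ Fintype.piFinset A, (List.ofFn fun e => D e (G e)).prod :=
  (MultilinearMap.mkPiAlgebraFin 𝕜 k E).map_sum_finset D A

theorem update_append_left {α : Type*} {N M : ℕ} (f : Fin N → α) (h : Fin M → α) (i : Fin N) (x : α) :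
    Fin.append (Function.update f i x) h = Function.update (Fin.append f h) (Fin.castAdd M i) x := by
  funext j
  refine Fin.addCases (fun a => ?_) (fun b => ?_) j
  · by_cases ha : a = i
    · subst ha; simp
    · simp [ha]
  · have : Fin.natAdd N b ≠ Fin.castAdd M i := fun hh => by
      have := congrArg Fin.val hh
      simp at this; omega
    simp [this]

theorem collapse_castAdd {N M : ℕ} (a : Fin N) :
    collapse (rfl : N + M = N + M) (Fin.castAdd M a) = 0 := by
  simp [collapse]

theorem collapse_natAdd {N M : ℕ} (b : Fin M) :
    collapse (rfl : N + M = N + M) (Fin.natAdd N b) = b.succ := by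
  simp [collapse, Fin.ext_iff]

namespace NPChart

variable {𝕜 : Type*} [RCLike 𝕜] {n : ℕ} (V : NPChart 𝕜 n)

open PiTensorProduct

/-! ### Insertion of graphs -/

/-- The linear map `x ↦ x ⊗ h₁ ⊗ ⋯ ⊗ h_M`. -/
def consTensor {M : ℕ} (h : Fin M → V.Fun) : V.Fun →ₗ[𝕜] V.TFun (M + 1) where
  toFun x := PiTensorProduct.tprod 𝕜 (Fin.cons (α := fun _ => V.Fun) x h)
  map_add' := MultilinearMap.cons_add (M := fun _ => V.Fun) _ h
  map_smul' := MultilinearMap.cons_smul (M := fun _ => V.Fun) _ h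

theorem consTensor_apply {M : ℕ} (h : Fin M → V.Fun) (x : V.Fun) :
    V.consTensor h x = tprod 𝕜 (Fin.cons (α := fun _ => V.Fun) x h) := rfl

/-- Multiplication of the first `N` factors of a tensor. -/
def mulFirst (N M : ℕ) : V.TFun (N + M) →ₗ[𝕜] V.TFun (M + 1) :=
  PiTensorProduct.lift <| MultilinearMap.mk' (R := 𝕜) (M₁ := fun _ : Fin (N + M) => V.Fun)
    (fun f => PiTensorProduct.tprod 𝕜 (Fin.cons (α := fun _ => V.Fun)
      (List.ofFn fun i => f (Fin.castAdd M i)).prod (fun i => f (Fin.natAdd N i))))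
    (by
      intro f i x y
      have hL : ∀ (a : Fin N) (x : V.Fun), (fun i => Function.update f (Fin.castAdd M a) x
          (Fin.castAdd M i)) = Function.update (fun i => f (Fin.castAdd M i)) a x := fun a x => by
        funext j; by_cases h : j = a
        · subst h; simp
        · simp [h]
      have hR : ∀ (a : Fin M) (x : V.Fun), (fun i => Function.update f (Fin.natAdd N a) x
          (Fin.natAdd N i)) = Function.update (fun i => f (Fin.natAdd N i)) a x := fun a x => by
        funext j; by_cases h : j = a
        · subst h; simp
        · simp [h]
      have hne : ∀ (a : Fin N) (b : Fin M), Fin.natAdd N b ≠ Fin.castAdd M a := fun a b hh => by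
        have := congrArg Fin.val hh
        simp at this; omega
      -- An argument among the first `N` enters only through the product in slot zero; one among the
      -- last `M` enters only through the remaining slots.
      refine Fin.addCases (fun a => ?_) (fun b => ?_) i
      · have h2 := (MultilinearMap.mkPiAlgebraFin 𝕜 N V.Fun).map_update_add
          (fun i => f (Fin.castAdd M i)) a x y
        simp only [MultilinearMap.mkPiAlgebraFin_apply] at h2
        rw [hL, hL, hL, h2]
        simp only [Function.update_of_ne (hne a _)]
        exact MultilinearMap.cons_add _ _ _ _
      · rw [hR, hR, hR]
        simp only [Function.update_of_ne (hne _ b).symm]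
        rw [Fin.cons_update, Fin.cons_update, Fin.cons_update]
        exact MultilinearMap.map_update_add _ _ _ _ _)
    (by
      intro f i c x
      have hL : ∀ (a : Fin N) (x : V.Fun), (fun i => Function.update f (Fin.castAdd M a) x
          (Fin.castAdd M i)) = Function.update (fun i => f (Fin.castAdd M i)) a x := fun a x => by
        funext j; by_cases h : j = a
        · subst h; simp
        · simp [h]
      have hR : ∀ (a : Fin M) (x : V.Fun), (fun i => Function.update f (Fin.natAdd N a) x
          (Fin.natAdd N i)) = Function.update (fun i => f (Fin.natAdd N i)) a x := fun a x => by
        funext j; by_cases h : j = a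
        · subst h; simp
        · simp [h]
      have hne : ∀ (a : Fin N) (b : Fin M), Fin.natAdd N b ≠ Fin.castAdd M a := fun a b hh => by
        have := congrArg Fin.val hh
        simp at this; omega
      refine Fin.addCases (fun a => ?_) (fun b => ?_) i
      · have h2 := (MultilinearMap.mkPiAlgebraFin 𝕜 N V.Fun).map_update_smul
          (fun i => f (Fin.castAdd M i)) a c x
        simp only [MultilinearMap.mkPiAlgebraFin_apply] at h2
        rw [hL, hL, h2]
        simp only [Function.update_of_ne (hne a _)]
        exact MultilinearMap.cons_smul _ _ _ _
      · rw [hR, hR]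
        simp only [Function.update_of_ne (hne _ b).symm]
        rw [Fin.cons_update, Fin.cons_update]
        exact MultilinearMap.map_update_smul _ _ _ _ _)

theorem mulFirst_tprod {N M : ℕ} (f : Fin N → V.Fun) (h : Fin M → V.Fun) :
    V.mulFirst N M (tprod 𝕜 (Fin.append f h)) =
      V.consTensor h (List.ofFn f).prod := by
  rw [mulFirst, lift.tprod]
  change tprod 𝕜 (Fin.cons (α := fun _ => V.Fun)
      (List.ofFn fun i => Fin.append f h (Fin.castAdd M i)).prod
        (fun i => Fin.append f h (Fin.natAdd N i))) = _
  simp only [Fin.append_left, Fin.append_right]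
  rfl

/-- Insertion of the factors `h` after a tensor. -/
def appendTensor {N M : ℕ} (h : Fin M → V.Fun) : V.TFun N →ₗ[𝕜] V.TFun (N + M) :=
  PiTensorProduct.lift <| MultilinearMap.mk' (R := 𝕜) (M₁ := fun _ : Fin N => V.Fun)
    (fun f => PiTensorProduct.tprod 𝕜 (Fin.append f h))
    (by intro f i x y; simp only [update_append_left, MultilinearMap.map_update_add])
    (by intro f i c x; simp only [update_append_left, MultilinearMap.map_update_smul])

theorem appendTensor_tprod {N M : ℕ} (h : Fin M → V.Fun) (f : Fin N → V.Fun) :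
    V.appendTensor h (tprod 𝕜 f) = tprod 𝕜 (Fin.append f h) := by
  rw [appendTensor, lift.tprod]
  rfl

theorem mulFirst_appendTensor {N M : ℕ} (h : Fin M → V.Fun) (t : V.TFun N) :
    V.mulFirst N M (V.appendTensor h t) =
      V.consTensor h (V.mulAll N t) := by
  induction t using PiTensorProduct.induction_on with
  | smul_tprod r f =>
    rw [map_smul, map_smul, appendTensor_tprod, mulFirst_tprod, map_smul, map_smul, mulAll_tprod]
  | add x y hx hy =>
    rw [map_add, map_add, hx, hy, map_add, map_add]

theorem mulAll_mulFirst (N M : ℕ) : V.mulAll (M + 1) ∘ₗ V.mulFirst N M = V.mulAll (N + M) := by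
  refine PiTensorProduct.ext (MultilinearMap.ext fun f => ?_)
  rw [← Fin.append_castAdd_natAdd (f := f)]
  simp only [LinearMap.compMultilinearMap_apply, LinearMap.comp_apply]
  rw [mulFirst_tprod, consTensor_apply, mulAll_tprod, mulAll_tprod, List.ofFn_succ, List.prod_cons,
    List.ofFn_fin_append, List.prod_append]
  simp only [Fin.cons_zero, Fin.cons_succ]

theorem derivAt_castAdd_tprod {N M : ℕ} (c : V.Ix) (i : Fin N) (f : Fin N → V.Fun)
    (h : Fin M → V.Fun) :
    V.derivAt c (Fin.castAdd M i) (tprod 𝕜 (Fin.append f h)) = tprod 𝕜 (Fin.append (fun j =>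
      (if j < i then V.parity ^ c.deg else if j = i then V.deriv c else LinearMap.id) (f j)) h) := by
  rw [derivAt_tprod]
  congr 1
  funext j
  refine Fin.addCases (fun a => ?_) (fun b => ?_) j
  · have h1 : Fin.castAdd M a < Fin.castAdd M i ↔ a < i := Iff.rfl
    simp [h1]
  · have h1 : ¬ Fin.natAdd N b < Fin.castAdd M i := by
      rw [Fin.lt_def, Fin.val_natAdd, Fin.val_castAdd]; omega
    have h2 : ¬ Fin.natAdd N b = Fin.castAdd M i := by
      rw [Fin.ext_iff, Fin.val_natAdd, Fin.val_castAdd]; omega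
    simp [h1, h2]

theorem derivAt_natAdd_tprod {N M : ℕ} (c : V.Ix) (i : Fin M) (f : Fin N → V.Fun)
    (h : Fin M → V.Fun) :
    V.derivAt c (Fin.natAdd N i) (tprod 𝕜 (Fin.append f h)) =
      tprod 𝕜 (Fin.append (fun j => (V.parity ^ c.deg) (f j)) (fun j =>
      (if j < i then V.parity ^ c.deg else if j = i then V.deriv c else LinearMap.id) (h j))) := by
  rw [derivAt_tprod]
  congr 1
  funext j
  refine Fin.addCases (fun a => ?_) (fun b => ?_) j
  · have h1 : Fin.castAdd M a < Fin.natAdd N i := by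
      rw [Fin.lt_def, Fin.val_natAdd, Fin.val_castAdd]; omega
    simp [h1]
  · have h1 : Fin.natAdd N b < Fin.natAdd N i ↔ b < i := by
      rw [Fin.lt_def, Fin.lt_def, Fin.val_natAdd, Fin.val_natAdd]; omega
    simp [h1]

theorem derivAt_appendTensor {N M : ℕ} (h : Fin M → V.Fun) (c : V.Ix) (i : Fin N) :
    V.derivAt c (Fin.castAdd M i) ∘ₗ V.appendTensor h = V.appendTensor h ∘ₗ V.derivAt c i := by
  refine PiTensorProduct.ext (MultilinearMap.ext fun f => ?_)
  simp only [LinearMap.compMultilinearMap_apply, LinearMap.comp_apply]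
  rw [appendTensor_tprod, derivAt_castAdd_tprod, derivAt_tprod, appendTensor_tprod]

theorem Delta_appendTensor {N M : ℕ} (h : Fin M → V.Fun) (i j : Fin N) :
    V.Delta (Fin.castAdd M i) (Fin.castAdd M j) ∘ₗ V.appendTensor h =
      V.appendTensor h ∘ₗ V.Delta i j := by
  refine LinearMap.ext fun t => ?_
  simp only [Delta, LinearMap.comp_apply, LinearMap.sum_apply, LinearMap.smul_apply,
    Module.End.mul_apply, map_sum, map_smul]
  refine Finset.sum_congr rfl fun a _ => Finset.sum_congr rfl fun b _ => ?_
  have h1 := fun c (i : Fin N) t => LinearMap.congr_fun (V.derivAt_appendTensor h c i) t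
  simp only [LinearMap.comp_apply] at h1
  rw [h1, h1]

/-- In slot zero this is the Leibniz rule for the product of the first `N` factors, whose signs are
those of `derivAt` at the single factors. In any other slot the fibre of `collapse` is one vertex,
and the sign on the product equals the product of the signs. -/
theorem derivAt_mulFirst {N M : ℕ} (c : V.Ix) (i : Fin (M + 1)) :
    V.derivAt c i ∘ₗ V.mulFirst N M = V.mulFirst N M ∘ₗ
      ∑ u ∈ Finset.univ.filter (fun u => collapse (rfl : N + M = N + M) u = i), V.derivAt c u := by
  refine PiTensorProduct.ext (MultilinearMap.ext fun f => ?_)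
  rw [← Fin.append_castAdd_natAdd (f := f)]
  generalize (fun i => f (Fin.natAdd N i)) = h
  generalize (fun i => f (Fin.castAdd M i)) = f
  simp only [LinearMap.compMultilinearMap_apply, LinearMap.comp_apply, LinearMap.sum_apply, map_sum]
  rw [Finset.sum_filter, Fin.sum_univ_add, mulFirst_tprod, consTensor_apply, derivAt_tprod]
  simp only [collapse_castAdd, collapse_natAdd, derivAt_castAdd_tprod, derivAt_natAdd_tprod,
    mulFirst_tprod]
  refine Fin.cases ?_ (fun i => ?_) i
  · simp only [if_true, Fin.succ_ne_zero, if_false, Finset.sum_const_zero, add_zero]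
    rw [← map_sum, ← deriv_prod_ofFn, consTensor_apply]
    congr 1
    funext j
    refine Fin.cases ?_ (fun j => ?_) j
    · simp
    · simp [Fin.succ_ne_zero]
  · simp only [(Fin.succ_ne_zero i).symm, if_false, Finset.sum_const_zero, zero_add, Fin.succ_inj,
      Finset.sum_ite_eq', Finset.mem_univ, if_true, consTensor_apply]
    congr 1
    funext j
    refine Fin.cases ?_ (fun j => ?_) j
    · simp [parity_pow_prod_ofFn]
    · simp

theorem Delta_mulFirst {N M : ℕ} (p : Fin (M + 1) × Fin (M + 1)) :
    V.Delta p.1 p.2 ∘ₗ V.mulFirst N M = V.mulFirst N M ∘ₗ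
      ∑ q ∈ Finset.univ.filter (fun q : Fin (N + M) × Fin (N + M) =>
        Prod.map (collapse rfl) (collapse rfl) q = p), V.Delta q.1 q.2 := by
  -- The two ends of an edge are reattached independently: the fibre over a pair is the product of
  -- the fibres.
  have hf : Finset.univ.filter (fun q : Fin (N + M) × Fin (N + M) =>
        Prod.map (collapse (rfl : N + M = N + M)) (collapse rfl) q = p) =
      Finset.univ.filter (fun u => collapse (rfl : N + M = N + M) u = p.1) ×ˢ
        Finset.univ.filter (fun u => collapse (rfl : N + M = N + M) u = p.2) := by
    ext q
    simp [Prod.ext_iff]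
  have hd : ∀ a b, (V.derivAt a p.1 * V.derivAt b p.2) ∘ₗ V.mulFirst N M = V.mulFirst N M ∘ₗ
      ∑ q ∈ Finset.univ.filter (fun u => collapse (rfl : N + M = N + M) u = p.1) ×ˢ
        Finset.univ.filter (fun u => collapse (rfl : N + M = N + M) u = p.2),
        V.derivAt a q.1 * V.derivAt b q.2 := by
    intro a b
    rw [Module.End.mul_eq_comp, LinearMap.comp_assoc, derivAt_mulFirst, ← LinearMap.comp_assoc,
      derivAt_mulFirst, LinearMap.comp_assoc, ← Module.End.mul_eq_comp, Finset.sum_mul_sum,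
      Finset.sum_product]
  rw [hf]
  refine LinearMap.ext fun t => ?_
  have hd' := fun a b => LinearMap.congr_fun (hd a b) t
  simp only [LinearMap.comp_apply, LinearMap.sum_apply, map_sum] at hd'
  simp only [Delta, LinearMap.comp_apply, LinearMap.sum_apply, LinearMap.smul_apply, map_sum,
    map_smul, hd', Finset.smul_sum]
  conv_rhs => rw [Finset.sum_comm]
  exact Finset.sum_congr rfl fun a _ => Finset.sum_comm

end NPChart

/-! ### Compatibility of the representation with insertion, relabelling and the pre-Lie product -/

theorem sgn_mul_self {K : Type*} [Field K] {k : ℕ} (σ : Equiv.Perm (Fin k)) :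
    sgn K σ * sgn K σ = 1 := by
  rcases Int.units_eq_one_or (Equiv.Perm.sign σ) with h | h <;> simp [sgn, h]

theorem relabel_mk {K : Type*} [Field K] {d N k : ℕ} (σ : Equiv.Perm (Fin N))
    (γ : Multidigraph N k) :
    relabel K d σ (Gra.mk K d γ) = Gra.mk K d (mapVert (⇑σ⁻¹) γ) := by
  have h : relabel K d σ (Gra.mk K d γ) = Finsupp.linearCombination K
    (fun γ : Multidigraph N k => Gra.mk K d (mapVert (⇑σ⁻¹) γ)) (gr K γ) := rfl
  rw [h, gr, Finsupp.linearCombination_single, one_smul]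

theorem insertFirst_mk {K : Type*} [Field K] {d M N' L j k l : ℕ} (h : N' + M = L) (hl : j + k = l)
    (γ : Multidigraph (M + 1) j) (γ' : Multidigraph N' k) :
    insertFirst K d h hl (Gra.mk K d γ) (Gra.mk K d γ') = insertGraph K d h hl γ γ' := by
  have h : insertFirst K d h hl (Gra.mk K d γ) (Gra.mk K d γ') =
    Finsupp.linearCombination K (fun γ : Multidigraph (M + 1) j =>
      Finsupp.linearCombination K fun γ' : Multidigraph N' k => insertGraph K d h hl γ γ')
      (gr K γ) (gr K γ') := rfl
  rw [h, gr, Finsupp.linearCombination_single, one_smul, gr, Finsupp.linearCombination_single,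
    one_smul]

namespace NPChart

variable {𝕜 : Type*} [RCLike 𝕜] {n : ℕ} (V : NPChart 𝕜 n)

open PiTensorProduct

theorem prod_Delta_mulFirst {N M k : ℕ} (γ : Multidigraph (M + 1) k) :
    (List.ofFn fun e => V.Delta (γ e).1 (γ e).2).prod ∘ₗ V.mulFirst N M = V.mulFirst N M ∘ₗ
      ∑ G ∈ Finset.univ.filter (fun G : Multidigraph (N + M) k => mapVert (collapse rfl) G = γ),
        (List.ofFn fun e => V.Delta (G e).1 (G e).2).prod := by
  rw [comp_prod_ofFn _ _ _ fun e => V.Delta_mulFirst (γ e)]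
  rw [prod_ofFn_sum (𝕜 := 𝕜) _ fun _ (q : Fin (N + M) × Fin (N + M)) => V.Delta q.1 q.2]
  congr 1
  refine Finset.sum_congr ?_ fun _ _ => rfl
  ext G
  simp only [Fintype.mem_piFinset, Finset.mem_filter, Finset.mem_univ, true_and, funext_iff]
  rfl

/-- Edges that come first in the order stand on the left and so act last: the inserted graph is
evaluated before the edges of the outer graph act. -/
theorem prod_Delta_appendEdges {L j k : ℕ} (G : Multidigraph L j) (G' : Multidigraph L k) :
    (List.ofFn fun e => V.Delta (appendEdges rfl G G' e).1 (appendEdges rfl G G' e).2).prod =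
      (List.ofFn fun e => V.Delta (G e).1 (G e).2).prod *
        (List.ofFn fun e => V.Delta (G' e).1 (G' e).2).prod := by
  rw [← List.prod_append, ← List.ofFn_fin_append]
  congr 2
  funext e
  refine Fin.addCases (fun a => ?_) (fun b => ?_) e <;> simp [appendEdges]

/-- The right side evaluates $\gamma'$, multiplies its factors into slot zero and then applies the
edges of $\gamma$. Pulling these edges back through that multiplication by `prod_Delta_mulFirst`
produces the sum over all reattachments that defines the insertion. -/
theorem Rep_insertGraph {M N' L j k l : ℕ} (h : N' + M = L) (hl : j + k = l)
    (γ : Multidigraph (M + 1) j) (γ' : Multidigraph N' k) (H : V.Fun) :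
    V.flowAt (insertGraph 𝕜 (n + 1) h hl γ γ') H =
      V.repGraph γ (V.consTensor (fun _ => H) (V.flowAt (Gra.mk 𝕜 (n + 1) γ') H)) := by
  subst h hl
  have hH : (tprod 𝕜 fun _ : Fin (N' + M) => H) =
      V.appendTensor (fun _ : Fin M => H) (tprod 𝕜 fun _ : Fin N' => H) := by
    rw [appendTensor_tprod]
    congr 1
    funext i
    refine Fin.addCases (fun a => ?_) (fun b => ?_) i <;> simp
  have hJ := comp_prod_ofFn (V.appendTensor (fun _ : Fin M => H))
    (fun e => V.Delta (Fin.castAdd M (γ' e).1) (Fin.castAdd M (γ' e).2))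
    (fun e => V.Delta (γ' e).1 (γ' e).2) (fun e => V.Delta_appendTensor _ _ _)
  have hC := V.prod_Delta_mulFirst (N := N') γ
  simp only [flowAt, insertGraph, map_sum, Rep_mk, repGraph_eq, LinearMap.sum_apply,
    LinearMap.comp_apply, prod_Delta_appendEdges, Module.End.mul_apply]
  -- The edges of the inserted graph touch only the first $N'$ factors, so they act before the
  -- remaining copies of $H$ are appended.
  have hJ' : (List.ofFn fun e => V.Delta (mapVert (Fin.castLE (by omega : N' ≤ N' + M)) γ' e).1
      (mapVert (Fin.castLE (by omega : N' ≤ N' + M)) γ' e).2).prod (tprod 𝕜 fun _ => H) =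
      V.appendTensor (fun _ : Fin M => H)
        ((List.ofFn fun e => V.Delta (γ' e).1 (γ' e).2).prod (tprod 𝕜 fun _ => H)) := by
    rw [hH]
    exact LinearMap.congr_fun hJ _
  rw [hJ', ← mulFirst_appendTensor]
  generalize V.appendTensor (fun _ : Fin M => H)
    ((List.ofFn fun e => V.Delta (γ' e).1 (γ' e).2).prod (tprod 𝕜 fun _ => H)) = t
  have hC' := LinearMap.congr_fun hC t
  simp only [LinearMap.comp_apply] at hC'
  rw [hC', LinearMap.sum_apply, map_sum, map_sum]
  refine Finset.sum_congr rfl fun G _ => ?_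
  exact (LinearMap.congr_fun (V.mulAll_mulFirst N' M) _).symm

theorem flowAt_add {N k : ℕ} (g g' : Gra 𝕜 (n + 1) N k) (H : V.Fun) :
    V.flowAt (g + g') H = V.flowAt g H + V.flowAt g' H := by
  simp [flowAt]

theorem flowAt_smul {N k : ℕ} (c : 𝕜) (g : Gra 𝕜 (n + 1) N k) (H : V.Fun) :
    V.flowAt (c • g) H = c • V.flowAt g H := by
  simp [flowAt]

theorem flowAt_zero {N k : ℕ} (H : V.Fun) :
    V.flowAt (0 : Gra 𝕜 (n + 1) N k) H = 0 := by
  simp [flowAt]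

/-- The representation is compatible with the partial composition. -/
theorem flowAt_insertFirst {M N' L j k l : ℕ} (h : N' + M = L) (hl : j + k = l)
    (g : Gra 𝕜 (n + 1) (M + 1) j) (g' : Gra 𝕜 (n + 1) N' k) (H : V.Fun) :
    V.flowAt (insertFirst 𝕜 (n + 1) h hl g g') H =
      V.Rep g (V.consTensor (fun _ => H) (V.flowAt g' H)) := by
  induction g using Gra.induction with
  | zero => simp [flowAt_zero]
  | add x y hx hy => rw [map_add, LinearMap.add_apply, flowAt_add, hx, hy, map_add,
      LinearMap.add_apply]
  | smul_mk c γ =>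
    rw [map_smul, LinearMap.smul_apply, flowAt_smul, map_smul, LinearMap.smul_apply]
    congr 1
    induction g' using Gra.induction with
    | zero => simp [flowAt_zero]
    | add x y hx hy => rw [map_add, flowAt_add, flowAt_add, hx, hy, map_add, map_add]
    | smul_mk c γ' =>
      rw [map_smul, flowAt_smul, flowAt_smul, insertFirst_mk, Rep_insertGraph, Rep_mk, map_smul,
        map_smul]

/-- With equal inputs an exchange of neighbours returns the same tensor, up to
$(-1)^{(n+1)^2}=(-1)^{n+1}$. Neighbouring transpositions generate all permutations. -/
theorem repGraph_mapVert_perm {M k : ℕ} {H : V.Fun} (hH : H ∈ V.homog (n + 1))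
    (σ : Equiv.Perm (Fin (M + 1))) (γ : Multidigraph (M + 1) k) :
    V.repGraph (mapVert σ γ) (tprod 𝕜 fun _ => H) =
      sgn 𝕜 σ ^ (n + 1) • V.repGraph γ (tprod 𝕜 fun _ => H) := by
  have hσ : σ ∈ Submonoid.closure
      (Set.range fun i : Fin M => Equiv.swap i.castSucc i.succ) := by
    rw [Equiv.Perm.mclosure_swap_castSucc_succ]; trivial
  induction hσ using Submonoid.closure_induction generalizing γ with
  | mem τ h =>
    obtain ⟨i, rfl⟩ := h
    have hp := V.parity_of_mem_homog hH
    have h := V.repGraph_mapVert_swap i γ (tprod 𝕜 fun _ => H)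
    rw [V.braid_tprod i (fun _ => H) _ _ hp hp, map_smul] at h
    have hs : sgn 𝕜 (Equiv.swap i.castSucc i.succ) = -1 := by
      simp [sgn, Equiv.Perm.sign_swap (Fin.castSucc_lt_succ (i := i)).ne]
    rw [hs, ← h, smul_smul]
    have : (-1 : 𝕜) ^ (n + 1) * (-1) ^ ((n + 1) * (n + 1)) = 1 := by
      rcases Nat.even_or_odd (n + 1) with hn | hn
      · rw [hn.neg_one_pow, (hn.mul_right _).neg_one_pow, one_mul]
      · rw [hn.neg_one_pow, (hn.mul hn).neg_one_pow]; norm_num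
    rw [this, one_smul]
  | one =>
    have : mapVert (⇑(1 : Equiv.Perm (Fin (M + 1)))) γ = γ := rfl
    rw [this]
    simp [sgn]
  | mul τ τ' _ _ h h' =>
    have e : mapVert ⇑(τ * τ') γ = mapVert τ (mapVert τ' γ) := rfl
    rw [e, h, h', smul_smul, ← mul_pow]
    simp [sgn]

theorem flowAt_relabel {M k : ℕ} {H : V.Fun} (hH : H ∈ V.homog (n + 1))
    (σ : Equiv.Perm (Fin (M + 1))) (g : Gra 𝕜 (n + 1) (M + 1) k) :
    V.flowAt (relabel 𝕜 (n + 1) σ g) H = sgn 𝕜 σ ^ (n + 1) • V.flowAt g H := by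
  induction g using Gra.induction with
  | zero => simp [flowAt_zero]
  | add x y hx hy => rw [map_add, flowAt_add, hx, hy, flowAt_add, smul_add]
  | smul_mk c γ =>
    have hs : sgn 𝕜 σ⁻¹ = sgn 𝕜 σ := by simp [sgn]
    rw [map_smul, flowAt_smul, flowAt_smul, smul_comm, relabel_mk]
    congr 1
    rw [flowAt, flowAt, Rep_mk, Rep_mk, V.repGraph_mapVert_perm hH, hs]

-- The twist $\mathrm{sgn}(\sigma)^{n+1}$ of the pre-Lie product meets the equal sign from
-- `flowAt_relabel`, so every unshuffle contributes the same value and only their number survives.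
open Classical in
theorem flowAt_preLie {M M' P j k l : ℕ} (hP : M + M' = P) (hl : j + k = l)
    (g : Gra 𝕜 (n + 1) (M + 1) j) (g' : Gra 𝕜 (n + 1) (M' + 1) k) {H : V.Fun}
    (hH : H ∈ V.homog (n + 1)) :
    V.flowAt (preLie 𝕜 (n + 1) hP hl g g') H =
      ((Finset.univ.filter (fun σ : Equiv.Perm (Fin (P + 1)) => IsUnshuffle (M' + 1) σ)).card : 𝕜) •
        V.Rep g (V.consTensor (fun _ => H) (V.flowAt g' H)) := by
  have key : ∀ σ : Equiv.Perm (Fin (P + 1)), V.flowAt ((sgn 𝕜 σ ^ (n + 1) •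
      (insertFirst 𝕜 (n + 1) (show M' + 1 + M = P + 1 by omega) hl).compr₂
        (relabel 𝕜 (n + 1) σ)) g g') H = V.Rep g (V.consTensor (fun _ => H) (V.flowAt g' H)) := by
    intro σ
    rw [LinearMap.smul_apply, LinearMap.smul_apply, flowAt_smul, LinearMap.compr₂_apply,
      V.flowAt_relabel hH, smul_smul, ← mul_pow, sgn_mul_self, one_pow, one_smul,
      flowAt_insertFirst]
  unfold preLie
  rw [LinearMap.sum_apply, LinearMap.sum_apply, Nat.cast_smul_eq_nsmul, ← Finset.sum_const]
  have hs : ∀ (s : Finset (Equiv.Perm (Fin (P + 1)))) (G : Equiv.Perm (Fin (P + 1)) →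
      Gra 𝕜 (n + 1) (P + 1) l), V.flowAt (∑ σ ∈ s, G σ) H = ∑ σ ∈ s, V.flowAt (G σ) H := by
    intro s G
    simp [flowAt, map_sum]
  rw [hs]
  exact Finset.sum_congr rfl fun σ _ => key σ

/-! ### The edge graph as Poisson bracket and the action of the differential -/

theorem repGraph_edge (f : Fin 2 → V.Fun) :
    V.repGraph (fun _ : Fin 1 => ((0 : Fin 2), (1 : Fin 2))) (tprod 𝕜 f) = V.bracket (f 0) (f 1) := by
  rw [repGraph_eq, LinearMap.comp_apply]
  simp only [List.ofFn_succ, List.ofFn_zero, List.prod_cons, List.prod_nil, mul_one, Delta,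
    LinearMap.sum_apply, LinearMap.smul_apply, Module.End.mul_apply, derivAt_tprod, map_sum,
    map_smul, mulAll_tprod]
  simp [bracket]

/-- Graded symmetry read off from the graph with one edge: relabelling its two vertices flips the
edge, with sign $(-1)^{n+1}$, and exchanging the inputs gives $(-1)^{pq}$. -/
theorem bracket_comm {f g : V.Fun} {p q : ℕ} (hf : V.parity f = (-1 : 𝕜) ^ p • f)
    (hg : V.parity g = (-1 : 𝕜) ^ q • g) :
    V.bracket f g = ((-1 : 𝕜) ^ (n + 1) * (-1) ^ (p * q)) • V.bracket g f := by
  have h1 := V.repGraph_mapVert_swap (0 : Fin 1) (fun _ : Fin 1 => ((0 : Fin 2), (1 : Fin 2)))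
    (tprod 𝕜 ![f, g])
  have h2 : mapVert (Equiv.swap (Fin.castSucc (0 : Fin 1)) (Fin.succ 0))
      (fun _ : Fin 1 => ((0 : Fin 2), (1 : Fin 2))) =
      flipEdge 0 (fun _ : Fin 1 => ((0 : Fin 2), (1 : Fin 2))) := by
    funext e
    fin_cases e
    simp [mapVert, flipEdge]
  rw [h2, repGraph_flipEdge, V.braid_tprod 0 ![f, g] p q hf hg, LinearMap.smul_apply, map_smul,
    repGraph_edge, repGraph_edge, smul_smul] at h1
  simpa using h1.symm

theorem Rep_edgeGraph (x y : V.Fun) :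
    V.Rep (edgeGraph 𝕜 (n + 1)) (V.consTensor (fun _ => y) x) = V.bracket x y := by
  rw [edgeGraph, Rep_mk, consTensor_apply]
  exact V.repGraph_edge _

theorem flowAt_edgeGraph (H : V.Fun) : V.flowAt (edgeGraph 𝕜 (n + 1)) H = V.bracket H H := by
  rw [edgeGraph, flowAt, Rep_mk]
  exact V.repGraph_edge _

/-- The differential of the graph complex acts as the bracket with `H`. -/
theorem exists_flowAt_graphBracket {M P k l : ℕ} (hP : 1 + M = P) (hl : 1 + k = l) :
    ∃ c : 𝕜, c ≠ 0 ∧ ∀ (V : NPChart 𝕜 n) (H : V.Ham) (g : Gra 𝕜 (n + 1) (M + 1) k),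
      V.flowAt (graphBracket 𝕜 (n + 1) hP hl (edgeGraph 𝕜 (n + 1)) g) H.1 =
        c • V.bracket (V.flowAt g H.1) H.1 := by
  classical
  -- The constant is the number of unshuffles. It is independent of the chart and of $H$, and
  -- nonzero because the identity is an unshuffle and the characteristic is zero.
  refine ⟨(Finset.univ.filter
    (fun σ : Equiv.Perm (Fin (P + 1)) => IsUnshuffle (M + 1) σ)).card, ?_, fun V H g => ?_⟩
  · rw [Nat.cast_ne_zero, Finset.card_ne_zero]
    exact ⟨1, by simp only [Finset.mem_filter, Finset.mem_univ, true_and]; intro a b h _; simpa using h⟩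
  · have h : graphBracket 𝕜 (n + 1) hP hl (edgeGraph 𝕜 (n + 1)) g =
        preLie 𝕜 (n + 1) hP hl (edgeGraph 𝕜 (n + 1)) g +
        (-(((graphDegree (n + 1) 1 1 * graphDegree (n + 1) M k).negOnePow : ℤ) : 𝕜)) •
          preLie 𝕜 (n + 1) (show M + 1 = P by omega) (show k + 1 = l by omega) g
            (edgeGraph 𝕜 (n + 1)) := by
      rw [neg_smul, ← sub_eq_add_neg]
      rfl
    -- Inserting the edge into `g` fills a slot of `g` with $\{H,H\}=0$, so the second half of the
    -- commutator vanishes whatever its sign.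
    rw [h, flowAt_add, flowAt_smul, V.flowAt_preLie _ _ _ _ H.2.1, V.flowAt_preLie _ _ _ _ H.2.1,
      flowAt_edgeGraph, H.2.2, map_zero, map_zero, smul_zero, smul_zero, add_zero, Rep_edgeGraph]

/-- With $M+1$ inputs of degree $n+1$ and $k$ edges of degree $-n$ the result has degree
$(M+1)(n+1)-kn$, which is the graph degree plus $n+1$. -/
theorem flowAt_mem_homog {M k : ℕ} {m : ℕ} {g : Gra 𝕜 (n + 1) (M + 1) k}
    (hg : graphDegree (n + 1) M k ≠ (m : ℤ) - (n + 1) → g = 0) (H : V.Ham) :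
    V.flowAt g H.1 ∈ V.homog m := by
  by_cases h : graphDegree (n + 1) M k = (m : ℤ) - (n + 1)
  · have h1 := H.2.1
    rw [← homogInt_natCast] at h1 ⊢
    have h2 := V.flowAt_mem_homogInt g h1
    have e : (((M + 1 : ℕ) : ℤ) * ((n + 1 : ℕ) : ℤ) - k * n) = m := by
      unfold graphDegree at h
      push_cast at h ⊢
      linarith
    rwa [e] at h2
  · rw [hg h, flowAt_zero]
    exact zero_mem _

theorem exists_bracket_flowAt_comm (H : V.Ham) {f : V.Fun} {m : ℕ} (hf : f ∈ V.homog m) :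
    ∃ z : 𝕜, V.bracket f H.1 = z • V.bracket H.1 f ∧ z ≠ 0 :=
  ⟨_, V.bracket_comm (V.parity_of_mem_homog hf) (V.parity_of_mem_homog H.2.1), by simp⟩

/-- Cocycles of degree zero of the graph complex act by cocycles. -/
theorem flowAt_mem_cocycles (γ : graphCocycles 𝕜 (n + 1) 0) (M k : ℕ) (H : V.Ham) :
    V.flowAt (γ.1 M k) H.1 ∈ V.cocycles H.1 (n + 1) := by
  have h0 : V.flowAt (γ.1 M k) H.1 ∈ V.homog (n + 1) :=
    V.flowAt_mem_homog (fun h => (γ.2.1 M k).1 fun h' => h (by rw [h']; push_cast; ring)) H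
  refine ⟨h0, ?_⟩
  refine LinearMap.mem_ker.2 ?_
  rw [ham_apply]
  obtain ⟨c, hc, hδ⟩ := exists_flowAt_graphBracket (𝕜 := 𝕜) (n := n) (Nat.add_comm 1 M)
    (Nat.add_comm 1 k)
  -- The component of $\delta\gamma$ with one more vertex and edge involves only the component
  -- $(M,k)$ of $\gamma$, so each component is closed by itself.
  have hγ : graphBracket 𝕜 (n + 1) (Nat.add_comm 1 M) (Nat.add_comm 1 k) (edgeGraph 𝕜 (n + 1))
      (γ.1 M k) = 0 := by
    have h := LinearMap.mem_ker.1 γ.2.2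
    exact congrFun (congrFun h (M + 1)) (k + 1)
  have h1 := hδ V H (γ.1 M k)
  rw [hγ, flowAt_zero] at h1
  obtain ⟨z, hz, hz0⟩ := V.exists_bracket_flowAt_comm H h0
  rw [hz, smul_smul] at h1
  exact (smul_eq_zero.1 h1.symm).resolve_left (mul_ne_zero hc hz0)

/-- Coboundaries of degree zero of the graph complex act by coboundaries. -/
theorem flowAt_mem_coboundaries {γ : GraphSeries 𝕜 (n + 1)}
    (hγ : γ ∈ graphCoboundaries 𝕜 (n + 1) 0) (M k : ℕ) (H : V.Ham) :
    V.flowAt (γ M k) H.1 ∈ V.coboundaries H.1 n := by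
  obtain ⟨β, hβ, rfl⟩ := hγ
  -- The differential adds a vertex and an edge, so its image has no components with a single vertex
  -- or without edges.
  rcases M with _ | M
  · have : graphDiff 𝕜 (n + 1) β 0 k = 0 := rfl
    rw [this, flowAt_zero]; exact zero_mem _
  rcases k with _ | k
  · have : graphDiff 𝕜 (n + 1) β (M + 1) 0 = 0 := rfl
    rw [this, flowAt_zero]; exact zero_mem _
  obtain ⟨c, -, hδ⟩ := exists_flowAt_graphBracket (𝕜 := 𝕜) (n := n) (Nat.add_comm 1 M)
    (Nat.add_comm 1 k)
  have h : graphDiff 𝕜 (n + 1) β (M + 1) (k + 1) = graphBracket 𝕜 (n + 1) (Nat.add_comm 1 M)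
    (Nat.add_comm 1 k) (edgeGraph 𝕜 (n + 1)) (β M k) := rfl
  -- The primitive has graph degree $-1$, hence its function has degree $n$.
  have h0 : V.flowAt (β M k) H.1 ∈ V.homog n :=
    V.flowAt_mem_homog (fun h => (hβ M k).1 fun h' => h (by rw [h']; ring)) H
  obtain ⟨z, hz, -⟩ := V.exists_bracket_flowAt_comm H h0
  rw [h, hδ, hz, smul_smul, ← ham_apply]
  exact Submodule.smul_mem _ _ ⟨_, h0, rfl⟩

end NPChart

/-! ### The flows of graph cocycles -/

/-- `Submodule.liftQ` for a target that is only an additive monoid. -/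
def quotientLift {R A B : Type*} [Ring R] [AddCommGroup A] [Module R A] [AddCommMonoid B]
    [Module R B] (S : Submodule R A) (f : A →ₗ[R] B) (h : ∀ a ∈ S, f a = 0) : (A ⧸ S) →ₗ[R] B where
  toFun := Quotient.lift f fun a b hab => by
    have h1 := h _ ((Submodule.quotientRel_def S).1 hab)
    rw [← sub_add_cancel a b, map_add, h1, zero_add]
  map_add' := by rintro ⟨a⟩ ⟨b⟩; exact map_add f a b
  map_smul' := by rintro c ⟨a⟩; exact map_smul f c a

section Flows

variable (𝕜 : Type*) [RCLike 𝕜] (n : ℕ)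

/-- The universal flow of the component of a graph cocycle with `M + 1` vertices and `k` edges. -/
def cocycleFlow (M k : ℕ) : graphCocycles 𝕜 (n + 1) 0 →ₗ[𝕜] HFlow 𝕜 n where
  toFun γ := ⟨fun V H => V.cohClass H.1 n ⟨V.flowAt (γ.1 M k) H.1, V.flowAt_mem_cocycles γ M k H⟩, by
    -- A single component of the cocycle is itself a finite formula, valid on all charts, even if
    -- the whole cocycle has infinitely many components.
    refine ⟨DirectSum.lof 𝕜 (ℕ × ℕ) (fun q => Gra 𝕜 (n + 1) (q.1 + 1) q.2) (M, k) (γ.1 M k),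
      fun V H => ?_⟩
    have h : V.evalFormula H.1 (DirectSum.lof 𝕜 (ℕ × ℕ) (fun q => Gra 𝕜 (n + 1) (q.1 + 1) q.2)
        (M, k) (γ.1 M k)) = V.flowAt (γ.1 M k) H.1 := by
      rw [NPChart.evalFormula, DirectSum.toModule_lof]
      rfl
    exact ⟨h ▸ V.flowAt_mem_cocycles γ M k H, congrArg (V.cohClass H.1 n) (Subtype.ext h.symm)⟩⟩
  map_add' γ γ' := by
    refine Subtype.ext (funext fun V => funext fun H => ?_)
    refine Eq.trans ?_ (map_add (V.cohClass H.1 n) _ _)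
    exact congrArg _ (Subtype.ext (V.flowAt_add _ _ _))
  map_smul' c γ := by
    refine Subtype.ext (funext fun V => funext fun H => ?_)
    refine Eq.trans ?_ (map_smul (V.cohClass H.1 n) c _)
    exact congrArg _ (Subtype.ext (V.flowAt_smul _ _ _))

theorem cocycleFlow_eq_zero {M k : ℕ} {γ : graphCocycles 𝕜 (n + 1) 0} (h : γ.1 M k = 0) :
    cocycleFlow 𝕜 n M k γ = 0 := by
  refine Subtype.ext (funext fun V => funext fun H => ?_)
  refine Eq.trans ?_ (map_zero (V.cohClass H.1 n))
  exact congrArg _ (Subtype.ext ((congrArg (V.flowAt · H.1) h).trans (V.flowAt_zero _)))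

theorem cocycleFlow_of_mem_coboundaries (M k : ℕ) (γ : graphCocycles 𝕜 (n + 1) 0)
    (hγ : γ ∈ (graphCoboundaries 𝕜 (n + 1) 0).submoduleOf (graphCocycles 𝕜 (n + 1) 0)) :
    cocycleFlow 𝕜 n M k γ = 0 :=
  Subtype.ext (funext fun V => funext fun H =>
    (Submodule.Quotient.mk_eq_zero _).2 (V.flowAt_mem_coboundaries hγ M k H))

/-- The universal flow of a component of a graph cohomology class. -/
def classFlow (M k : ℕ) : GraphCohomology 𝕜 (n + 1) 0 →ₗ[𝕜] HFlow 𝕜 n :=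
  quotientLift _ (cocycleFlow 𝕜 n M k) (cocycleFlow_of_mem_coboundaries 𝕜 n M k)

/-- The flows depend only on the class, so one finite representative bounds the support. This is
what makes the infinite sum in `totalFlow` additive and homogeneous. -/
theorem finite_support_classFlow (c : finiteClasses 𝕜 (n + 1) 0) :
    (Function.support fun q : ℕ × ℕ => classFlow 𝕜 n q.1 q.2 c.1).Finite := by
  obtain ⟨c, γ, hγ, rfl⟩ := c
  refine hγ.subset fun q hq h => hq ?_
  exact cocycleFlow_eq_zero 𝕜 n h

/-- The sum of the universal flows of the components of a graph cohomology class that is represented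
by a finite sum of graphs. -/
def totalFlow : finiteClasses 𝕜 (n + 1) 0 →ₗ[𝕜] HFlow 𝕜 n where
  toFun c := ∑ᶠ q : ℕ × ℕ, classFlow 𝕜 n q.1 q.2 c.1
  map_add' c c' := by
    rw [← finsum_add_distrib (finite_support_classFlow 𝕜 n c) (finite_support_classFlow 𝕜 n c')]
    simp
  map_smul' z c := by
    rw [RingHom.id_apply, smul_finsum' _ (finite_support_classFlow 𝕜 n c)]
    simp

theorem totalFlow_graphClass (γ : graphCocycles 𝕜 (n + 1) 0) (hγ : IsFinite γ.1) :
    totalFlow 𝕜 n ⟨graphClass 𝕜 (n + 1) 0 γ, γ, hγ, rfl⟩ =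
      ∑ q ∈ hγ.toFinset, classFlow 𝕜 n q.1 q.2 (graphClass 𝕜 (n + 1) 0 γ) := by
  refine finsum_eq_sum_of_support_subset _ fun q hq => ?_
  refine Finset.mem_coe.2 ((Set.Finite.mem_toFinset hγ).2 ?_)
  exact fun h => hq (cocycleFlow_eq_zero 𝕜 n h)

end Flows

open TensorProduct

/-! ### Functions on charts of degree one -/

namespace NPChart

variable {𝕜 : Type*} [RCLike 𝕜] {n : ℕ} (V : NPChart 𝕜 n)

/-- The function `f θ_{c₁} ⋯ θ_{c_l}` depends linearly on `f`. -/
def monoLin (l : List V.OddIx) : V.Smooth →ₗ[𝕜] V.Fun where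
  toFun f := V.mono f 0 l
  map_add' f g := by
    have h : V.evenMono (f + g) 0 = V.evenMono f 0 + V.evenMono g 0 := TensorProduct.add_tmul _ _ _
    rw [mono, h, add_tmul]; rfl
  map_smul' c f := by
    have h : V.evenMono (c • f) 0 = c • V.evenMono f 0 := TensorProduct.smul_tmul' _ _ _
    rw [mono, h, smul_tmul]; rfl

theorem monoLin_mul (f g : V.Smooth) (l l' : List V.OddIx) :
    V.monoLin l f * V.monoLin l' g = V.monoLin (l ++ l') (f * g) := by
  have := V.mono_mul_mono f g 0 0 l l'
  rwa [add_zero] at this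

/-- The part of a function that does not involve coordinates of positive degree. -/
def body : V.Fun →ₗ[𝕜] V.Smooth :=
  (TensorProduct.rid 𝕜 V.Smooth).toLinearMap ∘ₗ
    (TensorProduct.map LinearMap.id (MvPolynomial.aeval fun _ => (0 : 𝕜)).toLinearMap :
      V.Smooth ⊗[𝕜] MvPolynomial V.EvenIx 𝕜 →ₗ[𝕜] V.Smooth ⊗[𝕜] 𝕜) ∘ₗ
    (TensorProduct.rid 𝕜 (V.Smooth ⊗[𝕜] MvPolynomial V.EvenIx 𝕜)).toLinearMap ∘ₗ
    (TensorProduct.map LinearMap.id (ExteriorAlgebra.algebraMapInv).toLinearMap :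
      (V.Smooth ⊗[𝕜] MvPolynomial V.EvenIx 𝕜) ⊗[𝕜] V.OddFun →ₗ[𝕜]
        (V.Smooth ⊗[𝕜] MvPolynomial V.EvenIx 𝕜) ⊗[𝕜] 𝕜)

theorem body_monoLin_nil (f : V.Smooth) : V.body (V.monoLin [] f) = f := by
  have h : V.monoLin [] f = ((f ⊗ₜ[𝕜] (1 : MvPolynomial V.EvenIx 𝕜)) ⊗ₜ[𝕜] (1 : V.OddFun) :
    (V.Smooth ⊗[𝕜] MvPolynomial V.EvenIx 𝕜) ⊗[𝕜] V.OddFun) := rfl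
  rw [h]
  change TensorProduct.rid 𝕜 V.Smooth (TensorProduct.map LinearMap.id
    (MvPolynomial.aeval fun _ => (0 : 𝕜)).toLinearMap (TensorProduct.rid 𝕜
      (V.Smooth ⊗[𝕜] MvPolynomial V.EvenIx 𝕜) ((f ⊗ₜ[𝕜] (1 : MvPolynomial V.EvenIx 𝕜)) ⊗ₜ[𝕜]
        ExteriorAlgebra.algebraMapInv (1 : V.OddFun)))) = f
  rw [map_one, TensorProduct.rid_tmul, one_smul, TensorProduct.map_tmul]
  change TensorProduct.rid 𝕜 V.Smooth (f ⊗ₜ[𝕜] MvPolynomial.aeval (fun _ => (0 : 𝕜)) 1) = f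
  rw [map_one, TensorProduct.rid_tmul, one_smul]

theorem theta_mul_theta (b c : V.OddIx) : V.theta b * V.theta c = -(V.theta c * V.theta b) := by
  rw [eq_neg_iff_add_eq_zero]
  refine (CliffordAlgebra.ι_mul_ι_add_swap _ _).trans ?_
  simp [QuadraticMap.polar]

theorem monoLin_swap (b c : V.OddIx) (f : V.Smooth) :
    V.monoLin [b, c] f = -V.monoLin [c, b] f := by
  have h : ∀ b c, V.monoLin [b, c] f = V.tmul (V.evenMono f 0) (V.theta b * V.theta c) := by
    intro b c; simp [monoLin, mono]
  rw [h, h, theta_mul_theta, ← neg_one_smul 𝕜, tmul_smul, neg_one_smul]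

/-- A cyclic rotation of three anticommuting generators is an even permutation. -/
theorem monoLin_rotate (a b c : V.OddIx) (f : V.Smooth) :
    V.monoLin [b, c, a] f = V.monoLin [a, b, c] f := by
  have h : ∀ a b c, V.monoLin [a, b, c] f =
      V.tmul (V.evenMono f 0) (V.theta a * (V.theta b * V.theta c)) := by
    intro a b c; simp [monoLin, mono]
  rw [h, h, V.theta_mul_theta c a, mul_neg, ← mul_assoc, V.theta_mul_theta b a, neg_mul, neg_neg,
    mul_assoc]

/-- The recursion that evaluates derivatives of words: the derivative either hits the first letter
or passes it with a minus sign. -/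
theorem deriv_odd_cons (c b : V.OddIx) (l : List V.OddIx) (f : V.Smooth) :
    V.deriv c.1 (V.monoLin (b :: l) f) = (if b = c then V.monoLin l f else 0) -
      V.monoLin [b] 1 * V.deriv c.1 (V.monoLin l f) := by
  have h₀ : c.1.deg ≠ 0 := fun h => by have := c.2; rw [h] at this; simp at this
  have h₁ : ¬ Even c.1.deg := Nat.not_even_iff_odd.2 c.2
  have h : ∀ l, V.deriv c.1 (V.monoLin l f) =
      V.tmul (V.evenMono f 0) (V.oddPd c (l.map V.theta).prod) := by
    intro l
    unfold deriv
    rw [dif_neg h₀, dif_neg h₁]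
    rfl
  have h2 : V.oddPd c ((b :: l).map V.theta).prod =
      (Finsupp.single b (1 : 𝕜) c) • (l.map V.theta).prod -
        V.theta b * V.oddPd c (l.map V.theta).prod := by
    rw [List.map_cons, List.prod_cons]
    exact CliffordAlgebra.contractLeft_ι_mul _ _ _
  have h3 : V.monoLin [b] 1 = V.tmul 1 (V.theta b) := by simp [monoLin, mono]; rfl
  rw [h, h, h2, tmul_sub, h3, tmul_mul_tmul, one_mul]
  congr 1
  split_ifs with hb
  · subst hb
    rw [Finsupp.single_eq_same, one_smul]; rfl
  · rw [Finsupp.single_eq_of_ne (Ne.symm hb), zero_smul, tmul_zero]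

theorem deriv_odd_nil (c : V.OddIx) (f : V.Smooth) : V.deriv c.1 (V.monoLin [] f) = 0 := by
  have h₀ : c.1.deg ≠ 0 := fun h => by have := c.2; rw [h] at this; simp at this
  have h₁ : ¬ Even c.1.deg := Nat.not_even_iff_odd.2 c.2
  unfold deriv
  rw [dif_neg h₀, dif_neg h₁]
  have : V.oddPd c 1 = 0 := CliffordAlgebra.contractLeft_one _ _
  change V.tmul _ (V.oddPd c 1) = 0
  rw [this, tmul_zero]

end NPChart

/-! ### Charts of degree one: polynomials in the odd coordinates and the Schouten bracket -/

section Bivector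

variable {𝕜 : Type*} [RCLike 𝕜] (V : NPChart 𝕜 1)

/-- The odd coordinate `p_μ`. -/
abbrev pIx (μ : Fin V.m) : V.OddIx := ⟨.p μ, odd_one⟩

/-- The function `C^ν p_ν`. -/
def linFun (C : Fin V.m → V.Smooth) : V.Fun := ∑ ν, V.monoLin [pIx V ν] (C ν)

/-- The function `B^{μν} p_μ p_ν`. -/
def quadFun (B : Fin V.m → Fin V.m → V.Smooth) : V.Fun :=
  ∑ μ, ∑ ν, V.monoLin [pIx V μ, pIx V ν] (B μ ν)

/-- The function `A^{lμν} p_l p_μ p_ν`. -/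
def cubFun (A : Fin V.m → Fin V.m → Fin V.m → V.Smooth) : V.Fun :=
  ∑ l, ∑ μ, ∑ ν, V.monoLin [pIx V l, pIx V μ, pIx V ν] (A l μ ν)

theorem bivectorFun_eq (π : Fin V.m → Fin V.m → V.Smooth) :
    bivectorFun V π = (1 / 2 : 𝕜) • quadFun V π := rfl

theorem pIx_inj (μ ν : Fin V.m) : pIx V μ = pIx V ν ↔ μ = ν :=
  ⟨fun h => Coord.p.inj (congrArg Subtype.val h), fun h => h ▸ rfl⟩

theorem deriv_p_lin (ρ : Fin V.m) (C : Fin V.m → V.Smooth) :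
    V.deriv (.p ρ) (linFun V C) = V.monoLin [] (C ρ) := by
  have h : ∀ ν, V.deriv (.p ρ) (V.monoLin [pIx V ν] (C ν)) =
      if ν = ρ then V.monoLin [] (C ν) else 0 := fun ν => by
    have := V.deriv_odd_cons (pIx V ρ) (pIx V ν) [] (C ν)
    rw [V.deriv_odd_nil, mul_zero, sub_zero] at this
    simpa only [pIx_inj] using this
  simp [linFun, h]

theorem deriv_p_monoLin_two (ρ μ ν : Fin V.m) (f : V.Smooth) :
    V.deriv (.p ρ) (V.monoLin [pIx V μ, pIx V ν] f) =
      (if μ = ρ then V.monoLin [pIx V ν] f else 0) -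
        (if ν = ρ then V.monoLin [pIx V μ] f else 0) := by
  have h1 := V.deriv_odd_cons (pIx V ρ) (pIx V μ) [pIx V ν] f
  have h2 := V.deriv_odd_cons (pIx V ρ) (pIx V ν) [] f
  rw [V.deriv_odd_nil, mul_zero, sub_zero] at h2
  simp only [pIx_inj] at h1 h2
  rw [h1, h2]
  congr 1
  split_ifs
  · rw [V.monoLin_mul, one_mul]; rfl
  · rw [mul_zero]

theorem deriv_p_quad (ρ : Fin V.m) (B : Fin V.m → Fin V.m → V.Smooth) :
    V.deriv (.p ρ) (quadFun V B) = linFun V fun ν => B ρ ν - B ν ρ := by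
  simp only [quadFun, linFun, map_sum, deriv_p_monoLin_two, map_sub, Finset.sum_sub_distrib]
  congr 1
  · rw [Finset.sum_comm]
    simp
  · simp

theorem deriv_p_cub (ρ : Fin V.m) (A : Fin V.m → Fin V.m → Fin V.m → V.Smooth) :
    V.deriv (.p ρ) (cubFun V A) = quadFun V fun μ ν => A ρ μ ν - (A μ ρ ν - A μ ν ρ) := by
  have h : ∀ l μ ν f, V.deriv (.p ρ) (V.monoLin [pIx V l, pIx V μ, pIx V ν] f) =
      (if l = ρ then V.monoLin [pIx V μ, pIx V ν] f else 0) -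
        ((if μ = ρ then V.monoLin [pIx V l, pIx V ν] f else 0) -
          (if ν = ρ then V.monoLin [pIx V l, pIx V μ] f else 0)) := by
    intro l μ ν f
    have h1 := V.deriv_odd_cons (pIx V ρ) (pIx V l) [pIx V μ, pIx V ν] f
    simp only [pIx_inj] at h1
    rw [h1, deriv_p_monoLin_two, mul_sub]
    congr 2
    · split_ifs
      · rw [V.monoLin_mul, one_mul]; rfl
      · rw [mul_zero]
    · split_ifs
      · rw [V.monoLin_mul, one_mul]; rfl
      · rw [mul_zero]
  simp only [cubFun, quadFun, map_sum, h, map_sub, Finset.sum_sub_distrib]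
  congr 1
  · rw [Finset.sum_comm]
    refine Finset.sum_congr rfl fun μ _ => ?_
    rw [Finset.sum_comm]
    simp
  · congr 1
    · refine Finset.sum_congr rfl fun l _ => ?_
      rw [Finset.sum_comm]
      simp
    · simp

theorem deriv_x_quad (ρ : Fin V.m) (B : Fin V.m → Fin V.m → V.Smooth) :
    V.deriv (.x ρ) (quadFun V B) = quadFun V fun μ ν => dx V ρ (B μ ν) := by
  have h : ∀ l f, V.deriv (.x ρ) (V.monoLin l f) = V.monoLin l (dx V ρ f) := by
    intro l f
    have h₀ : (Coord.x ρ : V.Ix).deg = 0 := rfl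
    unfold NPChart.deriv
    rw [dif_pos h₀]
    rfl
  simp only [quadFun, map_sum, h]

theorem lin_mul_quad (C : Fin V.m → V.Smooth) (B : Fin V.m → Fin V.m → V.Smooth) :
    linFun V C * quadFun V B = cubFun V fun l μ ν => C l * B μ ν := by
  rw [linFun, Finset.sum_mul]
  refine Finset.sum_congr rfl fun l _ => ?_
  simp only [quadFun, Finset.mul_sum, V.monoLin_mul, List.cons_append, List.nil_append]

/-- Renaming the summation indices rotates the word $p_lp_\mu p_\nu$ cyclically, which costs no
sign. -/
theorem cub_rotate (A : Fin V.m → Fin V.m → Fin V.m → V.Smooth) :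
    cubFun V (fun l μ ν => A μ ν l) = cubFun V A := by
  unfold cubFun
  rw [Finset.sum_comm]
  refine Finset.sum_congr rfl fun μ _ => ?_
  rw [Finset.sum_comm]
  refine Finset.sum_congr rfl fun ν _ => Finset.sum_congr rfl fun l _ => ?_
  exact (V.monoLin_rotate _ _ _ _).symm

theorem quad_mul_lin (C : Fin V.m → V.Smooth) (B : Fin V.m → Fin V.m → V.Smooth) :
    quadFun V B * linFun V C = cubFun V fun l μ ν => C l * B μ ν := by
  have h : quadFun V B * linFun V C = cubFun V fun μ ν l => B μ ν * C l := by
    simp only [quadFun, linFun, cubFun, Finset.sum_mul]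
    simp only [Finset.mul_sum, V.monoLin_mul, List.cons_append, List.nil_append]
  rw [h, ← cub_rotate]
  simp only [mul_comm]

theorem cub_add (A A' : Fin V.m → Fin V.m → Fin V.m → V.Smooth) :
    cubFun V A + cubFun V A' = cubFun V fun l μ ν => A l μ ν + A' l μ ν := by
  simp only [cubFun, map_add, Finset.sum_add_distrib]

theorem cub_sum (A : Fin V.m → Fin V.m → Fin V.m → Fin V.m → V.Smooth) :
    ∑ ρ, cubFun V (A ρ) = cubFun V fun l μ ν => ∑ ρ, A ρ l μ ν := by
  simp only [cubFun, map_sum]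
  rw [Finset.sum_comm]
  refine Finset.sum_congr rfl fun l _ => ?_
  rw [Finset.sum_comm]
  refine Finset.sum_congr rfl fun μ _ => ?_
  rw [Finset.sum_comm]

/-- Both factors $p$ contribute equally by antisymmetry, and this cancels the $\tfrac12$. -/
theorem deriv_p_bivectorFun {π : Fin V.m → Fin V.m → V.Smooth} (hπ : IsBivector V π)
    (ρ : Fin V.m) : V.deriv (.p ρ) (bivectorFun V π) = linFun V (π ρ) := by
  rw [bivectorFun_eq, map_smul, deriv_p_quad]
  have : ∀ ν, π ρ ν - π ν ρ = (2 : 𝕜) • π ρ ν := fun ν => by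
    rw [hπ ρ ν, sub_neg_eq_add, two_smul]
  simp only [this, linFun, map_smul, ← Finset.smul_sum, smul_smul]
  norm_num

theorem deriv_x_bivectorFun (π : Fin V.m → Fin V.m → V.Smooth) (ρ : Fin V.m) :
    V.deriv (.x ρ) (bivectorFun V π) = (1 / 2 : 𝕜) • quadFun V fun μ ν => dx V ρ (π μ ν) := by
  rw [bivectorFun_eq, map_smul, deriv_x_quad]

/-- Differentiating by $p_\mu$ and then $p_\nu$ recovers the coefficient $\pi^{\mu\nu}$. -/
theorem bivector_ext {π π' : Fin V.m → Fin V.m → V.Smooth} (hπ : IsBivector V π)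
    (hπ' : IsBivector V π') (h : bivectorFun V π = bivectorFun V π') : π = π' := by
  funext μ ν
  have h1 := congrArg (fun f => V.body (V.deriv (.p ν) (V.deriv (.p μ) f))) h
  simpa only [deriv_p_bivectorFun V hπ, deriv_p_bivectorFun V hπ', deriv_p_lin,
    V.body_monoLin_nil] using h1

theorem bivectorFun_mem_homog (π : Fin V.m → Fin V.m → V.Smooth) :
    bivectorFun V π ∈ V.homog (1 + 1) := by
  rw [bivectorFun_eq]
  refine Submodule.smul_mem _ _ (Submodule.sum_mem _ fun μ _ => Submodule.sum_mem _ fun ν _ => ?_)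
  exact Submodule.subset_span ⟨_, _, _, rfl, by simp [Coord.deg]⟩

theorem sum_coord {A : Type*} [AddCommMonoid A] (F : V.Ix → A) :
    ∑ a, F a = ∑ μ, F (.x μ) + ∑ μ, F (.p μ) := by
  -- In degree one there are no $\xi$ because $n$ is odd, and no $\psi,\chi$ because their index
  -- type is `Fin 0`.
  have hs : IsEmpty (Fin V.s) := by rw [V.s_eq_zero odd_one]; infer_instance
  let e : Fin V.m ⊕ Fin V.m ≃ V.Ix :=
    { toFun := Sum.elim .x .p
      invFun := fun a => match a with
        | .x μ => .inl μ
        | .p μ => .inr μ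
        | .psi i _ => i.elim0
        | .chi i _ => i.elim0
        | .xi a => hs.elim a
      left_inv := by rintro (μ | μ) <;> rfl
      right_inv := by
        rintro (μ | μ | ⟨i, α⟩ | ⟨i, α⟩ | a)
        · rfl
        · rfl
        · exact i.elim0
        · exact i.elim0
        · exact hs.elim a }
  rw [← e.sum_comp, Fintype.sum_sum_type]
  rfl

/-- For even $f$ the Koszul sign is trivial, and for $n=1$ both $w^{xp}$ and $w^{px}$ equal $1$. -/
theorem bracket_of_parity {f : V.Fun} (hf : V.parity f = f) (g : V.Fun) :
    V.bracket f g = ∑ ρ, (V.deriv (.x ρ) f * V.deriv (.p ρ) g +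
      V.deriv (.p ρ) f * V.deriv (.x ρ) g) := by
  have hp : ∀ k : ℕ, (V.parity ^ k) f = f := fun k => by
    rcases Nat.even_or_odd k with h | h
    · rw [V.parity_pow_of_even h]; rfl
    · rw [V.parity_pow_of_odd h, hf]
  simp only [NPChart.bracket, hp, sum_coord]
  simp [NPChart.w, Finset.sum_add_distrib]

/-- The bracket of the functions of two bivector fields is given by their Schouten bracket. -/
theorem bracket_bivectorFun {π π' : Fin V.m → Fin V.m → V.Smooth} (hπ : IsBivector V π)
    (hπ' : IsBivector V π') :
    V.bracket (bivectorFun V π) (bivectorFun V π') =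
      (1 / 2 : 𝕜) • cubFun V (schoutenTerm V π π') := by
  have hp : V.parity (bivectorFun V π) = bivectorFun V π := by
    rw [V.parity_of_mem_homog (bivectorFun_mem_homog V π)]
    norm_num
  rw [bracket_of_parity V hp]
  simp only [deriv_p_bivectorFun V hπ, deriv_p_bivectorFun V hπ', deriv_x_bivectorFun,
    smul_mul_assoc, mul_smul_comm, lin_mul_quad, quad_mul_lin, ← smul_add, cub_add,
    ← Finset.smul_sum, cub_sum]
  congr 2
  funext l μ ν
  refine Finset.sum_congr rfl fun ρ _ => ?_
  rw [add_comm]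

theorem schoutenTerm_swap {π π' : Fin V.m → Fin V.m → V.Smooth} (hπ : IsBivector V π)
    (hπ' : IsBivector V π') (l μ ν : Fin V.m) :
    schoutenTerm V π π' l ν μ = -schoutenTerm V π π' l μ ν := by
  unfold schoutenTerm
  rw [← Finset.sum_neg_distrib]
  refine Finset.sum_congr rfl fun ρ _ => ?_
  rw [hπ μ ν, hπ' μ ν, map_neg, map_neg]
  ring

/-- A cubic function in odd variables sees only the total antisymmetrization of its coefficients.
Given antisymmetry in the last two indices, the six terms of the antisymmetrization pair up to twice
the cyclic sum. -/
theorem cubFun_eq_zero_iff {A : Fin V.m → Fin V.m → Fin V.m → V.Smooth}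
    (hA : ∀ l μ ν, A l ν μ = -A l μ ν) :
    cubFun V A = 0 ↔ ∀ l μ ν, A l μ ν + A μ ν l + A ν l μ = 0 := by
  constructor
  · intro h l μ ν
    have h1 := congrArg (fun f => V.body (V.deriv (.p ν) (V.deriv (.p μ) (V.deriv (.p l) f)))) h
    simp only [deriv_p_cub, deriv_p_quad, deriv_p_lin, V.body_monoLin_nil, map_zero] at h1
    have h2 : (2 : 𝕜) • (A l μ ν + A μ ν l + A ν l μ) = 0 := by
      rw [← h1, hA μ ν l, hA l μ ν, hA ν l μ, two_smul]
      ring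
    exact (smul_eq_zero.1 h2).resolve_left two_ne_zero
  · intro h
    have h1 := cub_rotate V A
    have h2 := cub_rotate V fun l μ ν => A μ ν l
    -- All three rotations of the coefficients define the same function, so the vanishing cyclic sum
    -- says that three times this function is zero.
    have h3 : cubFun V A + (cubFun V fun l μ ν => A μ ν l) + (cubFun V fun l μ ν => A ν l μ) = 0 := by
      rw [cub_add, cub_add]
      simp only [h]
      simp [cubFun]
    rw [h2, h1] at h3
    have h4 : (3 : 𝕜) • cubFun V A = 0 := by
      rw [← h3]; module
    exact (smul_eq_zero.1 h4).resolve_left three_ne_zero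

theorem bracket_bivectorFun_eq_zero_iff {π π' : Fin V.m → Fin V.m → V.Smooth}
    (hπ : IsBivector V π) (hπ' : IsBivector V π') :
    V.bracket (bivectorFun V π) (bivectorFun V π') = 0 ↔ ∀ l μ ν, schouten V π π' l μ ν = 0 := by
  rw [bracket_bivectorFun V hπ hπ', smul_eq_zero_iff_right (by norm_num),
    cubFun_eq_zero_iff V (schoutenTerm_swap V hπ hπ')]
  rfl

theorem bivectorFun_add (π π' : Fin V.m → Fin V.m → V.Smooth) :
    bivectorFun V (π + π') = bivectorFun V π + bivectorFun V π' := by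
  simp only [bivectorFun_eq, quadFun, Pi.add_apply, map_add, Finset.sum_add_distrib, smul_add]

theorem bivectorFun_smul (c : 𝕜) (π : Fin V.m → Fin V.m → V.Smooth) :
    bivectorFun V (c • π) = c • bivectorFun V π := by
  simp only [bivectorFun_eq, quadFun, Pi.smul_apply, map_smul, ← Finset.smul_sum]
  rw [smul_comm]

theorem exists_bivector {H : V.Fun} (hH : H ∈ V.homog 2) :
    ∃ π, IsBivector V π ∧ bivectorFun V π = H := by
  induction hH using Submodule.span_induction with
  | zero => exact ⟨0, fun μ ν => by simp, by simp [bivectorFun_eq, quadFun]⟩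
  | add x y _ _ hx hy =>
    obtain ⟨π, h, rfl⟩ := hx
    obtain ⟨π', h', rfl⟩ := hy
    exact ⟨π + π', fun μ ν => by simp [h μ ν, h' μ ν, add_comm], bivectorFun_add V π π'⟩
  | smul c x _ hx =>
    obtain ⟨π, h, rfl⟩ := hx
    exact ⟨c • π, fun μ ν => by simp [h μ ν], bivectorFun_smul V c π⟩
  | mem x h =>
    obtain ⟨f, e, l, rfl, h⟩ := h
    have hdeg : ∀ c : V.Ix, c.deg = 0 ∨ ∃ μ, c = .p μ := by
      rintro (μ | μ | ⟨i, α⟩ | ⟨i, α⟩ | a)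
      · exact Or.inl rfl
      · exact Or.inr ⟨μ, rfl⟩
      · exact i.elim0
      · exact i.elim0
      -- For $n=1$ the formula `n / 2` assigns degree $0$ to $\xi$ by integer division, so this case
      -- joins that of $x$.
      · exact Or.inl rfl
    have hE : IsEmpty V.EvenIx := ⟨fun c => by
      rcases hdeg c.1 with h | ⟨μ, h⟩
      · exact c.2.1 h
      · have := c.2.2
        rw [h] at this
        exact Nat.not_even_one this⟩
    have hO : ∀ c : V.OddIx, ∃ μ, c = pIx V μ := fun c => by
      rcases hdeg c.1 with h | ⟨μ, h⟩
      · have := c.2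
        rw [h] at this
        exact (Nat.not_odd_zero this).elim
      · exact ⟨μ, Subtype.ext h⟩
    obtain rfl : e = 0 := Subsingleton.elim _ _
    -- Every odd coordinate is some $p_\mu$ of degree $1$, so degree two means a word of two
    -- letters.
    have hl : l.length = 2 := by
      have h1 : (l.map fun c => c.1.deg) = l.map fun _ => 1 := by
        refine List.map_congr_left fun c _ => ?_
        obtain ⟨μ, rfl⟩ := hO c
        rfl
      rw [h1] at h
      simpa using h
    obtain ⟨b, c, rfl⟩ := List.length_eq_two.1 hl
    obtain ⟨μ, rfl⟩ := hO b
    obtain ⟨ν, rfl⟩ := hO c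
    -- The monomial $f\,p_\mu p_\nu$ comes from the antisymmetric matrix with $f$ at $(\mu,\nu)$ and
    -- $-f$ at $(\nu,\mu)$; for $\mu=\nu$ both sides are zero.
    refine ⟨fun i j => (if i = μ then if j = ν then f else 0 else 0) -
      (if i = ν then if j = μ then f else 0 else 0), fun i j => ?_, ?_⟩
    · dsimp only
      rw [neg_sub]
      congr 1 <;> split_ifs <;> rfl
    · have h1 : ∀ i j (μ ν : Fin V.m), V.monoLin [pIx V i, pIx V j]
          (if i = μ then if j = ν then f else 0 else 0) =
          if i = μ then if j = ν then V.monoLin [pIx V i, pIx V j] f else 0 else 0 := by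
        intro i j μ ν
        split_ifs <;> simp
      rw [bivectorFun_eq, quadFun]
      simp only [map_sub, h1, Finset.sum_sub_distrib]
      have h2 : ∀ μ ν : Fin V.m, (∑ i, ∑ j, if i = μ then
          if j = ν then V.monoLin [pIx V i, pIx V j] f else 0 else 0) =
          V.monoLin [pIx V μ, pIx V ν] f := by
        intro μ ν
        rw [Finset.sum_eq_single μ (fun i _ hi => by simp [hi]) (by simp)]
        simp
      rw [h2, h2, V.monoLin_swap (pIx V ν), sub_neg_eq_add, ← two_smul 𝕜, smul_smul]
      norm_num
      rfl

end Bivector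

end NPGraph

end

/-! ### Proof of the proposition -/

open NPGraph in
theorem mainTheorem9 (𝕜 : Type*) [RCLike 𝕜] :
    (∀ n : ℕ,
      ∃ Φ : ℕ → ℕ → (GraphCohomology 𝕜 (n + 1) 0 →ₗ[𝕜] HFlow 𝕜 n),
        (∀ (M k : ℕ) (γ : graphCocycles 𝕜 (n + 1) 0) (V : NPChart 𝕜 n) (H : V.Ham),
          V.flowAt (γ.1 M k) H.1 ∈ V.homog (n + 1) ∧
          V.bracket H.1 (V.flowAt (γ.1 M k) H.1) = 0 ∧
          ∃ hc : V.flowAt (γ.1 M k) H.1 ∈ V.cocycles H.1 (n + 1),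
            (Φ M k (graphClass 𝕜 (n + 1) 0 γ)).1 V H =
              V.cohClass H.1 n ⟨V.flowAt (γ.1 M k) H.1, hc⟩) ∧
        ∃ Ψ : finiteClasses 𝕜 (n + 1) 0 →ₗ[𝕜] HFlow 𝕜 n,
          ∀ (γ : graphCocycles 𝕜 (n + 1) 0) (hγ : IsFinite γ.1),
            Ψ ⟨graphClass 𝕜 (n + 1) 0 γ, γ, hγ, rfl⟩ =
              ∑ q ∈ hγ.toFinset, Φ q.1 q.2 (graphClass 𝕜 (n + 1) 0 γ)) ∧
    (∀ V : NPChart 𝕜 1,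
      (∀ H ∈ V.homog 2, ∃! π : Fin V.m → Fin V.m → V.Smooth,
        IsBivector V π ∧ bivectorFun V π = H) ∧
      (∀ π, IsBivector V π → (bivectorFun V π ∈ V.Ham ↔ IsPoisson V π)) ∧
      ∀ (M k : ℕ) (γ : graphCocycles 𝕜 (1 + 1) 0) (π : Fin V.m → Fin V.m → V.Smooth),
        IsPoisson V π →
          ∃ π' : Fin V.m → Fin V.m → V.Smooth, IsBivector V π' ∧
            V.flowAt (γ.1 M k) (bivectorFun V π) = bivectorFun V π' ∧
            ∀ l μ ν, schouten V π π' l μ ν = 0) := by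
  have hbr : ∀ {n M k : ℕ} (γ : graphCocycles 𝕜 (n + 1) 0) (V : NPChart 𝕜 n) (H : V.Ham),
      V.bracket H.1 (V.flowAt (γ.1 M k) H.1) = 0 := fun γ V H => by
    rw [← NPChart.ham_apply]
    exact LinearMap.mem_ker.1 (V.flowAt_mem_cocycles γ _ _ H).2
  have hHam : ∀ (V : NPChart 𝕜 1) π, IsBivector V π →
      (bivectorFun V π ∈ V.Ham ↔ IsPoisson V π) := fun V π hπ => by
    rw [IsPoisson, ← bracket_bivectorFun_eq_zero_iff V hπ hπ]
    exact ⟨fun h => ⟨hπ, h.2⟩, fun h => ⟨bivectorFun_mem_homog V π, h.2⟩⟩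
  refine ⟨fun n => ⟨classFlow 𝕜 n, fun M k γ V H => ?_, totalFlow 𝕜 n, totalFlow_graphClass 𝕜 n⟩,
    fun V => ⟨fun H hH => ?_, hHam V, fun M k γ π hπ => ?_⟩⟩
  · exact ⟨(V.flowAt_mem_cocycles γ M k H).1, hbr γ V H, V.flowAt_mem_cocycles γ M k H, rfl⟩
  · obtain ⟨π, hπ, rfl⟩ := exists_bivector V hH
    exact ⟨π, ⟨hπ, rfl⟩, fun π' h => bivector_ext V h.1 hπ h.2⟩
  · have hH := (hHam V π hπ.1).2 hπ
    -- For $n=1$ the flow has degree $d=2$, so it comes from a bivector field; its closedness under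
    -- $\{H,\cdot\}$ is then the vanishing of the mixed Schouten bracket.
    obtain ⟨π', hπ', h⟩ := exists_bivector V (V.flowAt_mem_cocycles γ M k ⟨_, hH⟩).1
    refine ⟨π', hπ', h.symm, (bracket_bivectorFun_eq_zero_iff V hπ.1 hπ').1 ?_⟩
    rw [h]
    exact hbr γ V ⟨_, hH⟩
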